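/- An \emph{oriented graph} is a finite digraph $G=(V,E)$ without self-loops and without $2$-cycles. A set $S\subseteq V$ is \emph{conflict-free} if no arc of $G$ has both endpoints in $S$; it is \emph{admissible} if it is conflict-free and, for every $v\in S$ and every arc $(u,v)\in E$, there is an arc $(w,u)\in E$ with $w\in S$. A \emph{preferred extension} of $G$ is an inclusion-wise maximal admissible set. \textbf{Theorem.} The equation $1-x^{-1}-x^{-8}=0$ has a unique positive real root $\varphi$, and $\varphi\approx 1.23205$ (rounded to five decimals), so $\varphi<1.2321$. (i) There are a single algorithm and a polynomial $q$ such that, for every oriented graph $G=(V,E)$, given by its adjacency matrix with respect to an arbitrary ordering of $V$, the algorithm lists all preferred extensions of $G$, each exactly once, in at most $q(|V|)\cdot\varphi^{|V|}$ steps, i.e. in time $O^*(\varphi^{|V|})$. Here an algorithm is a finite first-order recursive program over binary trees built from cons cells, and each elementary step (reading a variable, producing the empty tree, allocating one cell, taking a component of a cell, testing for the empty tree, making a local definition, calling a function) costs one unit of time. Such a step takes constant time on a random access machine. (ii) Every oriented graph $G=(V,E)$ has at most $\varphi^{|V|}$ preferred extensions. -/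

import Mathlib

/-! ## Argumentation frameworks -/

namespace Argumentation

variable {V : Type*}

/-- An oriented graph: a digraph with no 2-cycles (and, taking `u = v`, no self-loops). -/
def IsOriented (G : Digraph V) : Prop :=
  ∀ u v : V, G.Adj u v → ¬ G.Adj v u

/-- No arc has both endpoints in `S`. -/
def ConflictFree (G : Digraph V) (S : Set V) : Prop :=
  ∀ u ∈ S, ∀ v ∈ S, ¬ G.Adj u v

/-- Every attacker `u` of `v` is attacked by some member of `S`. -/
def Acceptable (G : Digraph V) (S : Set V) (v : V) : Prop :=
  ∀ u : V, G.Adj u v → ∃ w ∈ S, G.Adj w u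

/-- `S` is conflict-free and each of its members is acceptable with respect to `S`. -/
def Admissible (G : Digraph V) (S : Set V) : Prop :=
  ConflictFree G S ∧ ∀ v ∈ S, Acceptable G S v

/-- A preferred extension: an inclusion-wise maximal admissible set. -/
def Preferred (G : Digraph V) (S : Set V) : Prop :=
  Maximal (Admissible G) S

end Argumentation

/-! ## The machine model: first-order recursive programs over cons cells

The data are binary trees (Lisp-style cells). A program is a finite list of unary function
bodies that may call each other recursively. Every evaluation step (reading a variable, `nil`,
allocating one cell, taking a component, a nil-test, a local definition, a function call) costs
one unit; there is no other primitive, in particular no arithmetic and no comparison of trees.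
Since cells are immutable and are passed by reference, such a step takes constant time on a
random access machine. -/

namespace ConsProg

/-- The data of the programs. -/
inductive Val : Type
  | nil : Val
  | cons : Val → Val → Val

namespace Val

/-- First component (`nil` for `nil`). -/
def fst : Val → Val
  | nil => nil
  | cons a _ => a

/-- Second component (`nil` for `nil`). -/
def snd : Val → Val
  | nil => nil
  | cons _ b => b

/-- Truth values: `false` is `nil`, `true` is the cell `(nil . nil)`. -/
def ofBool : Bool → Val
  | false => nil
  | true => cons nil nil

/-- Lists as `nil`-terminated chains of cells. -/
def ofList : List Val → Val
  | [] => nil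
  | a :: l => cons a (ofList l)

end Val

/-- Expressions; variables are positions in the environment, the innermost one being `0`. -/
inductive Expr : Type
  | var (i : ℕ)
  | nil
  | cons (a b : Expr)
  | fst (a : Expr)
  | snd (a : Expr)
  | ite (c a b : Expr)
  | letIn (a b : Expr)
  | call (f : ℕ) (a : Expr)

/-- A program: the list of its function bodies. Function `0` is the main function. -/
abbrev Program : Type := List Expr

/-- `Eval P env a v t`: in program `P`, with environment `env`, the expression `a` evaluates
to `v` in exactly `t` steps (call by value). A function body sees its argument only. -/
inductive Eval (P : Program) : List Val → Expr → Val → ℕ → Prop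
  | var {env : List Val} {i : ℕ} {v : Val} :
      env[i]? = some v → Eval P env (.var i) v 1
  | nil {env : List Val} : Eval P env .nil .nil 1
  | cons {env : List Val} {a b : Expr} {v w : Val} {s t : ℕ} :
      Eval P env a v s → Eval P env b w t → Eval P env (.cons a b) (.cons v w) (s + t + 1)
  | fst {env : List Val} {a : Expr} {v : Val} {t : ℕ} :
      Eval P env a v t → Eval P env (.fst a) v.fst (t + 1)
  | snd {env : List Val} {a : Expr} {v : Val} {t : ℕ} :
      Eval P env a v t → Eval P env (.snd a) v.snd (t + 1)
  | iteCons {env : List Val} {c a b : Expr} {x y v : Val} {s t : ℕ} :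
      Eval P env c (.cons x y) s → Eval P env a v t → Eval P env (.ite c a b) v (s + t + 1)
  | iteNil {env : List Val} {c a b : Expr} {v : Val} {s t : ℕ} :
      Eval P env c .nil s → Eval P env b v t → Eval P env (.ite c a b) v (s + t + 1)
  | letIn {env : List Val} {a b : Expr} {v w : Val} {s t : ℕ} :
      Eval P env a v s → Eval P (v :: env) b w t → Eval P env (.letIn a b) w (s + t + 1)
  | call {env : List Val} {f : ℕ} {a body : Expr} {v w : Val} {s t : ℕ} :
      P[f]? = some body → Eval P env a v s → Eval P [v] body w t →
      Eval P env (.call f a) w (s + t + 1)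

/-- Evaluation is deterministic: the value and the number of steps are determined. -/
theorem Eval.unique {P : Program} {env : List Val} {a : Expr} {v w : Val} {s t : ℕ}
    (h : Eval P env a v s) (h' : Eval P env a w t) : v = w ∧ s = t := by
  induction h generalizing w t with
  | var h => cases h' with | var h' => simp_all
  | nil => cases h'; simp
  | cons _ _ ih₁ ih₂ =>
    cases h' with
    | cons h₁ h₂ =>
      obtain ⟨rfl, rfl⟩ := ih₁ h₁
      obtain ⟨rfl, rfl⟩ := ih₂ h₂
      simp
  | fst _ ih => cases h' with | fst h => obtain ⟨rfl, rfl⟩ := ih h; simp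
  | snd _ ih => cases h' with | snd h => obtain ⟨rfl, rfl⟩ := ih h; simp
  | iteCons _ _ ih₁ ih₂ =>
    cases h' with
    | iteCons h₁ h₂ =>
      obtain ⟨_, rfl⟩ := ih₁ h₁
      obtain ⟨rfl, rfl⟩ := ih₂ h₂
      simp
    | iteNil h₁ h₂ => cases (ih₁ h₁).1
  | iteNil _ _ ih₁ ih₂ =>
    cases h' with
    | iteCons h₁ h₂ => cases (ih₁ h₁).1
    | iteNil h₁ h₂ =>
      obtain ⟨_, rfl⟩ := ih₁ h₁
      obtain ⟨rfl, rfl⟩ := ih₂ h₂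
      simp
  | letIn _ _ ih₁ ih₂ =>
    cases h' with
    | letIn h₁ h₂ =>
      obtain ⟨rfl, rfl⟩ := ih₁ h₁
      obtain ⟨rfl, rfl⟩ := ih₂ h₂
      simp
  | call hb _ _ ih₁ ih₂ =>
    cases h' with
    | call hb' h₁ h₂ =>
      obtain rfl := Option.some.inj (hb.symm.trans hb')
      obtain ⟨rfl, rfl⟩ := ih₁ h₁
      obtain ⟨rfl, rfl⟩ := ih₂ h₂
      simp

/-- On input `x` the program `P` halts with output `y` after exactly `t` steps. -/
def Runs (P : Program) (x y : Val) (t : ℕ) : Prop :=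
  Eval P [x] (.call 0 (.var 0)) y t

end ConsProg

namespace Argumentation

open ConsProg

variable {V : Type*} {n : ℕ}

open Classical in
/-- A set of vertices as its membership bit vector, the vertices being listed in the order `e`. -/
noncomputable def encodeSet (e : Fin n ≃ V) (S : Set V) : Val :=
  Val.ofList (List.ofFn fun i => Val.ofBool (decide (e i ∈ S)))

/-- A digraph as its adjacency matrix, the vertices being listed in the order `e`: row `i` is
the bit vector of the set of out-neighbours of `e i`. -/
noncomputable def encodeDigraph (e : Fin n ≃ V) (G : Digraph V) : Val :=
  Val.ofList (List.ofFn fun i => encodeSet e {v | G.Adj (e i) v})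

/-- `y` is a list (in some order) of all preferred extensions of `G`, each of them once. -/
def ListsPreferred (e : Fin n ≃ V) (G : Digraph V) (y : Val) : Prop :=
  ∃ L : List (Set V), L.Nodup ∧ (∀ S : Set V, S ∈ L ↔ Preferred G S) ∧
    y = Val.ofList (L.map (encodeSet e))

/-- `P` enumerates all preferred extensions of every oriented graph, within
`O*(α ^ |V|)` steps, that is, in at most `q(|V|) * α ^ |V|` steps for a fixed polynomial `q`. -/
def EnumeratesPreferredInTime.{u} (P : Program) (α : ℝ) : Prop :=
  ∃ q : Polynomial ℕ, ∀ (V : Type u) (n : ℕ) (e : Fin n ≃ V) (G : Digraph V), IsOriented G →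
    ∃ (y : Val) (t : ℕ), Runs P (encodeDigraph e G) y t ∧ ListsPreferred e G y ∧
      (t : ℝ) ≤ ((q.eval n : ℕ) : ℝ) * α ^ n

end Argumentation

/-! ## Partial solutions -/

namespace Argumentation

section Partial

variable {V : Type*} (G : Digraph V)

/-- Adjacency in either direction. -/
def Nbr (u v : V) : Prop := G.Adj u v ∨ G.Adj v u

theorem Nbr.symm {G : Digraph V} {u v : V} (h : Nbr G u v) : Nbr G v u := Or.symm h

/-- The admissible sets between `S` and `Y`. -/
def Fam (st : Finset V × Finset V) (T : Finset V) : Prop :=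
  Admissible G (T : Set V) ∧ st.1 ⊆ T ∧ T ⊆ st.2

/-- The maximal admissible sets between `S` and `Y`. -/
def MaxFam (st : Finset V × Finset V) (T : Finset V) : Prop := Maximal (Fam G st) T

/-- No admissible set between `S` and `Y` contains `v`. -/
def Bad (st : Finset V × Finset V) (v : V) : Prop :=
  (∃ s ∈ st.1, Nbr G v s) ∨ ∃ u, G.Adj u v ∧ ∀ t ∈ st.2, G.Adj t u → Nbr G v t

/-- Every admissible set between `S` and `Y` contains `w`, as its only means of defence against
some attacker `u` of `S`. -/
def Forced (st : Finset V × Finset V) (w : V) : Prop :=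
  ∃ u, G.Adj w u ∧ (∃ v ∈ st.1, G.Adj u v) ∧ ∀ t ∈ st.2, G.Adj t u → t = w

variable {G}

theorem Fam.conflictFree {st : Finset V × Finset V} {T : Finset V} (h : Fam G st T) {u v : V}
    (hu : u ∈ T) (hv : v ∈ T) : ¬ G.Adj u v := h.1.1 u hu v hv

theorem Fam.not_nbr {st : Finset V × Finset V} {T : Finset V} (h : Fam G st T) {u v : V}
    (hu : u ∈ T) (hv : v ∈ T) : ¬ Nbr G u v := by
  rintro (h' | h')
  · exact h.conflictFree hu hv h'
  · exact h.conflictFree hv hu h'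

theorem Fam.not_bad {st : Finset V × Finset V} {T : Finset V} (h : Fam G st T) {v : V}
    (hv : v ∈ T) : ¬ Bad G st v := by
  rintro (⟨s, hs, hvs⟩ | ⟨u, huv, hu⟩)
  · exact h.not_nbr hv (h.2.1 hs) hvs
  · obtain ⟨t, ht, htu⟩ := h.1.2 v hv u huv
    exact h.not_nbr hv ht (hu t (h.2.2 ht) htu)

theorem Fam.forced {st : Finset V × Finset V} {T : Finset V} (h : Fam G st T) {w : V}
    (hw : Forced G st w) : w ∈ T := by
  obtain ⟨u, -, ⟨v, hv, huv⟩, hu⟩ := hw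
  obtain ⟨t, ht, htu⟩ := h.1.2 v (h.2.1 hv) u huv
  exact hu t (h.2.2 ht) htu ▸ ht

end Partial

section Finite

open Classical

variable {V : Type*} [Fintype V] (G : Digraph V)

/-- One round of propagation. -/
noncomputable def step (st : Finset V × Finset V) : Finset V × Finset V :=
  (Finset.univ.filter fun w => w ∈ st.1 ∨ Forced G st w,
   Finset.univ.filter fun v => v ∈ st.2 ∧ ¬ Bad G st v)

/-- The result of propagation. -/
noncomputable def norm (st : Finset V × Finset V) : Finset V × Finset V :=
  (step G)^[Fintype.card V + Fintype.card V] st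

/-- Removes the members of `C` without an in-neighbour or without an out-neighbour in `C`. -/
noncomputable def coreStep (C : Finset V) : Finset V :=
  Finset.univ.filter fun v => v ∈ C ∧ (∃ u ∈ C, G.Adj u v) ∧ ∃ u ∈ C, G.Adj v u

/-- The largest subset of `U` with all its in-degrees and out-degrees positive. -/
noncomputable def core (U : Finset V) : Finset V := (coreStep G)^[Fintype.card V] U

/-- The measure of a partial solution. -/
noncomputable def mu (st : Finset V × Finset V) : ℕ :=
  (core G ((norm G st).2 \ (norm G st).1)).card

/-- Removes the members of `X` that are not acceptable. -/
noncomputable def accStep (X : Finset V) : Finset V :=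
  Finset.univ.filter fun v => v ∈ X ∧ ∀ u, G.Adj u v → ∃ w ∈ X, G.Adj w u

/-- The largest subset of `X` that defends itself. -/
noncomputable def defended (X : Finset V) : Finset V := (accStep G)^[Fintype.card V] X

variable {G}

theorem step_fst_subset (st : Finset V × Finset V) : st.1 ⊆ (step G st).1 := by
  intro x hx
  simp [step, hx]

theorem step_snd_subset (st : Finset V × Finset V) : (step G st).2 ⊆ st.2 := by
  intro x hx
  simp [step] at hx
  exact hx.1

theorem fam_step {st : Finset V × Finset V} {T : Finset V} : Fam G (step G st) T ↔ Fam G st T := by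
  constructor
  · rintro ⟨h, h₁, h₂⟩
    exact ⟨h, (step_fst_subset st).trans h₁, h₂.trans (step_snd_subset st)⟩
  · intro h
    refine ⟨h.1, fun x hx => ?_, fun x hx => ?_⟩
    · simp only [step, Finset.mem_filter, Finset.mem_univ, true_and] at hx
      exact hx.elim (fun hx => h.2.1 hx) h.forced
    · simp only [step, Finset.mem_filter, Finset.mem_univ, true_and]
      exact ⟨h.2.2 hx, h.not_bad hx⟩

theorem fam_norm {st : Finset V × Finset V} {T : Finset V} : Fam G (norm G st) T ↔ Fam G st T := by
  rw [norm]
  induction Fintype.card V + Fintype.card V with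
  | zero => rfl
  | succ k ih => rw [Function.iterate_succ_apply', fam_step, ih]

theorem maxFam_norm {st : Finset V × Finset V} {T : Finset V} :
    MaxFam G (norm G st) T ↔ MaxFam G st T := by
  have : Fam G (norm G st) = Fam G st := funext fun T => propext fam_norm
  rw [MaxFam, MaxFam, this]

theorem norm_subset (st : Finset V × Finset V) :
    st.1 ⊆ (norm G st).1 ∧ (norm G st).2 ⊆ st.2 := by
  rw [norm]
  induction Fintype.card V + Fintype.card V with
  | zero => exact ⟨subset_rfl, subset_rfl⟩
  | succ k ih =>
    rw [Function.iterate_succ_apply']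
    exact ⟨ih.1.trans (step_fst_subset _), (step_snd_subset _).trans ih.2⟩

/-- Iterating a map with a strictly decreasing potential reaches a fixed point. -/
theorem iterate_fixed {α : Type*} (f : α → α) (p : α → ℕ) (hp : ∀ a, f a ≠ a → p (f a) < p a)
    {k : ℕ} {a : α} (hk : p a ≤ k) : f (f^[k] a) = f^[k] a := by
  induction k generalizing a with
  | zero =>
    by_contra h
    have := hp a h
    omega
  | succ k ih =>
    rw [Function.iterate_succ_apply]
    by_cases h : f a = a
    · rw [h, Function.iterate_fixed h]
      exact h
    · have := hp a h
      exact ih (by omega)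

theorem step_norm (st : Finset V × Finset V) : step G (norm G st) = norm G st := by
  refine iterate_fixed (step G) (fun s => (s.1)ᶜ.card + s.2.card) (fun s hs => ?_) ?_
  · have h₁ : (step G s).1ᶜ ⊆ s.1ᶜ := Finset.compl_subset_compl.2 (step_fst_subset s)
    have h₂ := step_snd_subset (G := G) s
    by_contra hlt
    have c₁ := Finset.card_le_card h₁
    have c₂ := Finset.card_le_card h₂
    have e₁ := Finset.eq_of_subset_of_card_le h₁ (by omega)
    have e₂ := Finset.eq_of_subset_of_card_le h₂ (by omega)
    exact hs (Prod.ext (compl_injective e₁) e₂)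
  · exact add_le_add (Finset.card_le_univ _) (Finset.card_le_univ _)

theorem coreStep_subset (C : Finset V) : coreStep G C ⊆ C := by
  intro x hx
  simp [coreStep] at hx
  exact hx.1

theorem coreStep_core (U : Finset V) : coreStep G (core G U) = core G U := by
  refine iterate_fixed (coreStep G) Finset.card (fun s hs => ?_) (Finset.card_le_univ _)
  exact Finset.card_lt_card ((coreStep_subset s).ssubset_of_ne hs)

theorem core_subset (U : Finset V) : core G U ⊆ U := by
  rw [core]
  induction Fintype.card V with
  | zero => exact subset_rfl
  | succ k ih =>
    rw [Function.iterate_succ_apply']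
    exact (coreStep_subset _).trans ih

theorem subset_core {C U : Finset V} (h : C ⊆ U)
    (hC : ∀ v ∈ C, (∃ u ∈ C, G.Adj u v) ∧ ∃ u ∈ C, G.Adj v u) : C ⊆ core G U := by
  rw [core]
  induction Fintype.card V with
  | zero => exact h
  | succ k ih =>
    rw [Function.iterate_succ_apply']
    intro v hv
    obtain ⟨⟨a, ha, hav⟩, b, hb, hvb⟩ := hC v hv
    simp only [coreStep, Finset.mem_filter, Finset.mem_univ, true_and]
    exact ⟨ih hv, ⟨a, ih ha, hav⟩, b, ih hb, hvb⟩

theorem core_in {U : Finset V} {v : V} (h : v ∈ core G U) : ∃ u ∈ core G U, G.Adj u v := by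
  rw [← coreStep_core] at h
  simp only [coreStep, Finset.mem_filter, Finset.mem_univ, true_and] at h
  exact h.2.1

theorem core_out {U : Finset V} {v : V} (h : v ∈ core G U) : ∃ u ∈ core G U, G.Adj v u := by
  rw [← coreStep_core] at h
  simp only [coreStep, Finset.mem_filter, Finset.mem_univ, true_and] at h
  exact h.2.2

theorem core_mono {U U' : Finset V} (h : U ⊆ U') : core G U ⊆ core G U' :=
  subset_core ((core_subset U).trans h) fun _ hv => ⟨core_in hv, core_out hv⟩

theorem accStep_subset (X : Finset V) : accStep G X ⊆ X := by
  intro x hx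
  simp [accStep] at hx
  exact hx.1

theorem accStep_defended (X : Finset V) : accStep G (defended G X) = defended G X := by
  refine iterate_fixed (accStep G) Finset.card (fun s hs => ?_) (Finset.card_le_univ _)
  exact Finset.card_lt_card ((accStep_subset s).ssubset_of_ne hs)

theorem defended_subset (X : Finset V) : defended G X ⊆ X := by
  rw [defended]
  induction Fintype.card V with
  | zero => exact subset_rfl
  | succ k ih =>
    rw [Function.iterate_succ_apply']
    exact (accStep_subset _).trans ih

theorem subset_defended {T X : Finset V} (h : T ⊆ X)
    (hT : ∀ v ∈ T, ∀ u, G.Adj u v → ∃ w ∈ T, G.Adj w u) : T ⊆ defended G X := by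
  rw [defended]
  induction Fintype.card V with
  | zero => exact h
  | succ k ih =>
    rw [Function.iterate_succ_apply']
    intro v hv
    simp only [accStep, Finset.mem_filter, Finset.mem_univ, true_and]
    refine ⟨ih hv, fun u hu => ?_⟩
    obtain ⟨w, hw, hwu⟩ := hT v hv u hu
    exact ⟨w, ih hw, hwu⟩

theorem admissible_defended {X : Finset V} (h : ConflictFree G (X : Set V)) :
    Admissible G (defended G X : Set V) := by
  refine ⟨fun u hu v hv => h u (defended_subset X hu) v (defended_subset X hv), fun v hv u hu => ?_⟩
  have hv' : v ∈ accStep G (defended G X) := by rw [accStep_defended]; exact hv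
  simp only [accStep, Finset.mem_filter, Finset.mem_univ, true_and] at hv'
  exact hv'.2 u hu

theorem subset_defended_of_admissible {T X : Finset V} (h : T ⊆ X)
    (hT : Admissible G (T : Set V)) : T ⊆ defended G X :=
  subset_defended h fun v hv u hu => by simpa using hT.2 v hv u hu

/-- Branching on a vertex: the maximal sets of the branch without `w` are maximal, unless they
arise from a maximal set of the other branch by removing `w`. -/
theorem maxFam_branch {S Y : Finset V} (w : V) (T : Finset V) :
    MaxFam G (S, Y) T ↔ MaxFam G (insert w S, Y) T ∨
      (MaxFam G (S, Y.erase w) T ∧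
        ∀ T', MaxFam G (insert w S, Y) T' → T ≠ defended G (T'.erase w)) := by
  have fam₁ : ∀ {T}, Fam G (insert w S, Y) T ↔ Fam G (S, Y) T ∧ w ∈ T := by
    intro T
    simp only [Fam, Finset.insert_subset_iff]
    tauto
  have fam₀ : ∀ {T}, Fam G (S, Y.erase w) T ↔ Fam G (S, Y) T ∧ w ∉ T := by
    intro T
    simp only [Fam, Finset.subset_erase]
    tauto
  have adm : ∀ {T'}, Fam G (insert w S, Y) T' → Admissible G (defended G (T'.erase w) : Set V) :=
    fun {T'} h => admissible_defended fun u hu v hv =>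
      h.conflictFree (Finset.mem_of_mem_erase hu) (Finset.mem_of_mem_erase hv)
  constructor
  · intro h
    by_cases hw : w ∈ T
    · left
      exact ⟨fam₁.2 ⟨h.prop, hw⟩, fun T' hT' hle => h.le_of_ge (fam₁.1 hT').1 hle⟩
    · right
      refine ⟨⟨fam₀.2 ⟨h.prop, hw⟩, fun T' hT' hle => h.le_of_ge (fam₀.1 hT').1 hle⟩, ?_⟩
      rintro T' hT' rfl
      have := h.le_of_ge (fam₁.1 hT'.prop).1
        ((defended_subset _).trans (Finset.erase_subset _ _))
      exact hw (this (fam₁.1 hT'.prop).2)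
  · rintro (h | ⟨h, hne⟩)
    · exact ⟨(fam₁.1 h.prop).1, fun T' hT' hle =>
        h.le_of_ge (fam₁.2 ⟨hT', hle (fam₁.1 h.prop).2⟩) hle⟩
    · refine ⟨(fam₀.1 h.prop).1, fun T₂ hT₂ hle => ?_⟩
      by_cases hw : w ∈ T₂
      · exfalso
        obtain ⟨T', hle', hT'⟩ := (Set.toFinite {T | Fam G (insert w S, Y) T}).exists_le_maximal
          (fam₁.2 ⟨hT₂, hw⟩)
        have hsub : T ⊆ T'.erase w :=
          Finset.subset_erase.2 ⟨hle.trans hle', (fam₀.1 h.prop).2⟩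
        have hsub' := subset_defended_of_admissible hsub h.prop.1
        refine hne T' hT' (hsub'.antisymm (h.le_of_ge ⟨adm hT'.prop, ?_, ?_⟩ hsub'))
        · exact h.prop.2.1.trans hsub'
        · refine (defended_subset _).trans (Finset.erase_subset_erase _ ?_)
          exact hT'.prop.2.2
      · exact h.le_of_ge (fam₀.2 ⟨hT₂, hw⟩) hle

/-- In a propagated partial solution, an undecided vertex has no neighbour in `S`, and each of its
attackers has a possible attacker. -/
theorem not_bad_of_stable {st : Finset V × Finset V} (h : step G st = st) {v : V} (hv : v ∈ st.2) :
    ¬ Bad G st v := by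
  have : v ∈ (step G st).2 := by rw [h]; exact hv
  simp only [step, Finset.mem_filter, Finset.mem_univ, true_and] at this
  exact this.2

theorem exists_defender {st : Finset V × Finset V} (h : step G st = st) {u v : V}
    (hv : v ∈ st.2) (huv : G.Adj u v) : ∃ t ∈ st.2, G.Adj t u ∧ ¬ Nbr G v t := by
  have := not_bad_of_stable h hv
  rw [Bad, not_or] at this
  have := this.2
  push Not at this
  exact this u huv

theorem not_nbr_of_stable {st : Finset V × Finset V} (h : step G st = st) {v s : V}
    (hv : v ∈ st.2) (hs : s ∈ st.1) : ¬ Nbr G v s := fun hvs =>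
  not_bad_of_stable h hv (Or.inl ⟨s, hs, hvs⟩)

/-- Every possible attacker of a core vertex is in the core. -/
theorem mem_core_of_adj {st : Finset V × Finset V} (h : step G st = st) {t c : V}
    (hc : c ∈ core G (st.2 \ st.1)) (ht : t ∈ st.2) (htc : G.Adj t c) :
    t ∈ core G (st.2 \ st.1) := by
  set U := st.2 \ st.1 with hU
  have memU : ∀ {c t}, c ∈ U → t ∈ st.2 → G.Adj t c → t ∈ U := by
    intro c t hc ht htc
    rw [hU, Finset.mem_sdiff] at hc ⊢
    exact ⟨ht, fun hs => not_nbr_of_stable h hc.1 hs (Or.inr htc)⟩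
  let R : Finset V := U.filter fun x =>
    ∃ c ∈ core G U, Relation.ReflTransGen (fun a b => a ∈ U ∧ b ∈ U ∧ G.Adj a b) x c
  have hR : R ⊆ core G U := by
    refine subset_core (Finset.filter_subset _ _) fun v hv => ?_
    obtain ⟨hvU, c, hc, hvc⟩ := Finset.mem_filter.1 hv
    have hout : ∃ y ∈ R, G.Adj v y := by
      rcases Relation.ReflTransGen.cases_head hvc with rfl | ⟨y, ⟨-, hy, hvy⟩, hyc⟩
      · obtain ⟨y, hy, hvy⟩ := core_out hc
        exact ⟨y, Finset.mem_filter.2 ⟨core_subset _ hy, y, hy, .refl⟩, hvy⟩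
      · exact ⟨y, Finset.mem_filter.2 ⟨hy, c, hc, hyc⟩, hvy⟩
    refine ⟨?_, hout⟩
    obtain ⟨y, hy, hvy⟩ := hout
    have hyU := (Finset.mem_filter.1 hy).1
    obtain ⟨t, ht, htv, -⟩ := exists_defender h (Finset.mem_sdiff.1 hyU).1 hvy
    have htU := memU hvU ht htv
    exact ⟨t, Finset.mem_filter.2 ⟨htU, c, hc, .head ⟨htU, hvU, htv⟩ hvc⟩, htv⟩
  have htU := memU (core_subset _ hc) ht htc
  exact hR (Finset.mem_filter.2 ⟨htU, c, hc, .single ⟨htU, core_subset _ hc, htc⟩⟩)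

/-- If the core is empty, no arc joins two undecided vertices. -/
theorem not_adj_of_core_eq_empty {st : Finset V × Finset V} (h : step G st = st)
    (hc : core G (st.2 \ st.1) = ∅) {u v : V} (hu : u ∈ st.2 \ st.1) (hv : v ∈ st.2 \ st.1) :
    ¬ G.Adj u v := by
  intro huv
  set U := st.2 \ st.1 with hU
  let R : Finset V := U.filter fun x => ∃ y ∈ U, G.Adj x y
  -- every member of `R` has an in-neighbour in `R`
  have hin : ∀ x ∈ R, ∃ t ∈ R, G.Adj t x := by
    intro x hx
    obtain ⟨hxU, y, hy, hxy⟩ := Finset.mem_filter.1 hx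
    obtain ⟨t, ht, htx, -⟩ := exists_defender h (Finset.mem_sdiff.1 hy).1 hxy
    have htU : t ∈ U := by
      rw [hU, Finset.mem_sdiff] at hxU ⊢
      exact ⟨ht, fun hs => not_nbr_of_stable h hxU.1 hs (Or.inr htx)⟩
    exact ⟨t, Finset.mem_filter.2 ⟨htU, x, hxU, htx⟩, htx⟩
  have huR : u ∈ R := Finset.mem_filter.2 ⟨hu, v, hv, huv⟩
  -- a backward walk within `R` repeats a vertex
  choose! f hf hfadj using hin
  have hmem : ∀ k, f^[k] u ∈ R := by
    intro k
    induction k with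
    | zero => exact huR
    | succ k ih => rw [Function.iterate_succ_apply']; exact hf _ ih
  obtain ⟨i, j, hij, heq⟩ := Finite.exists_ne_map_eq_of_infinite fun k => f^[k] u
  wlog hlt : i < j generalizing i j
  · exact this j i hij.symm heq.symm (by omega)
  have hadj : ∀ k, G.Adj (f^[k+1] u) (f^[k] u) := by
    intro k
    rw [Function.iterate_succ_apply']
    exact hfadj _ (hmem k)
  let Z : Finset V := (Finset.Ico i j).image fun k => f^[k] u
  have hZ : Z ⊆ core G U := by
    refine subset_core (fun x hx => ?_) fun x hx => ?_
    · obtain ⟨k, -, rfl⟩ := Finset.mem_image.1 hx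
      exact (Finset.mem_filter.1 (hmem k)).1
    · obtain ⟨k, hk, rfl⟩ := Finset.mem_image.1 hx
      rw [Finset.mem_Ico] at hk
      constructor
      · by_cases hkj : k + 1 = j
        · refine ⟨f^[i] u, Finset.mem_image.2 ⟨i, Finset.mem_Ico.2 ⟨le_rfl, hlt⟩, rfl⟩, ?_⟩
          have := hadj k
          rw [hkj] at this
          simpa only [heq] using this
        · exact ⟨f^[k+1] u, Finset.mem_image.2 ⟨k+1, Finset.mem_Ico.2 ⟨by omega, by omega⟩, rfl⟩,
            hadj k⟩
      · by_cases hki : k = i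
        · refine ⟨f^[j-1] u, Finset.mem_image.2 ⟨j-1, Finset.mem_Ico.2 ⟨by omega, by omega⟩, rfl⟩, ?_⟩
          have := hadj (j-1)
          rw [Nat.sub_add_cancel (by omega)] at this
          rw [hki, heq]
          exact this
        · refine ⟨f^[k-1] u, Finset.mem_image.2 ⟨k-1, Finset.mem_Ico.2 ⟨by omega, by omega⟩, rfl⟩, ?_⟩
          have := hadj (k-1)
          rwa [Nat.sub_add_cancel (by omega)] at this
  have : f^[i] u ∈ core G U := hZ (Finset.mem_image.2 ⟨i, Finset.mem_Ico.2 ⟨le_rfl, hlt⟩, rfl⟩)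
  rw [hc] at this
  simp at this

/-- Without a core, there is at most one maximal set. -/
theorem maxFam_of_core_eq_empty {st : Finset V × Finset V} (h : step G st = st)
    (hc : core G (st.2 \ st.1) = ∅) (T : Finset V) :
    MaxFam G st T ↔ ConflictFree G (st.2 : Set V) ∧ st.1 ⊆ defended G st.2 ∧
      T = defended G st.2 := by
  have key : ConflictFree G (st.2 : Set V) → ∀ T, Fam G st T → T ⊆ defended G st.2 :=
    fun _ T hT => subset_defended_of_admissible hT.2.2 hT.1
  have cf : ∀ T, Fam G st T → ConflictFree G (st.2 : Set V) := by
    intro T hT u hu v hv huv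
    rw [Finset.mem_coe] at hu hv
    by_cases hus : u ∈ st.1
    · exact not_nbr_of_stable h hv hus (Or.inr huv)
    · by_cases hvs : v ∈ st.1
      · exact not_nbr_of_stable h hu hvs (Or.inl huv)
      · exact not_adj_of_core_eq_empty h hc (Finset.mem_sdiff.2 ⟨hu, hus⟩)
          (Finset.mem_sdiff.2 ⟨hv, hvs⟩) huv
  constructor
  · intro hT
    have hcf := cf T hT.prop
    have hsub := key hcf T hT.prop
    have hS := hT.prop.2.1.trans hsub
    exact ⟨hcf, hS, hsub.antisymm
      (hT.le_of_ge ⟨admissible_defended hcf, hS, defended_subset _⟩ hsub)⟩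
  · rintro ⟨hcf, hS, rfl⟩
    exact ⟨⟨admissible_defended hcf, hS, defended_subset _⟩, fun T' hT' _ => key hcf T' hT'⟩

end Finite

end Argumentation

/-! ## The choice of a branching -/

namespace Argumentation

section Branching

open Classical

variable {V : Type*} (G : Digraph V)

/-- The in-neighbours of `v` in `C`. -/
noncomputable def inNbrs (C : Finset V) (v : V) : Finset V := C.filter fun u => G.Adj u v

/-- The out-neighbours of `v` in `C`. -/
noncomputable def outNbrs (C : Finset V) (v : V) : Finset V := C.filter fun u => G.Adj v u

/-- The closed neighbourhood of `v` in `C`. -/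
noncomputable def closedNbrs (C : Finset V) (v : V) : Finset V :=
  insert v (inNbrs G C v ∪ outNbrs G C v)

/-- `D` is a possible core after choosing `v` and excluding `Z`, starting from the core `C`. -/
structure InBranch (C D Z : Finset V) (v : V) : Prop where
  subset : D ⊆ C
  not_mem : v ∉ D
  not_nbr : ∀ x, Nbr G v x → x ∉ D
  excluded : ∀ x ∈ Z, x ∉ D
  exists_in : ∀ x ∈ D, ∃ y ∈ D, G.Adj y x
  exists_out : ∀ x ∈ D, ∃ y ∈ D, G.Adj x y
  forced : ∀ u ∈ C, ∀ w, G.Adj u v → G.Adj w u →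
    (∀ t ∈ C, G.Adj t u → ¬ Nbr G t v → t = w) → w ∉ D

/-- `D` is a possible core after excluding `Z`, starting from the core `C`. -/
structure OutBranch (C D Z : Finset V) : Prop where
  subset : D ⊆ C
  excluded : ∀ x ∈ Z, x ∉ D
  exists_in : ∀ x ∈ D, ∃ y ∈ D, G.Adj y x
  exists_out : ∀ x ∈ D, ∃ y ∈ D, G.Adj x y
  undefended : ∀ u ∈ C, ∀ p, G.Adj u p → (∀ t ∈ C, G.Adj t u → t ∈ Z) → p ∉ D

variable {G}

theorem mem_inNbrs {C : Finset V} {u v : V} : u ∈ inNbrs G C v ↔ u ∈ C ∧ G.Adj u v := by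
  simp [inNbrs]

theorem mem_outNbrs {C : Finset V} {u v : V} : u ∈ outNbrs G C v ↔ u ∈ C ∧ G.Adj v u := by
  simp [outNbrs]

theorem mem_closedNbrs {C : Finset V} {u v : V} :
    u ∈ closedNbrs G C v ↔ u = v ∨ u ∈ C ∧ Nbr G v u := by
  simp only [closedNbrs, Finset.mem_insert, Finset.mem_union, mem_inNbrs, mem_outNbrs, Nbr]
  tauto

theorem IsOriented.irrefl (hG : IsOriented G) (v : V) : ¬ G.Adj v v := fun h => hG v v h h

theorem IsOriented.ne (hG : IsOriented G) {u v : V} (h : G.Adj u v) : u ≠ v := by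
  rintro rfl
  exact hG.irrefl u h

theorem IsOriented.ne_of_adj_adj (hG : IsOriented G) {u v w : V} (h : G.Adj u v)
    (h' : G.Adj v w) : u ≠ w := by
  rintro rfl
  exact hG _ _ h h'

theorem card_closedNbrs (hG : IsOriented G) (C : Finset V) (v : V) :
    (closedNbrs G C v).card = (inNbrs G C v).card + (outNbrs G C v).card + 1 := by
  rw [closedNbrs, Finset.card_insert_of_notMem, Finset.card_union_of_disjoint]
  · rw [Finset.disjoint_left]
    intro x hx hx'
    exact hG _ _ (mem_inNbrs.1 hx).2 (mem_outNbrs.1 hx').2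
  · simp [mem_inNbrs, mem_outNbrs, hG.irrefl]

theorem closedNbrs_subset {C : Finset V} {v : V} (hv : v ∈ C) : closedNbrs G C v ⊆ C := by
  intro x hx
  rcases mem_closedNbrs.1 hx with rfl | hx
  · exact hv
  · exact hx.1

theorem card_add_card_le {C D R : Finset V} (hD : D ⊆ C) (hR : R ⊆ C) (h : ∀ x ∈ R, x ∉ D) :
    D.card + R.card ≤ C.card := by
  rw [← Finset.card_union_of_disjoint (Finset.disjoint_right.2 h)]
  exact Finset.card_le_card (Finset.union_subset hD hR)

theorem InBranch.not_mem_of_closedNbrs {C D Z : Finset V} {v x : V} (h : InBranch G C D Z v)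
    (hx : x ∈ closedNbrs G C v) : x ∉ D := by
  rcases mem_closedNbrs.1 hx with rfl | hx
  · exact h.not_mem
  · exact h.not_nbr x hx.2

theorem InBranch.drop (hG : IsOriented G) {C D Z : Finset V} {v : V} (h : InBranch G C D Z v)
    (hv : v ∈ C) :
    D.card + ((inNbrs G C v).card + (outNbrs G C v).card + 1) ≤ C.card := by
  rw [← card_closedNbrs hG]
  exact card_add_card_le h.subset (closedNbrs_subset hv) fun x hx => h.not_mem_of_closedNbrs hx

theorem InBranch.drop_insert (hG : IsOriented G) {C D Z : Finset V} {v x : V}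
    (h : InBranch G C D Z v) (hv : v ∈ C) (hx : x ∈ C) (hxv : x ≠ v) (hn : ¬ Nbr G v x)
    (hxD : x ∉ D) :
    D.card + ((inNbrs G C v).card + (outNbrs G C v).card + 2) ≤ C.card := by
  have hx' : x ∉ closedNbrs G C v := by
    rw [mem_closedNbrs]
    tauto
  have := card_add_card_le (R := insert x (closedNbrs G C v)) h.subset
    (Finset.insert_subset hx (closedNbrs_subset hv)) fun y hy => by
      rcases Finset.mem_insert.1 hy with rfl | hy
      · exact hxD
      · exact h.not_mem_of_closedNbrs hy
  rw [Finset.card_insert_of_notMem hx', card_closedNbrs hG] at this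
  exact this

theorem not_mem_of_inNbrs {C D : Finset V} (hD : D ⊆ C) (h : ∀ x ∈ D, ∃ y ∈ D, G.Adj y x) {u : V}
    (hu : ∀ w ∈ inNbrs G C u, w ∉ D) : u ∉ D := by
  intro huD
  obtain ⟨y, hy, hyu⟩ := h u huD
  exact hu y (mem_inNbrs.2 ⟨hD hy, hyu⟩) hy

theorem not_mem_of_outNbrs {C D : Finset V} (hD : D ⊆ C) (h : ∀ x ∈ D, ∃ y ∈ D, G.Adj x y) {u : V}
    (hu : ∀ w ∈ outNbrs G C u, w ∉ D) : u ∉ D := by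
  intro huD
  obtain ⟨y, hy, hyu⟩ := h u huD
  exact hu y (mem_outNbrs.2 ⟨hD hy, hyu⟩) hy

theorem OutBranch.drop (hG : IsOriented G) {C D Z : Finset V} {u : V} (h : OutBranch G C D Z)
    (hu : u ∈ C) (hZ : inNbrs G C u ⊆ Z) :
    D.card + ((inNbrs G C u).card + (outNbrs G C u).card + 1) ≤ C.card := by
  rw [← card_closedNbrs hG]
  refine card_add_card_le h.subset (closedNbrs_subset hu) fun x hx => ?_
  rcases mem_closedNbrs.1 hx with rfl | ⟨hxC, hx | hx⟩
  · exact not_mem_of_inNbrs h.subset h.exists_in fun w hw => h.excluded w (hZ hw)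
  · exact h.undefended u hu x hx fun t ht htu => hZ (mem_inNbrs.2 ⟨ht, htu⟩)
  · exact h.excluded x (hZ (mem_inNbrs.2 ⟨hxC, hx⟩))

variable (G)

/-- Branching on `v`, with the given decreases of the core. -/
def Plan₁ (C : Finset V) (v : V) (a b : ℕ) : Prop :=
  (∀ D, InBranch G C D ∅ v → D.card + a ≤ C.card) ∧
  ∀ D, OutBranch G C D {v} → D.card + b ≤ C.card

/-- Branching on `v`, then on `w`, with the given decreases of the core. -/
def Plan₂ (C : Finset V) (v w : V) (a b c : ℕ) : Prop :=
  (∀ D, InBranch G C D ∅ v → D.card + a ≤ C.card) ∧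
  (∀ D, InBranch G C D {v} w → D.card + b ≤ C.card) ∧
  ∀ D, OutBranch G C D {v, w} → D.card + c ≤ C.card

/-- Branching on `v`, then on `w`, then on `x`, with the given decreases of the core. -/
def Plan₃ (C : Finset V) (v w x : V) (a b c d : ℕ) : Prop :=
  (∀ D, InBranch G C D ∅ v → D.card + a ≤ C.card) ∧
  (∀ D, InBranch G C D {v} w → D.card + b ≤ C.card) ∧
  (∀ D, InBranch G C D {v, w} x → D.card + c ≤ C.card) ∧
  ∀ D, OutBranch G C D {v, w, x} → D.card + d ≤ C.card

/-- One of the branchings that the algorithm uses. -/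
def HasPlan (C : Finset V) : Prop :=
  (∃ v ∈ C, Plan₁ G C v 8 1 ∨ Plan₁ G C v 6 2 ∨ Plan₁ G C v 4 3) ∨
  (∃ v ∈ C, ∃ w ∈ C, Plan₂ G C v w 6 5 5 ∨ Plan₂ G C v w 5 6 5 ∨ Plan₂ G C v w 5 5 6) ∨
  ∃ v ∈ C, ∃ w ∈ C, ∃ x ∈ C, Plan₃ G C v w x 7 7 7 7

variable {G}

theorem HasPlan.of_four_three {C : Finset V} {v : V} (hv : v ∈ C) (h : Plan₁ G C v 4 3) :
    HasPlan G C := Or.inl ⟨v, hv, Or.inr (Or.inr h)⟩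

theorem HasPlan.of_six_two {C : Finset V} {v : V} (hv : v ∈ C) (h : Plan₁ G C v 6 2) :
    HasPlan G C := Or.inl ⟨v, hv, Or.inr (Or.inl h)⟩

theorem HasPlan.of_two {C : Finset V} {v w : V} (hv : v ∈ C) (hw : w ∈ C)
    (h : Plan₂ G C v w 6 5 5 ∨ Plan₂ G C v w 5 6 5 ∨ Plan₂ G C v w 5 5 6) :
    HasPlan G C := Or.inr (Or.inl ⟨v, hv, w, hw, h⟩)

/-- Excluding `v` decreases the core by three if this isolates two more vertices. -/
theorem OutBranch.drop_three {C D Z : Finset V} (h : OutBranch G C D Z) {x y z : V}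
    (hx : x ∈ C) (hy : y ∈ C) (hz : z ∈ C) (hxy : x ≠ y) (hxz : x ≠ z) (hyz : y ≠ z)
    (hxD : x ∉ D) (hyD : y ∉ D) (hzD : z ∉ D) : D.card + 3 ≤ C.card := by
  have hc : ({x, y, z} : Finset V).card = 3 := by
    rw [Finset.card_eq_three]
    exact ⟨x, y, z, hxy, hxz, hyz, rfl⟩
  rw [← hc]
  refine card_add_card_le h.subset ?_ ?_
  · intro a ha
    simp only [Finset.mem_insert, Finset.mem_singleton] at ha
    rcases ha with rfl | rfl | rfl <;> assumption
  · intro a ha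
    simp only [Finset.mem_insert, Finset.mem_singleton] at ha
    rcases ha with rfl | rfl | rfl <;> assumption

theorem hasPlan_of_seven_le (hG : IsOriented G) {C : Finset V} {v : V} (hv : v ∈ C)
    (h : 7 ≤ (inNbrs G C v).card + (outNbrs G C v).card) : HasPlan G C := by
  refine Or.inl ⟨v, hv, Or.inl ⟨fun D hD => ?_, fun D hD => ?_⟩⟩
  · have := hD.drop hG hv
    omega
  · have := card_add_card_le (R := {v}) hD.subset (by simpa using hv) (by simpa using hD.excluded)
    simpa using this

/-- The case of an in-degree one. -/
theorem hasPlan_of_inNbrs_eq_singleton (hG : IsOriented G) {C : Finset V}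
    (hin : ∀ c ∈ C, 1 ≤ (inNbrs G C c).card) (hout : ∀ c ∈ C, 1 ≤ (outNbrs G C c).card)
    (hdef : ∀ u ∈ C, ∀ v ∈ C, G.Adj u v → ∃ t ∈ C, G.Adj t u ∧ ¬ Nbr G v t)
    {u₀ : V} (hu₀ : u₀ ∈ C) (h₀ : (inNbrs G C u₀).card = 1) : HasPlan G C := by
  by_cases hw : ∃ u ∈ C, ∃ w, inNbrs G C u = {w} ∧
      3 ≤ (inNbrs G C w).card + (outNbrs G C w).card
  · obtain ⟨u, hu, w, huw, hdeg⟩ := hw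
    have hwu := mem_inNbrs.1 (huw ▸ Finset.mem_singleton_self w : w ∈ inNbrs G C u)
    refine .of_four_three hwu.1 ⟨fun D hD => ?_, fun D hD => ?_⟩
    · have := hD.drop hG hwu.1
      omega
    · have := hD.drop hG hu huw.le
      rw [huw, Finset.card_singleton] at this
      have := hout u hu
      omega
  · push Not at hw
    let Q := C.filter fun x => (inNbrs G C x).card = 1
    have hQ : ∀ x ∈ Q, ∃ w ∈ Q, inNbrs G C x = {w} ∧ outNbrs G C w = {x} := by
      intro x hx
      obtain ⟨hxC, hx₁⟩ := Finset.mem_filter.1 hx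
      obtain ⟨w, hxw⟩ := Finset.card_eq_one.1 hx₁
      have hwx := mem_inNbrs.1 (hxw ▸ Finset.mem_singleton_self w : w ∈ inNbrs G C x)
      have h₁ := hw x hxC w hxw
      have h₂ := hin w hwx.1
      have h₃ := hout w hwx.1
      refine ⟨w, Finset.mem_filter.2 ⟨hwx.1, by omega⟩, hxw, ?_⟩
      obtain ⟨y, hy⟩ := Finset.card_eq_one.1 (by omega : (outNbrs G C w).card = 1)
      have := hy ▸ mem_outNbrs.2 ⟨hxC, hwx.2⟩
      rw [hy, Finset.mem_singleton.1 this]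
    obtain ⟨c, hcQ, hc, hc'⟩ := hQ u₀ (Finset.mem_filter.2 ⟨hu₀, h₀⟩)
    obtain ⟨b, hbQ, hb, hb'⟩ := hQ c hcQ
    obtain ⟨a, haQ, ha, ha'⟩ := hQ b hbQ
    have hcC := (Finset.mem_filter.1 hcQ).1
    have hbC := (Finset.mem_filter.1 hbQ).1
    have haC := (Finset.mem_filter.1 haQ).1
    have hcu : G.Adj c u₀ := (mem_inNbrs.1 (hc ▸ Finset.mem_singleton_self c)).2
    have hbc : G.Adj b c := (mem_inNbrs.1 (hb ▸ Finset.mem_singleton_self b)).2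
    have hab : G.Adj a b := (mem_inNbrs.1 (ha ▸ Finset.mem_singleton_self a)).2
    have hau : a ≠ u₀ := by
      rintro rfl
      obtain ⟨t, ht, hta, hbt⟩ := hdef a haC b hbC hab
      have : t ∈ inNbrs G C a := mem_inNbrs.2 ⟨ht, hta⟩
      rw [hc, Finset.mem_singleton] at this
      exact hbt (this ▸ Or.inl hbc)
    have hcard : ({a, b, c, u₀} : Finset V).card = 4 := by
      rw [Finset.card_eq_succ]
      refine ⟨a, {b, c, u₀}, ?_, rfl, Finset.card_eq_three.2
        ⟨b, c, u₀, hG.ne hbc, hG.ne_of_adj_adj hbc hcu, hG.ne hcu, rfl⟩⟩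
      simp [hG.ne hab, hG.ne_of_adj_adj hab hbc, hau]
    have hsub : ({a, b, c, u₀} : Finset V) ⊆ C := by
      intro x hx
      simp only [Finset.mem_insert, Finset.mem_singleton] at hx
      rcases hx with rfl | rfl | rfl | rfl <;> assumption
    refine .of_four_three hcC ⟨fun D hD => ?_, fun D hD => ?_⟩
    · rw [← hcard]
      refine card_add_card_le hD.subset hsub fun x hx => ?_
      have hbD := hD.not_nbr b (Or.inr hbc)
      simp only [Finset.mem_insert, Finset.mem_singleton] at hx
      rcases hx with rfl | rfl | rfl | rfl
      · exact not_mem_of_outNbrs hD.subset hD.exists_out (by simpa [ha'] using hbD)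
      · exact hbD
      · exact hD.not_mem
      · exact hD.not_nbr _ (Or.inl hcu)
    · have hcD := hD.excluded c (Finset.mem_singleton_self c)
      have hbD : b ∉ D := not_mem_of_outNbrs hD.subset hD.exists_out (by simpa [hb'] using hcD)
      exact hD.drop_three haC hbC hcC (hG.ne hab) (hG.ne_of_adj_adj hab hbc) (hG.ne hbc)
        (not_mem_of_outNbrs hD.subset hD.exists_out (by simpa [ha'] using hbD)) hbD hcD

/-- The case of an out-degree one, all in-degrees being at least two. -/
theorem hasPlan_of_outNbrs_eq_singleton (hG : IsOriented G) {C : Finset V}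
    (hin : ∀ c ∈ C, 2 ≤ (inNbrs G C c).card) (hout : ∀ c ∈ C, 1 ≤ (outNbrs G C c).card)
    (hdef : ∀ u ∈ C, ∀ v ∈ C, G.Adj u v → ∃ t ∈ C, G.Adj t u ∧ ¬ Nbr G v t)
    {w₁ u : V} (hw₁ : w₁ ∈ C) (h₁ : outNbrs G C w₁ = {u}) : HasPlan G C := by
  obtain ⟨hu, hwu⟩ := mem_outNbrs.1 (h₁ ▸ Finset.mem_singleton_self u : u ∈ outNbrs G C w₁)
  have outu : ∀ {D}, OutBranch G C D {u} → u ∉ D ∧ w₁ ∉ D := fun {D} hD =>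
    have := hD.excluded u (Finset.mem_singleton_self u)
    ⟨this, not_mem_of_outNbrs hD.subset hD.exists_out (by simpa [h₁] using this)⟩
  have outu_two : ∀ {D}, OutBranch G C D {u} → D.card + 2 ≤ C.card := by
    intro D hD
    have hc : ({u, w₁} : Finset V).card = 2 := Finset.card_pair (hG.ne hwu).symm
    rw [← hc]
    refine card_add_card_le hD.subset (by simp [Finset.insert_subset_iff, hu, hw₁]) ?_
    simpa using outu hD
  have hinu := hin u hu
  by_cases hu₁ : (outNbrs G C u).card = 1
  · obtain ⟨y, hy⟩ := Finset.card_eq_one.1 hu₁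
    obtain ⟨hyC, huy⟩ := mem_outNbrs.1 (hy ▸ Finset.mem_singleton_self y : y ∈ outNbrs G C u)
    refine .of_four_three hyC ⟨fun D hD => ?_, fun D hD => ?_⟩
    · have := hD.drop hG hyC
      have := hin y hyC
      have := hout y hyC
      omega
    · have hyD := hD.excluded y (Finset.mem_singleton_self y)
      have huD : u ∉ D := not_mem_of_outNbrs hD.subset hD.exists_out (by simpa [hy] using hyD)
      exact hD.drop_three hyC hu hw₁ (hG.ne huy).symm (hG.ne_of_adj_adj hwu huy).symm
        (hG.ne hwu).symm hyD huD
        (not_mem_of_outNbrs hD.subset hD.exists_out (by simpa [h₁] using huD))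
  have := hout u hu
  by_cases hdu : 5 ≤ (inNbrs G C u).card + (outNbrs G C u).card
  · refine .of_six_two hu ⟨fun D hD => ?_, fun D hD => outu_two hD⟩
    have := hD.drop hG hu
    omega
  obtain ⟨w₂, hne, hw⟩ : ∃ w₂, w₁ ≠ w₂ ∧ inNbrs G C u = {w₁, w₂} := by
    obtain ⟨x, y, hxy, h⟩ := Finset.card_eq_two.1 (by omega : (inNbrs G C u).card = 2)
    have : w₁ ∈ inNbrs G C u := mem_inNbrs.2 ⟨hw₁, hwu⟩
    rw [h, Finset.mem_insert, Finset.mem_singleton] at this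
    rcases this with rfl | rfl
    · exact ⟨y, hxy, h⟩
    · exact ⟨x, hxy.symm, by rw [h, Finset.pair_comm]⟩
  have hu4 : (inNbrs G C u).card + (outNbrs G C u).card = 4 := by omega
  obtain ⟨hw₂, hwu₂⟩ := mem_inNbrs.1 (by rw [hw]; simp : w₂ ∈ inNbrs G C u)
  -- if `w₂` loses its out-neighbours together with `u`
  have three : (∀ D, OutBranch G C D {u} → w₂ ∉ D) → HasPlan G C := by
    intro h
    refine .of_four_three hu ⟨fun D hD => ?_, fun D hD => ?_⟩
    · have := hD.drop hG hu
      omega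
    · exact hD.drop_three hu hw₁ hw₂ (hG.ne hwu).symm (hG.ne hwu₂).symm hne (outu hD).1
        (outu hD).2 (h D hD)
  by_cases hw₂₁ : (outNbrs G C w₂).card = 1
  · obtain ⟨y, hy⟩ := Finset.card_eq_one.1 hw₂₁
    have : u ∈ outNbrs G C w₂ := mem_outNbrs.2 ⟨hu, hwu₂⟩
    rw [hy, Finset.mem_singleton] at this
    subst this
    exact three fun D hD =>
      not_mem_of_outNbrs hD.subset hD.exists_out (by simpa [hy] using (outu hD).1)
  have := hout w₂ hw₂
  have := hin w₂ hw₂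
  have hin₁ := hin w₁ hw₁
  have card₁ : (outNbrs G C w₁).card = 1 := by rw [h₁, Finset.card_singleton]
  have both : ∀ D, OutBranch G C D {w₂, w₁} → D.card + 5 ≤ C.card := by
    intro D hD
    have := hD.drop hG hu (by rw [hw, Finset.pair_comm])
    omega
  by_cases hadj : G.Adj w₂ w₁
  · by_cases hin₂ : (inNbrs G C w₁).card = 2
    · obtain ⟨b, hb⟩ : ∃ b, inNbrs G C w₁ = {w₂, b} := by
        obtain ⟨x, y, hxy, h⟩ := Finset.card_eq_two.1 hin₂
        have : w₂ ∈ inNbrs G C w₁ := mem_inNbrs.2 ⟨hw₂, hadj⟩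
        rw [h, Finset.mem_insert, Finset.mem_singleton] at this
        rcases this with rfl | rfl
        · exact ⟨y, h⟩
        · exact ⟨x, by rw [h, Finset.pair_comm]⟩
      obtain ⟨hbC, hbw⟩ := mem_inNbrs.1 (by rw [hb]; simp : b ∈ inNbrs G C w₁)
      have hbu : ¬ Nbr G u b := by
        obtain ⟨t, ht, htw, hut⟩ := hdef w₁ hw₁ u hu hwu
        have : t ∈ inNbrs G C w₁ := mem_inNbrs.2 ⟨ht, htw⟩
        rw [hb, Finset.mem_insert, Finset.mem_singleton] at this
        rcases this with rfl | rfl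
        · exact absurd (Or.inr hwu₂) hut
        · exact hut
      refine .of_six_two hu ⟨fun D hD => ?_, fun D hD => outu_two hD⟩
      have := hD.drop_insert hG hu hbC (hG.ne_of_adj_adj hbw hwu) hbu
        (hD.forced w₁ hw₁ b hwu hbw fun t ht htw hnt => by
          have : t ∈ inNbrs G C w₁ := mem_inNbrs.2 ⟨ht, htw⟩
          rw [hb, Finset.mem_insert, Finset.mem_singleton] at this
          rcases this with rfl | rfl
          · exact absurd (Or.inl hwu₂) hnt
          · rfl)
      omega
    · by_cases hout₂ : (outNbrs G C w₂).card = 2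
      · have hw₂' : {u, w₁} = outNbrs G C w₂ := by
          refine Finset.eq_of_subset_of_card_le ?_ ?_
          · simp [Finset.insert_subset_iff, mem_outNbrs, hu, hw₁, hwu₂, hadj]
          · rw [hout₂, Finset.card_pair (hG.ne hwu).symm]
        exact three fun D hD => not_mem_of_outNbrs hD.subset hD.exists_out (by
          rw [← hw₂']
          simpa using outu hD)
      · refine .of_two hw₂ hw₁ (Or.inl ⟨fun D hD => ?_, fun D hD => ?_, both⟩)
        · have := hD.drop hG hw₂
          omega
        · have := hD.drop hG hw₁
          omega
  · have hn : ¬ Nbr G w₂ w₁ := by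
      rintro (h | h)
      · exact hadj h
      · have : w₂ ∈ outNbrs G C w₁ := mem_outNbrs.2 ⟨hw₂, h⟩
        rw [h₁, Finset.mem_singleton] at this
        exact hG.ne hwu₂ this
    refine .of_two hw₂ hw₁ (Or.inl ⟨fun D hD => ?_, fun D hD => ?_, both⟩)
    · have huD := hD.not_nbr u (Or.inl hwu₂)
      have := hD.drop_insert hG hw₂ hw₁ hne hn
        (not_mem_of_outNbrs hD.subset hD.exists_out (by simpa [h₁] using huD))
      omega
    · have := hD.drop_insert hG hw₁ hw₂ hne.symm (fun h => hn h.symm)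
        (hD.excluded w₂ (Finset.mem_singleton_self _))
      omega

/-- The case of an in-degree two, all degrees being at least two. -/
theorem hasPlan_of_inNbrs_eq_pair (hG : IsOriented G) {C : Finset V}
    (hin : ∀ c ∈ C, 2 ≤ (inNbrs G C c).card) (hout : ∀ c ∈ C, 2 ≤ (outNbrs G C c).card)
    (hdef : ∀ u ∈ C, ∀ v ∈ C, G.Adj u v → ∃ t ∈ C, G.Adj t u ∧ ¬ Nbr G v t)
    {w₁ w₂ u : V} (hu : u ∈ C) (hne : w₁ ≠ w₂) (hw : inNbrs G C u = {w₁, w₂}) :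
    HasPlan G C := by
  have key : ∀ w₁ w₂, w₁ ≠ w₂ → inNbrs G C u = {w₁, w₂} →
      (5 ≤ (inNbrs G C u).card + (outNbrs G C u).card ∨
        5 ≤ (inNbrs G C w₂).card + (outNbrs G C w₂).card ∨ ¬ Nbr G w₂ w₁) → HasPlan G C := by
    intro w₁ w₂ hne hw h
    obtain ⟨hw₁, hwu₁⟩ := mem_inNbrs.1 (by rw [hw]; simp : w₁ ∈ inNbrs G C u)
    obtain ⟨hw₂, hwu₂⟩ := mem_inNbrs.1 (by rw [hw]; simp : w₂ ∈ inNbrs G C u)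
    have := hin _ hu
    have := hout _ hu
    have := hin _ hw₁
    have := hout _ hw₁
    have := hin _ hw₂
    have := hout _ hw₂
    have a₁ : ∀ D, InBranch G C D ∅ w₁ → D.card + 5 ≤ C.card := fun D hD => by
      have := hD.drop hG hw₁
      omega
    have a₂ : ∀ D, InBranch G C D {w₁} w₂ → D.card + 5 ≤ C.card := fun D hD => by
      have := hD.drop hG hw₂
      omega
    have a₃ : ∀ D, OutBranch G C D {w₁, w₂} → D.card + 5 ≤ C.card := fun D hD => by
      have := hD.drop hG hu hw.le
      omega
    refine .of_two hw₁ hw₂ ?_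
    rcases h with h | h | h
    · refine Or.inr (Or.inr ⟨a₁, a₂, fun D hD => ?_⟩)
      have := hD.drop hG hu hw.le
      omega
    · refine Or.inr (Or.inl ⟨a₁, fun D hD => ?_, a₃⟩)
      have := hD.drop hG hw₂
      omega
    · refine Or.inr (Or.inl ⟨a₁, fun D hD => ?_, a₃⟩)
      have := hD.drop_insert hG hw₂ hw₁ hne h (hD.excluded _ (Finset.mem_singleton_self _))
      omega
  by_cases h₂ : 5 ≤ (inNbrs G C u).card + (outNbrs G C u).card ∨
        5 ≤ (inNbrs G C w₂).card + (outNbrs G C w₂).card ∨ ¬ Nbr G w₂ w₁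
  · exact key w₁ w₂ hne hw h₂
  by_cases h₁ : 5 ≤ (inNbrs G C w₁).card + (outNbrs G C w₁).card
  · exact key w₂ w₁ hne.symm (by rw [hw, Finset.pair_comm]) (Or.inr (Or.inl h₁))
  simp only [not_or, not_not] at h₂
  obtain ⟨hdu, hd₂, hn⟩ := h₂
  clear key
  wlog hadj : G.Adj w₁ w₂ generalizing w₁ w₂
  · exact this hne.symm (by rw [hw, Finset.pair_comm]) hd₂ h₁ hn.symm (hn.resolve_right hadj)
  obtain ⟨hw₁, hwu₁⟩ := mem_inNbrs.1 (by rw [hw]; simp : w₁ ∈ inNbrs G C u)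
  obtain ⟨hw₂, hwu₂⟩ := mem_inNbrs.1 (by rw [hw]; simp : w₂ ∈ inNbrs G C u)
  have := hin _ hu
  have := hout _ hu
  have := hin _ hw₁
  have := hout _ hw₁
  have := hin _ hw₂
  have := hout _ hw₂
  obtain ⟨b, hb⟩ : ∃ b, inNbrs G C w₂ = {w₁, b} := by
    obtain ⟨x, y, hxy, h⟩ := Finset.card_eq_two.1 (by omega : (inNbrs G C w₂).card = 2)
    have : w₁ ∈ inNbrs G C w₂ := mem_inNbrs.2 ⟨hw₁, hadj⟩
    rw [h, Finset.mem_insert, Finset.mem_singleton] at this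
    rcases this with rfl | rfl
    · exact ⟨y, h⟩
    · exact ⟨x, by rw [h, Finset.pair_comm]⟩
  obtain ⟨hbC, hbw⟩ := mem_inNbrs.1 (by rw [hb]; simp : b ∈ inNbrs G C w₂)
  have hbu : ¬ Nbr G u b := by
    obtain ⟨t, ht, htw, hut⟩ := hdef w₂ hw₂ u hu hwu₂
    have : t ∈ inNbrs G C w₂ := mem_inNbrs.2 ⟨ht, htw⟩
    rw [hb, Finset.mem_insert, Finset.mem_singleton] at this
    rcases this with rfl | rfl
    · exact absurd (Or.inr hwu₁) hut
    · exact hut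
  have := hin _ hbC
  have := hout _ hbC
  refine .of_two hw₁ hbC (Or.inr (Or.inl ⟨fun D hD => ?_, fun D hD => ?_, fun D hD => ?_⟩))
  · have := hD.drop hG hw₁
    omega
  · have huD : u ∉ D := by
      refine not_mem_of_inNbrs hD.subset hD.exists_in fun w hw' => ?_
      rw [hw, Finset.mem_insert, Finset.mem_singleton] at hw'
      rcases hw' with rfl | rfl
      · exact hD.excluded _ (Finset.mem_singleton_self _)
      · exact hD.not_nbr _ (Or.inl hbw)
    have := hD.drop_insert hG hbC hu (hG.ne_of_adj_adj hbw hwu₂).symm (fun h => hbu h.symm) huD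
    omega
  · have := hD.drop hG hw₂ hb.le
    omega

/-- The case of in-degrees at least three and degrees at most six. -/
theorem hasPlan_of_three_le (hG : IsOriented G) {C : Finset V} (hC : C.Nonempty)
    (hin : ∀ c ∈ C, 3 ≤ (inNbrs G C c).card)
    (hdeg : ∀ c ∈ C, (inNbrs G C c).card + (outNbrs G C c).card ≤ 6) : HasPlan G C := by
  have hsum : ∑ c ∈ C, (inNbrs G C c).card = ∑ c ∈ C, (outNbrs G C c).card :=
    (Finset.sum_card_bipartiteAbove_eq_sum_card_bipartiteBelow (s := C) (t := C) G.Adj).symm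
  have hle : ∀ c ∈ C, (outNbrs G C c).card ≤ (inNbrs G C c).card := fun c hc => by
    have := hin c hc
    have := hdeg c hc
    omega
  have heq := (Finset.sum_eq_sum_iff_of_le hle).1 hsum.symm
  have hthree : ∀ c ∈ C, (inNbrs G C c).card = 3 ∧ (outNbrs G C c).card = 3 := fun c hc => by
    have := hin c hc
    have := hdeg c hc
    have := heq c hc
    omega
  obtain ⟨u, hu⟩ := hC
  obtain ⟨x, y, z, -, -, -, h⟩ := Finset.card_eq_three.1 (hthree u hu).1
  have hx := (mem_inNbrs.1 (by rw [h]; simp : x ∈ inNbrs G C u)).1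
  have hy := (mem_inNbrs.1 (by rw [h]; simp : y ∈ inNbrs G C u)).1
  have hz := (mem_inNbrs.1 (by rw [h]; simp : z ∈ inNbrs G C u)).1
  have seven : ∀ {D Z v}, v ∈ C → InBranch G C D Z v → D.card + 7 ≤ C.card := by
    intro D Z v hv hD
    have := hD.drop hG hv
    have := hthree v hv
    omega
  refine Or.inr (Or.inr ⟨x, hx, y, hy, z, hz, fun D => seven hx, fun D => seven hy,
    fun D => seven hz, fun D hD => ?_⟩)
  have := hD.drop hG hu h.le
  have := hthree u hu
  omega

theorem hasPlan (hG : IsOriented G) {C : Finset V} (hC : C.Nonempty)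
    (hin : ∀ c ∈ C, ∃ u ∈ C, G.Adj u c) (hout : ∀ c ∈ C, ∃ u ∈ C, G.Adj c u)
    (hdef : ∀ u ∈ C, ∀ v ∈ C, G.Adj u v → ∃ t ∈ C, G.Adj t u ∧ ¬ Nbr G v t) : HasPlan G C := by
  have hin₁ : ∀ c ∈ C, 1 ≤ (inNbrs G C c).card := fun c hc => by
    obtain ⟨u, hu⟩ := hin c hc
    exact Finset.card_pos.2 ⟨u, mem_inNbrs.2 hu⟩
  have hout₁ : ∀ c ∈ C, 1 ≤ (outNbrs G C c).card := fun c hc => by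
    obtain ⟨u, hu⟩ := hout c hc
    exact Finset.card_pos.2 ⟨u, mem_outNbrs.2 hu⟩
  by_cases h7 : ∃ v ∈ C, 7 ≤ (inNbrs G C v).card + (outNbrs G C v).card
  · obtain ⟨v, hv, h⟩ := h7
    exact hasPlan_of_seven_le hG hv h
  by_cases hi1 : ∃ u ∈ C, (inNbrs G C u).card = 1
  · obtain ⟨u, hu, h⟩ := hi1
    exact hasPlan_of_inNbrs_eq_singleton hG hin₁ hout₁ hdef hu h
  have hin₂ : ∀ c ∈ C, 2 ≤ (inNbrs G C c).card := fun c hc => by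
    have := hin₁ c hc
    have : (inNbrs G C c).card ≠ 1 := fun h => hi1 ⟨c, hc, h⟩
    omega
  by_cases ho1 : ∃ u ∈ C, (outNbrs G C u).card = 1
  · obtain ⟨w, hw, h⟩ := ho1
    obtain ⟨u, hu⟩ := Finset.card_eq_one.1 h
    exact hasPlan_of_outNbrs_eq_singleton hG hin₂ hout₁ hdef hw hu
  have hout₂ : ∀ c ∈ C, 2 ≤ (outNbrs G C c).card := fun c hc => by
    have := hout₁ c hc
    have : (outNbrs G C c).card ≠ 1 := fun h => ho1 ⟨c, hc, h⟩
    omega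
  by_cases hi2 : ∃ u ∈ C, (inNbrs G C u).card = 2
  · obtain ⟨u, hu, h⟩ := hi2
    obtain ⟨x, y, hxy, h⟩ := Finset.card_eq_two.1 h
    exact hasPlan_of_inNbrs_eq_pair hG hin₂ hout₂ hdef hu hxy h
  refine hasPlan_of_three_le hG hC (fun c hc => ?_) fun c hc => ?_
  · have := hin₂ c hc
    have : (inNbrs G C c).card ≠ 2 := fun h => hi2 ⟨c, hc, h⟩
    omega
  · by_contra h
    exact h7 ⟨c, hc, by omega⟩

end Branching

end Argumentation

/-! ## Plans and the number of preferred extensions -/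

namespace Argumentation

/-- The decreases of the measure that the algorithm accepts for the branches of a plan. -/
def templates : List (List ℕ) :=
  [[8, 1], [6, 2], [4, 3], [6, 5, 5], [5, 6, 5], [5, 5, 6], [7, 7, 7, 7]]

/-- Whether the measures `ms` lie below `m` by at least the decreases `as`. -/
def fits (m : ℕ) : List ℕ → List ℕ → Bool
  | [], [] => true
  | a :: as, b :: ms => decide (a + b ≤ m) && fits m as ms
  | [], _ :: _ => false
  | _ :: _, [] => false

theorem fits_sum_le {φ : ℝ} (hφ : 1 ≤ φ) {m : ℕ} {as ms : List ℕ} (h : fits m as ms = true) :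
    (ms.map (φ ^ ·)).sum ≤ φ ^ m * (as.map fun a => (φ ^ a)⁻¹).sum := by
  have h0 : 0 < φ := by linarith
  induction as generalizing ms with
  | nil => cases ms with
    | nil => simp
    | cons b ms => simp [fits] at h
  | cons a as ih => cases ms with
    | nil => simp [fits] at h
    | cons b ms =>
      simp only [fits, Bool.and_eq_true, decide_eq_true_eq] at h
      simp only [List.map_cons, List.sum_cons, mul_add]
      refine add_le_add ?_ (ih h.2)
      rw [← div_eq_mul_inv, le_div_iff₀ (by positivity), ← pow_add]
      exact pow_le_pow_right₀ hφ (by omega)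

theorem fits_lt {m : ℕ} {as ms : List ℕ} (h : fits m as ms = true) (ha : ∀ a ∈ as, 0 < a) :
    ∀ b ∈ ms, b < m := by
  induction as generalizing ms with
  | nil => cases ms with
    | nil => simp
    | cons b ms => simp [fits] at h
  | cons a as ih => cases ms with
    | nil => simp
    | cons b ms =>
      simp only [fits, Bool.and_eq_true, decide_eq_true_eq] at h
      intro x hx
      rcases List.mem_cons.1 hx with rfl | hx
      · have := ha a (by simp)
        omega
      · exact ih h.2 (fun a ha' => ha a (by simp [ha'])) x hx

theorem fits_length {m : ℕ} {as ms : List ℕ} (h : fits m as ms = true) :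
    as.length = ms.length := by
  induction as generalizing ms with
  | nil => cases ms with
    | nil => simp
    | cons b ms => simp [fits] at h
  | cons a as ih => cases ms with
    | nil => simp [fits] at h
    | cons b ms =>
      simp only [fits, Bool.and_eq_true, decide_eq_true_eq] at h
      simp [ih h.2]

theorem templates_pos : ∀ as ∈ templates, ∀ a ∈ as, 0 < a := by decide

theorem templates_sum_le {φ : ℝ} (hφ : 1.232 ≤ φ) (h : φ ^ 8 = φ ^ 7 + 1) :
    ∀ as ∈ templates, (as.map fun a => (φ ^ a)⁻¹).sum ≤ 1 := by
  have h0 : 0 < φ := by linarith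
  have bound : ∀ k : ℕ, (φ ^ k)⁻¹ ≤ ((1.232 : ℝ) ^ k)⁻¹ := fun k =>
    inv_anti₀ (by positivity) (pow_le_pow_left₀ (by norm_num) hφ k)
  have h8 : (φ ^ 8)⁻¹ + (φ ^ 1)⁻¹ = 1 := by
    have h7 : φ ^ 7 = φ ^ 8 - 1 := by linarith
    have : (φ ^ 1)⁻¹ = φ ^ 7 * (φ ^ 8)⁻¹ := by field_simp
    rw [this, h7, sub_mul, mul_inv_cancel₀ (by positivity)]
    ring
  have b2 := bound 2
  have b3 := bound 3
  have b4 := bound 4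
  have b5 := bound 5
  have b6 := bound 6
  have b7 := bound 7
  intro as has
  simp only [templates, List.mem_cons, List.not_mem_nil, or_false] at has
  rcases has with rfl | rfl | rfl | rfl | rfl | rfl | rfl <;>
    simp only [List.map_cons, List.map_nil, List.sum_cons, List.sum_nil]
  · linarith
  all_goals norm_num at b2 b3 b4 b5 b6 b7 ⊢
  all_goals linarith

section Plans

open Classical

variable {V : Type*} [Fintype V] (G : Digraph V)

/-- The measures of the branches of a plan: the members of the plan are chosen or excluded one
after the other, up to the first one that is chosen. -/
noncomputable def mus : List V → Finset V × Finset V → List ℕ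
  | [], st => [mu G st]
  | w :: ws, st => mu G (insert w st.1, st.2) :: mus ws (st.1, st.2.erase w)

/-- The measures of all branches of the plan are sufficiently far below `m`. -/
def Feasible (m : ℕ) (st : Finset V × Finset V) (ws : List V) : Prop :=
  ∃ as ∈ templates, fits m as (mus G ws st) = true

variable {G}

theorem length_mus (ws : List V) (st : Finset V × Finset V) :
    (mus G ws st).length = ws.length + 1 := by
  induction ws generalizing st with
  | nil => rfl
  | cons w ws ih => simp [mus, ih]

theorem Feasible.length_le {m : ℕ} {st : Finset V × Finset V} {ws : List V}
    (h : Feasible G m st ws) : ws.length ≤ 3 := by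
  obtain ⟨as, has, h⟩ := h
  have := fits_length h
  rw [length_mus] at this
  have h4 : ∀ as ∈ templates, as.length ≤ 4 := by decide
  have := h4 as has
  omega

theorem core_norm_subset {st s : Finset V × Finset V} (h₁ : st.1 ⊆ s.1) (h₂ : s.2 ⊆ st.2) :
    core G ((norm G s).2 \ (norm G s).1) ⊆ core G (st.2 \ st.1) :=
  core_mono (Finset.sdiff_subset_sdiff ((norm_subset s).2.trans h₂)
    (h₁.trans (norm_subset s).1))

theorem not_nbr_of_mem_core_norm {s : Finset V × Finset V} {x v : V}
    (hx : x ∈ (norm G s).2) (hv : v ∈ s.1) : ¬ Nbr G x v :=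
  not_nbr_of_stable (step_norm s) hx ((norm_subset s).1 hv)

theorem inBranch_core_norm {st : Finset V × Finset V} (hst : step G st = st) {Y Z : Finset V}
    {v : V} (hY : Y ⊆ st.2) (hZ : ∀ x ∈ Z, x ∉ Y) :
    InBranch G (core G (st.2 \ st.1))
      (core G ((norm G (insert v st.1, Y)).2 \ (norm G (insert v st.1, Y)).1)) Z v := by
  set s : Finset V × Finset V := (insert v st.1, Y) with hs
  have hv : v ∈ s.1 := Finset.mem_insert_self _ _
  have hmem : ∀ {x}, x ∈ core G ((norm G s).2 \ (norm G s).1) →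
      x ∈ (norm G s).2 ∧ x ∉ (norm G s).1 := fun hx => Finset.mem_sdiff.1 (core_subset _ hx)
  have hC := core_norm_subset (G := G) (st := st) (s := s) (Finset.subset_insert _ _) hY
  refine ⟨hC, fun h => (hmem h).2 ((norm_subset s).1 hv), fun x hvx hx => ?_, fun x hxZ hx => ?_,
    fun x => core_in, fun x => core_out, fun u hu w huv hwu huniq hw => ?_⟩
  · exact not_nbr_of_mem_core_norm (hmem hx).1 hv hvx.symm
  · exact hZ x hxZ ((norm_subset s).2 (hmem hx).1)
  · have : w ∈ (step G (norm G s)).1 := by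
      simp only [step, Finset.mem_filter, Finset.mem_univ, true_and]
      refine Or.inr ⟨u, hwu, ⟨v, (norm_subset s).1 hv, huv⟩, fun t ht htu => ?_⟩
      exact huniq t (mem_core_of_adj hst hu (hY ((norm_subset s).2 ht)) htu) htu
        (not_nbr_of_mem_core_norm ht hv)
    rw [step_norm] at this
    exact (hmem hw).2 this

theorem outBranch_core_norm {st : Finset V × Finset V} (hst : step G st = st) {Y Z : Finset V}
    (hY : Y ⊆ st.2) (hZ : ∀ x ∈ Z, x ∉ Y) :
    OutBranch G (core G (st.2 \ st.1))
      (core G ((norm G (st.1, Y)).2 \ (norm G (st.1, Y)).1)) Z := by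
  set s : Finset V × Finset V := (st.1, Y) with hs
  have hmem : ∀ {x}, x ∈ core G ((norm G s).2 \ (norm G s).1) →
      x ∈ (norm G s).2 ∧ x ∉ (norm G s).1 := fun hx => Finset.mem_sdiff.1 (core_subset _ hx)
  refine ⟨core_norm_subset subset_rfl hY, fun x hxZ hx => hZ x hxZ ((norm_subset s).2 (hmem hx).1),
    fun x => core_in, fun x => core_out, fun u hu p hup hall hp => ?_⟩
  obtain ⟨t, ht, htu, -⟩ := exists_defender (step_norm s) (hmem hp).1 hup
  have htY := (norm_subset s).2 ht
  exact hZ t (hall t (mem_core_of_adj hst hu (hY htY) htu) htu) htY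

/-- The algorithm never lacks a plan. -/
theorem exists_feasible (hG : IsOriented G) {st : Finset V × Finset V} (hst : step G st = st)
    (hne : (core G (st.2 \ st.1)).Nonempty) :
    ∃ ws, Feasible G (core G (st.2 \ st.1)).card st ws := by
  have hplan : HasPlan G (core G (st.2 \ st.1)) := by
    refine hasPlan hG hne (fun c => core_in) (fun c => core_out) fun u hu v hv huv => ?_
    obtain ⟨t, ht, htu, hvt⟩ :=
      exists_defender hst (Finset.mem_sdiff.1 (core_subset _ hv)).1 huv
    exact ⟨t, mem_core_of_adj hst hu ht htu, htu, hvt⟩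
  have inb : ∀ {Y Z v k}, Y ⊆ st.2 → (∀ x ∈ Z, x ∉ Y) →
      (∀ D, InBranch G (core G (st.2 \ st.1)) D Z v → D.card + k ≤ (core G (st.2 \ st.1)).card) →
      k + mu G (insert v st.1, Y) ≤ (core G (st.2 \ st.1)).card := by
    intro Y Z v k hY hZ h
    rw [add_comm]
    exact h _ (inBranch_core_norm hst hY hZ)
  have outb : ∀ {Y Z k}, Y ⊆ st.2 → (∀ x ∈ Z, x ∉ Y) →
      (∀ D, OutBranch G (core G (st.2 \ st.1)) D Z → D.card + k ≤ (core G (st.2 \ st.1)).card) →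
      k + mu G (st.1, Y) ≤ (core G (st.2 \ st.1)).card := by
    intro Y Z k hY hZ h
    rw [add_comm]
    exact h _ (outBranch_core_norm hst hY hZ)
  have e₁ : ∀ v, st.2.erase v ⊆ st.2 := fun v => Finset.erase_subset _ _
  have e₂ : ∀ v w, (st.2.erase v).erase w ⊆ st.2 := fun v w =>
    (Finset.erase_subset _ _).trans (e₁ v)
  have e₃ : ∀ v w x, ((st.2.erase v).erase w).erase x ⊆ st.2 := fun v w x =>
    (Finset.erase_subset _ _).trans (e₂ v w)
  have one : ∀ {v a b}, [a, b] ∈ templates → Plan₁ G (core G (st.2 \ st.1)) v a b →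
      ∃ ws, Feasible G (core G (st.2 \ st.1)).card st ws := by
    intro v a b hab h
    refine ⟨[v], _, hab, ?_⟩
    simp only [fits, mus, Bool.and_eq_true, decide_eq_true_eq]
    exact ⟨inb subset_rfl (by simp) h.1, outb (e₁ v) (by simp) h.2, trivial⟩
  have two : ∀ {v w a b c}, [a, b, c] ∈ templates → Plan₂ G (core G (st.2 \ st.1)) v w a b c →
      ∃ ws, Feasible G (core G (st.2 \ st.1)).card st ws := by
    intro v w a b c hab h
    refine ⟨[v, w], _, hab, ?_⟩
    simp only [fits, mus, Bool.and_eq_true, decide_eq_true_eq]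
    exact ⟨inb subset_rfl (by simp) h.1, inb (e₁ v) (by simp) h.2.1,
      outb (e₂ v w) (by simp) h.2.2, trivial⟩
  rcases hplan with ⟨v, -, h | h | h⟩ | ⟨v, -, w, -, h | h | h⟩ | ⟨v, -, w, -, x, -, h⟩
  · exact one (by decide) h
  · exact one (by decide) h
  · exact one (by decide) h
  · exact two (by decide) h
  · exact two (by decide) h
  · exact two (by decide) h
  · refine ⟨[v, w, x], [7, 7, 7, 7], by decide, ?_⟩
    simp only [fits, mus, Bool.and_eq_true, decide_eq_true_eq]
    exact ⟨inb subset_rfl (by simp) h.1, inb (e₁ v) (by simp) h.2.1,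
      inb (e₂ v w) (by simp) h.2.2.1, outb (e₃ v w x) (by simp) h.2.2.2, trivial⟩

/-- The number of maximal admissible sets between `S` and `Y`. -/
noncomputable def count (G : Digraph V) (st : Finset V × Finset V) : ℕ :=
  (Finset.univ.filter fun T => MaxFam G st T).card

theorem count_norm (st : Finset V × Finset V) : count G (norm G st) = count G st := by
  simp only [count, maxFam_norm]

theorem count_branch (S Y : Finset V) (w : V) :
    count G (S, Y) ≤ count G (insert w S, Y) + count G (S, Y.erase w) := by
  refine (Finset.card_le_card ?_).trans (Finset.card_union_le _ _)
  intro T hT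
  simp only [Finset.mem_union, Finset.mem_filter, Finset.mem_univ, true_and] at hT ⊢
  exact ((maxFam_branch w T).1 hT).imp_right And.left

theorem count_le_sum {φ : ℝ} {m : ℕ}
    (ih : ∀ st : Finset V × Finset V, mu G st < m → (count G st : ℝ) ≤ φ ^ mu G st)
    (ws : List V) (st : Finset V × Finset V) (h : ∀ b ∈ mus G ws st, b < m) :
    (count G st : ℝ) ≤ ((mus G ws st).map (φ ^ ·)).sum := by
  induction ws generalizing st with
  | nil => simpa [mus] using ih st (by simpa [mus] using h)
  | cons w ws ihw =>
    simp only [mus, List.mem_cons, forall_eq_or_imp] at h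
    simp only [mus, List.map_cons, List.sum_cons]
    have h₁ := ih _ h.1
    have h₂ := ihw (st.1, st.2.erase w) h.2
    have h₃ : (count G st : ℝ) ≤ count G (insert w st.1, st.2) + count G (st.1, st.2.erase w) := by
      exact_mod_cast count_branch st.1 st.2 w
    linarith

theorem feasible_sum_le {φ : ℝ} (hφ : 1.232 ≤ φ) (h8 : φ ^ 8 = φ ^ 7 + 1) {m : ℕ}
    {st : Finset V × Finset V} {ws : List V} (h : Feasible G m st ws) :
    ((mus G ws st).map (φ ^ ·)).sum ≤ φ ^ m := by
  obtain ⟨as, has, h⟩ := h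
  refine (fits_sum_le (by linarith) h).trans (mul_le_of_le_one_right ?_ ?_)
  · exact pow_nonneg (by linarith) m
  · exact templates_sum_le hφ h8 as has

theorem Feasible.lt {m : ℕ} {st : Finset V × Finset V} {ws : List V} (h : Feasible G m st ws) :
    ∀ b ∈ mus G ws st, b < m := by
  obtain ⟨as, has, h⟩ := h
  exact fits_lt h (templates_pos as has)

theorem count_le {φ : ℝ} (hφ : 1.232 ≤ φ) (h8 : φ ^ 8 = φ ^ 7 + 1) (hG : IsOriented G)
    (st : Finset V × Finset V) : (count G st : ℝ) ≤ φ ^ mu G st := by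
  induction hm : mu G st using Nat.strong_induction_on generalizing st with
  | _ m ih =>
    rw [← count_norm]
    rcases (core G ((norm G st).2 \ (norm G st).1)).eq_empty_or_nonempty with h | h
    · have : count G (norm G st) ≤ 1 := by
        refine Finset.card_le_one.2 fun a ha b hb => ?_
        simp only [Finset.mem_filter, Finset.mem_univ, true_and] at ha hb
        rw [maxFam_of_core_eq_empty (step_norm st) h] at ha hb
        rw [ha.2.2, hb.2.2]
      calc (count G (norm G st) : ℝ) ≤ 1 := by exact_mod_cast this
        _ ≤ φ ^ m := one_le_pow₀ (by linarith)
    · obtain ⟨ws, hws⟩ := exists_feasible hG (step_norm st) h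
      have hmu : (core G ((norm G st).2 \ (norm G st).1)).card = m := hm
      rw [hmu] at hws
      exact (count_le_sum (fun s hs => ih _ hs s rfl) ws _ hws.lt).trans
        (feasible_sum_le hφ h8 hws)

theorem mu_le (st : Finset V × Finset V) : mu G st ≤ Fintype.card V := Finset.card_le_univ _

theorem preferred_iff_maxFam (T : Finset V) :
    Preferred G (T : Set V) ↔ MaxFam G (∅, Finset.univ) T := by
  constructor
  · intro h
    refine ⟨⟨h.prop, by simp, by simp⟩, fun T' hT' hle => ?_⟩
    have := h.le_of_ge hT'.1 (by simpa using hle)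
    simpa using this
  · intro h
    refine ⟨h.prop.1, fun S hS hle => ?_⟩
    have := h.le_of_ge (y := S.toFinset) ⟨by simpa using hS, by simp, by simp⟩
      (by simpa using hle)
    simpa using this

theorem ncard_preferred_le {φ : ℝ} (hφ : 1.232 ≤ φ) (h8 : φ ^ 8 = φ ^ 7 + 1)
    (hG : IsOriented G) :
    ({S : Set V | Preferred G S}.ncard : ℝ) ≤ φ ^ Fintype.card V := by
  have : {S : Set V | Preferred G S}.ncard = count G (∅, Finset.univ) := by
    rw [count, ← Set.ncard_coe_finset]
    refine (Set.ncard_congr (fun (T : Finset V) _ => (T : Set V)) ?_ ?_ ?_).symm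
    · intro T hT
      simpa [preferred_iff_maxFam] using hT
    · intro T T' _ _ h
      exact_mod_cast h
    · intro S hS
      refine ⟨S.toFinset, ?_, by simp⟩
      have : Preferred G (S.toFinset : Set V) := by simpa using hS
      simpa [← preferred_iff_maxFam] using hS
  rw [this]
  exact (count_le hφ h8 hG _).trans (pow_le_pow_right₀ (by linarith) (mu_le _))

end Plans

/-- The base of the exponential bound. -/
theorem exists_root : ∃ φ : ℝ, (0 < φ ∧ 1 - φ ^ (-1 : ℤ) - φ ^ (-8 : ℤ) = 0) ∧
    (∀ x : ℝ, 0 < x → 1 - x ^ (-1 : ℤ) - x ^ (-8 : ℤ) = 0 → x = φ) ∧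
    1.232045 < φ ∧ φ < 1.232055 ∧ φ ^ 8 = φ ^ 7 + 1 := by
  have eqv : ∀ x : ℝ, 0 < x → (1 - x ^ (-1 : ℤ) - x ^ (-8 : ℤ) = 0 ↔ x ^ 8 = x ^ 7 + 1) := by
    intro x hx
    have h : 1 - x ^ (-1 : ℤ) - x ^ (-8 : ℤ) = (x ^ 8 - x ^ 7 - 1) / x ^ 8 := by
      rw [zpow_neg, zpow_neg, zpow_one, show (8 : ℤ) = ((8 : ℕ) : ℤ) from rfl, zpow_natCast]
      field_simp
    rw [h, div_eq_zero_iff, or_iff_left (by positivity)]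
    constructor <;> intro h <;> linarith
  have one_lt : ∀ x : ℝ, 0 < x → x ^ 8 = x ^ 7 + 1 → 1 < x := by
    intro x hx h
    by_contra hle
    have h7 : 0 < x ^ 7 := by positivity
    have : x ^ 8 ≤ x ^ 7 := pow_le_pow_of_le_one hx.le (not_lt.1 hle) (by norm_num)
    linarith
  have mono : ∀ x y : ℝ, 1 < x → x < y → x ^ 8 - x ^ 7 < y ^ 8 - y ^ 7 := by
    intro x y hx hxy
    have h₁ : x ^ 7 < y ^ 7 := pow_lt_pow_left₀ hxy (by linarith) (by norm_num)
    have h₂ : 0 < x ^ 7 := by positivity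
    have e : ∀ z : ℝ, z ^ 8 - z ^ 7 = z ^ 7 * (z - 1) := fun z => by ring
    rw [e, e]
    exact mul_lt_mul h₁ (by linarith) (by linarith) (by linarith)
  have hcont : ContinuousOn (fun x : ℝ => x ^ 8 - x ^ 7) (Set.Icc 1.232045 1.232055) := by fun_prop
  obtain ⟨φ, ⟨hl, hr⟩, hφ⟩ := intermediate_value_Ioo (by norm_num) hcont
    (show (1 : ℝ) ∈ Set.Ioo _ _ by constructor <;> norm_num)
  simp only at hφ
  have h8 : φ ^ 8 = φ ^ 7 + 1 := by linarith
  have h0 : 0 < φ := by linarith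
  refine ⟨φ, ⟨h0, (eqv φ h0).2 h8⟩, fun x hx h => ?_, hl, hr, h8⟩
  have hx8 := (eqv x hx).1 h
  have hx1 := one_lt x hx hx8
  rcases lt_trichotomy x φ with hlt | rfl | hlt
  · have := mono x φ hx1 hlt
    linarith
  · rfl
  · have := mono φ x (by linarith) hlt
    linarith

end Argumentation

/-! ## Evaluation within a given number of steps -/

namespace ConsProg

open ConsProg.Val

variable {P : Program}

/-- The expression `a` evaluates to `v` in at most `c` steps. -/
def Ev (P : Program) (env : List Val) (a : Expr) (v : Val) (c : ℕ) : Prop :=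
  ∃ t ≤ c, Eval P env a v t

/-- The function `f` maps `x` to `y` in at most `c` steps. -/
def Fn (P : Program) (f : ℕ) (x y : Val) (c : ℕ) : Prop :=
  ∃ body, P[f]? = some body ∧ Ev P [x] body y c

theorem Eval.append {env : List Val} {a : Expr} {v : Val} {t : ℕ} (h : Eval P env a v t)
    (env' : List Val) : Eval P (env ++ env') a v t := by
  induction h with
  | var h =>
    refine .var ?_
    rw [List.getElem?_append_left (List.getElem?_eq_some_iff.1 h).1, h]
  | nil => exact .nil
  | cons _ _ ih₁ ih₂ => exact .cons ih₁ ih₂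
  | fst _ ih => exact .fst ih
  | snd _ ih => exact .snd ih
  | iteCons _ _ ih₁ ih₂ => exact .iteCons ih₁ ih₂
  | iteNil _ _ ih₁ ih₂ => exact .iteNil ih₁ ih₂
  | letIn _ _ ih₁ ih₂ => exact .letIn ih₁ ih₂
  | call hb _ h₂ ih₁ _ => exact .call hb ih₁ h₂

theorem Ev.append {env : List Val} {a : Expr} {v : Val} {c : ℕ} (h : Ev P env a v c)
    (env' : List Val) : Ev P (env ++ env') a v c :=
  h.imp fun _ h => ⟨h.1, h.2.append env'⟩

theorem Ev.mono {env : List Val} {a : Expr} {v : Val} {c d : ℕ} (h : Ev P env a v c)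
    (hcd : c ≤ d) : Ev P env a v d :=
  h.imp fun _ h => ⟨h.1.trans hcd, h.2⟩

theorem Ev.congr {env : List Val} {a : Expr} {v w : Val} {c : ℕ} (h : Ev P env a v c)
    (hvw : v = w) : Ev P env a w c := hvw ▸ h

theorem Fn.mono {f : ℕ} {x y : Val} {c d : ℕ} (h : Fn P f x y c) (hcd : c ≤ d) : Fn P f x y d :=
  h.imp fun _ h => ⟨h.1, h.2.mono hcd⟩

theorem Fn.congr {f : ℕ} {x y z : Val} {c : ℕ} (h : Fn P f x y c) (hyz : y = z) : Fn P f x z c :=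
  hyz ▸ h

theorem Ev.nil {env : List Val} : Ev P env .nil .nil 1 := ⟨1, le_rfl, .nil⟩

theorem Ev.truth {env : List Val} : Ev P env (.cons .nil .nil) (ofBool true) 3 :=
  ⟨3, le_rfl, .cons .nil .nil⟩

theorem Ev.cons {env : List Val} {a b : Expr} {v w : Val} {s t : ℕ} (h₁ : Ev P env a v s)
    (h₂ : Ev P env b w t) : Ev P env (.cons a b) (.cons v w) (s + t + 1) := by
  obtain ⟨s', hs, h₁⟩ := h₁
  obtain ⟨t', ht, h₂⟩ := h₂
  exact ⟨s' + t' + 1, by omega, .cons h₁ h₂⟩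

theorem Ev.iteCons {env : List Val} {c a b : Expr} {x y v : Val} {s t : ℕ}
    (h₁ : Ev P env c (.cons x y) s) (h₂ : Ev P env a v t) :
    Ev P env (.ite c a b) v (s + t + 1) := by
  obtain ⟨s', hs, h₁⟩ := h₁
  obtain ⟨t', ht, h₂⟩ := h₂
  exact ⟨s' + t' + 1, by omega, .iteCons h₁ h₂⟩

theorem Ev.iteNil {env : List Val} {c a b : Expr} {v : Val} {s t : ℕ}
    (h₁ : Ev P env c .nil s) (h₂ : Ev P env b v t) : Ev P env (.ite c a b) v (s + t + 1) := by
  obtain ⟨s', hs, h₁⟩ := h₁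
  obtain ⟨t', ht, h₂⟩ := h₂
  exact ⟨s' + t' + 1, by omega, .iteNil h₁ h₂⟩

theorem Ev.ite {env : List Val} {c a b : Expr} {p : Bool} {v : Val} {s t : ℕ}
    (h₁ : Ev P env c (ofBool p) s) (ha : p = true → Ev P env a v t)
    (hb : p = false → Ev P env b v t) : Ev P env (.ite c a b) v (s + t + 1) := by
  cases p with
  | true => exact h₁.iteCons (ha rfl)
  | false => exact h₁.iteNil (hb rfl)

theorem Ev.and {env : List Val} {c a : Expr} {p q : Bool} {s t : ℕ}
    (h₁ : Ev P env c (ofBool p) s) (h₂ : Ev P env a (ofBool q) t) :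
    Ev P env (.ite c a .nil) (ofBool (p && q)) (s + t + 2) := by
  refine (h₁.ite (t := t + 1) ?_ ?_).mono (by omega)
  · rintro rfl
    exact h₂.mono (by omega)
  · rintro rfl
    exact Ev.nil.mono (by omega)

theorem Ev.not {env : List Val} {c : Expr} {p : Bool} {s : ℕ} (h : Ev P env c (ofBool p) s) :
    Ev P env (.ite c .nil (.cons .nil .nil)) (ofBool !p) (s + 4) := by
  refine (h.ite (t := 3) ?_ ?_).mono (by omega)
  · rintro rfl
    exact Ev.nil.mono (by omega)
  · rintro rfl
    exact Ev.truth

/-- `not c` and then `a`. -/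
theorem Ev.notAnd {env : List Val} {c a : Expr} {p q : Bool} {s t : ℕ}
    (h₁ : Ev P env c (ofBool p) s) (h₂ : Ev P env a (ofBool q) t) :
    Ev P env (.ite c .nil a) (ofBool (!p && q)) (s + t + 2) := by
  refine (h₁.ite (t := t + 1) ?_ ?_).mono (by omega)
  · rintro rfl
    exact Ev.nil.mono (by omega)
  · rintro rfl
    exact h₂.mono (by omega)

theorem Ev.or {env : List Val} {c a : Expr} {p q : Bool} {s t : ℕ}
    (h₁ : Ev P env c (ofBool p) s) (h₂ : Ev P env a (ofBool q) t) :
    Ev P env (.ite c (.cons .nil .nil) a) (ofBool (p || q)) (s + t + 4) := by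
  refine (h₁.ite (t := t + 3) ?_ ?_).mono (by omega)
  · rintro rfl
    exact Ev.truth.mono (by omega)
  · rintro rfl
    exact h₂.mono (by omega)

theorem Ev.letIn {env : List Val} {a b : Expr} {v w : Val} {s t : ℕ} (h₁ : Ev P env a v s)
    (h₂ : Ev P (v :: env) b w t) : Ev P env (.letIn a b) w (s + t + 1) := by
  obtain ⟨s', hs, h₁⟩ := h₁
  obtain ⟨t', ht, h₂⟩ := h₂
  exact ⟨s' + t' + 1, by omega, .letIn h₁ h₂⟩

theorem Ev.call {env : List Val} {f : ℕ} {a : Expr} {v w : Val} {s t : ℕ} (h₁ : Ev P env a v s)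
    (h₂ : Fn P f v w t) : Ev P env (.call f a) w (s + t + 1) := by
  obtain ⟨s', hs, h₁⟩ := h₁
  obtain ⟨body, hb, t', ht, h₂⟩ := h₂
  exact ⟨s' + t' + 1, by omega, .call hb h₁ h₂⟩

namespace Expr

/-- Expressions made of variables, `nil`, `cons`, `fst` and `snd`. -/
def isPath (k : ℕ) : Expr → Bool
  | var i => decide (i < k)
  | nil => true
  | cons a b => isPath k a && isPath k b
  | fst a => isPath k a
  | snd a => isPath k a
  | _ => false

/-- The value of such an expression. -/
def pathVal (env : List Val) : Expr → Val
  | var i => env.getD i .nil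
  | cons a b => .cons (pathVal env a) (pathVal env b)
  | fst a => (pathVal env a).fst
  | snd a => (pathVal env a).snd
  | _ => .nil

/-- The number of evaluation steps of such an expression. -/
def pathCost : Expr → ℕ
  | cons a b => pathCost a + pathCost b + 1
  | fst a => pathCost a + 1
  | snd a => pathCost a + 1
  | _ => 1

end Expr

theorem Ev.path {env : List Val} {a : Expr} {v : Val}
    (h : a.isPath env.length = true := by rfl) (hv : a.pathVal env = v := by rfl) :
    Ev P env a v a.pathCost := by
  subst hv
  refine ⟨_, le_rfl, ?_⟩
  induction a with
  | var i =>
    simp only [Expr.isPath, decide_eq_true_eq] at h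
    refine .var ?_
    simp [Expr.pathVal, List.getElem?_eq_getElem h]
  | nil => exact .nil
  | cons a b iha ihb =>
    simp only [Expr.isPath, Bool.and_eq_true] at h
    exact .cons (iha h.1) (ihb h.2)
  | fst a ih => exact .fst (ih h)
  | snd a ih => exact .snd (ih h)
  | ite => simp [Expr.isPath] at h
  | letIn => simp [Expr.isPath] at h
  | call => simp [Expr.isPath] at h

/-! ### Loops -/

open ConsProg.Expr in
/-- On `(x . l)`: the values of `e` at `(x . a)`, for `a` in the list `l`. -/
def mapBody (self : ℕ) (e : Expr) : Expr :=
  ite (snd (var 0))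
    (cons (letIn (cons (fst (var 0)) (fst (snd (var 0)))) e)
      (call self (cons (fst (var 0)) (snd (snd (var 0))))))
    nil

open ConsProg.Expr in
/-- On `(x . l)`: whether `e` holds at `(x . a)` for some `a` in the list `l`. -/
def anyBody (self : ℕ) (e : Expr) : Expr :=
  ite (snd (var 0))
    (ite (letIn (cons (fst (var 0)) (fst (snd (var 0)))) e) (cons nil nil)
      (call self (cons (fst (var 0)) (snd (snd (var 0))))))
    nil

open ConsProg.Expr in
/-- On `(x . l)`: the first `a` in the list `l` for which `e` holds at `(x . a)`. -/
def findBody (self : ℕ) (e : Expr) : Expr :=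
  ite (snd (var 0))
    (ite (letIn (cons (fst (var 0)) (fst (snd (var 0)))) e) (fst (snd (var 0)))
      (call self (cons (fst (var 0)) (snd (snd (var 0))))))
    nil

open ConsProg.Expr in
/-- On `(x . (l . s))`: the state `s` is replaced by the value of `e` at `(x . (a . s))`, for each
`a` in the list `l`. -/
def foldBody (self : ℕ) (e : Expr) : Expr :=
  ite (fst (snd (var 0)))
    (call self (cons (fst (var 0)) (cons (snd (fst (snd (var 0))))
      (letIn (cons (fst (var 0)) (cons (fst (fst (snd (var 0)))) (snd (snd (var 0))))) e))))
    (snd (snd (var 0)))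

open ConsProg.Expr in
/-- On `(k . l)`, for lists of the same length: the values of `e` at the pairs of tails. -/
def zipBody (self : ℕ) (e : Expr) : Expr :=
  ite (fst (var 0))
    (cons e (call self (cons (snd (fst (var 0))) (snd (snd (var 0))))))
    nil

/-- The cost of a loop of `n` rounds. -/
def loopCost (n c : ℕ) : ℕ := n * (c + 40) + 10

theorem loopCost_succ (n c : ℕ) : loopCost (n + 1) c = loopCost n c + c + 40 := by
  unfold loopCost
  ring

theorem loopCost_mono {n m c d : ℕ} (h : n ≤ m) (h' : c ≤ d) : loopCost n c ≤ loopCost m d := by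
  unfold loopCost
  gcongr

theorem Fn.map {self : ℕ} {e : Expr} (hP : P[self]? = some (mapBody self e)) {α : Type*}
    {g F : α → Val} {x : Val} {c : ℕ} {l : List α}
    (h : ∀ a ∈ l, Ev P [.cons x (g a)] e (F a) c) :
    Fn P self (.cons x (ofList (l.map g))) (ofList (l.map F)) (loopCost l.length c) := by
  refine ⟨_, hP, ?_⟩
  induction l with
  | nil => exact (Ev.iteNil .path .nil).mono (by simp [loopCost, Expr.pathCost])
  | cons a l ih =>
    have h₁ := (h a (by simp)).append [.cons x (ofList ((a :: l).map g))]
    have ih := ih fun b hb => h b (by simp [hb])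
    rw [List.length_cons, loopCost_succ]
    refine (Ev.iteCons .path ((Ev.letIn .path h₁).cons
      (Ev.call .path ⟨_, hP, ih⟩))).mono ?_
    simp only [Expr.pathCost]
    omega

theorem Fn.any {self : ℕ} {e : Expr} (hP : P[self]? = some (anyBody self e)) {α : Type*}
    {g : α → Val} {p : α → Bool} {x : Val} {c : ℕ} {l : List α}
    (h : ∀ a ∈ l, Ev P [.cons x (g a)] e (ofBool (p a)) c) :
    Fn P self (.cons x (ofList (l.map g))) (ofBool (l.any p)) (loopCost l.length c) := by
  refine ⟨_, hP, ?_⟩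
  induction l with
  | nil => exact (Ev.iteNil .path .nil).mono (by simp [loopCost, Expr.pathCost])
  | cons a l ih =>
    have h₁ := (h a (by simp)).append [.cons x (ofList ((a :: l).map g))]
    have ih := ih fun b hb => h b (by simp [hb])
    rw [List.length_cons, loopCost_succ, List.any_cons]
    refine (Ev.iteCons .path ((Ev.letIn .path h₁).or
      (Ev.call .path ⟨_, hP, ih⟩))).mono ?_
    simp only [Expr.pathCost]
    omega

theorem Fn.find {self : ℕ} {e : Expr} (hP : P[self]? = some (findBody self e)) {α : Type*}
    {g : α → Val} {p : α → Bool} {x : Val} {c : ℕ} {l : List α}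
    (h : ∀ a ∈ l, Ev P [.cons x (g a)] e (ofBool (p a)) c) (hex : ∃ a ∈ l, p a = true) :
    ∃ a ∈ l, p a = true ∧
      Fn P self (.cons x (ofList (l.map g))) (g a) (loopCost l.length c) := by
  induction l with
  | nil => simp at hex
  | cons a l ih =>
    have h₁ := (h a (by simp)).append [.cons x (ofList ((a :: l).map g))]
    rw [List.length_cons, loopCost_succ]
    cases hp : p a with
    | true =>
      refine ⟨a, by simp, hp, _, hP, ?_⟩
      rw [hp] at h₁
      refine (Ev.iteCons .path ((Ev.letIn .path h₁).iteCons .path)).mono ?_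
      simp only [Expr.pathCost]
      omega
    | false =>
      obtain ⟨b, hb, hpb, hf⟩ := ih (fun b hb => h b (by simp [hb])) (by
        obtain ⟨b, hb, hpb⟩ := hex
        rcases List.mem_cons.1 hb with rfl | hb
        · simp [hp] at hpb
        · exact ⟨b, hb, hpb⟩)
      refine ⟨b, by simp [hb], hpb, _, hP, ?_⟩
      rw [hp] at h₁
      refine (Ev.iteCons .path ((Ev.letIn .path h₁).iteNil
        (Ev.call .path hf))).mono ?_
      simp only [Expr.pathCost]
      omega

theorem Fn.fold {self : ℕ} {e : Expr} (hP : P[self]? = some (foldBody self e)) {α β : Type*}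
    {g : α → Val} {k : β → Val} {f : α → β → β} {x : Val} {c : ℕ} {l : List α}
    (h : ∀ a ∈ l, ∀ s, Ev P [.cons x (.cons (g a) (k s))] e (k (f a s)) c) (s : β) :
    Fn P self (.cons x (.cons (ofList (l.map g)) (k s))) (k (l.foldl (fun s a => f a s) s))
      (loopCost l.length c) := by
  refine ⟨_, hP, ?_⟩
  induction l generalizing s with
  | nil => exact (Ev.iteNil .path .path).mono (by simp [loopCost, Expr.pathCost])
  | cons a l ih =>
    have h₁ := (h a (by simp) s).append [.cons x (.cons (ofList ((a :: l).map g)) (k s))]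
    have ih := ih (fun b hb => h b (by simp [hb])) (f a s)
    rw [List.length_cons, loopCost_succ]
    refine (Ev.iteCons .path (Ev.call (Ev.cons .path
      (Ev.cons .path (Ev.letIn .path h₁))) ⟨_, hP, ih⟩)).mono ?_
    simp only [Expr.pathCost]
    omega

theorem Fn.zip {self : ℕ} {e : Expr} (hP : P[self]? = some (zipBody self e)) {α : Type*}
    {g g' F : α → Val} {c : ℕ} {l : List α}
    (h : ∀ a ∈ l, ∀ x y, Ev P [.cons (.cons (g a) x) (.cons (g' a) y)] e (F a) c) :
    Fn P self (.cons (ofList (l.map g)) (ofList (l.map g'))) (ofList (l.map F))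
      (loopCost l.length c) := by
  refine ⟨_, hP, ?_⟩
  induction l with
  | nil => exact (Ev.iteNil .path .nil).mono (by simp [loopCost, Expr.pathCost])
  | cons a l ih =>
    have h₁ := h a (by simp) (ofList (l.map g)) (ofList (l.map g'))
    have ih := ih fun b hb => h b (by simp [hb])
    rw [List.length_cons, loopCost_succ]
    refine (Ev.iteCons .path (h₁.cons (Ev.call .path ⟨_, hP, ih⟩))).mono ?_
    simp only [Expr.pathCost]
    omega

end ConsProg

/-! ## The program -/

namespace ConsProg

open ConsProg.Expr

/-- Intersection of bit vectors. -/
def interE (a b : Expr) : Expr := call 1 (cons a b)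

/-- Difference of bit vectors. -/
def diffE (a b : Expr) : Expr := call 2 (cons a b)

/-- Union of bit vectors. -/
def unionE (a b : Expr) : Expr := call 3 (cons a b)

/-- Whether a bit vector has a nonzero entry. -/
def nonemptyE (a : Expr) : Expr := call 4 (cons nil a)

/-- The bit vector of the vertex described by a record. -/
def selfE (r : Expr) : Expr := fst r

/-- The in-neighbours of the vertex described by a record. -/
def inE (r : Expr) : Expr := fst (snd r)

/-- The out-neighbours of the vertex described by a record. -/
def outE (r : Expr) : Expr := fst (snd (snd r))

/-- The neighbours of the vertex described by a record. -/
def nbrE (r : Expr) : Expr := snd (snd (snd r))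

/-- The argument of the function. -/
def arg : Expr := var 0

/-- The negation of a truth value. -/
def notE (a : Expr) : Expr := ite a nil (cons nil nil)

/-- An expression with a given value. -/
def constE : Val → Expr
  | .nil => nil
  | .cons v w => cons (constE v) (constE w)

/-- Natural numbers in unary. -/
def unary (k : ℕ) : Val := Val.ofList (List.replicate k .nil)

/-- The list of templates. -/
def templatesVal : Val :=
  Val.ofList (Argumentation.templates.map fun as => Val.ofList (as.map unary))

/-- The program that enumerates preferred extensions. -/
def prog : Program :=
  [ -- 0: the main function
    letIn (call 38 arg)
      (letIn (call 42 (cons (var 0) (call 41 (cons (call 40 (cons (var 1) (var 0))) (var 1)))))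
        (call 33 (cons (var 0)
          (cons (call 35 (cons nil (var 2))) (call 36 (cons nil (var 2))))))),
    -- 1, 2, 3, 4: intersection, difference, union, nonemptiness
    zipBody 1 (ite (fst (fst arg)) (fst (snd arg)) nil),
    zipBody 2 (ite (fst (fst arg)) (notE (fst (snd arg))) nil),
    zipBody 3 (ite (fst (fst arg)) (cons nil nil) (fst (snd arg))),
    anyBody 4 (snd arg),
    -- 5, 6: the vertices that are possible after one round of propagation
    anyBody 5 (ite (nonemptyE (interE (selfE (snd arg)) (inE (snd (fst arg)))))
      (notE (nonemptyE (diffE (interE (snd (fst (fst arg))) (inE (snd arg)))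
        (nbrE (snd (fst arg)))))) nil),
    mapBody 6 (ite (nonemptyE (interE (selfE (snd arg)) (snd (snd (fst arg)))))
      (ite (nonemptyE (interE (nbrE (snd arg)) (fst (snd (fst arg))))) nil
        (notE (call 5 (cons (cons (snd (fst arg)) (snd arg)) (fst (fst arg)))))) nil),
    -- 7, 8: the vertices that are chosen after one round of propagation
    anyBody 7 (ite (nonemptyE (interE (selfE (snd (fst arg))) (inE (snd arg))))
      (ite (nonemptyE (interE (outE (snd arg)) (fst (fst (fst arg)))))
        (notE (nonemptyE (diffE (interE (snd (fst (fst arg))) (inE (snd arg)))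
          (selfE (snd (fst arg)))))) nil) nil),
    mapBody 8 (ite (nonemptyE (interE (selfE (snd arg)) (fst (snd (fst arg))))) (cons nil nil)
      (call 7 (cons (cons (snd (fst arg)) (snd arg)) (fst (fst arg))))),
    -- 9, 10: propagation
    foldBody 9 (cons (call 8 (cons (cons (fst arg) (snd (snd arg))) (fst arg)))
      (call 6 (cons (cons (fst arg) (snd (snd arg))) (fst arg)))),
    call 9 (cons (fst arg) (cons (fst arg)
      (call 9 (cons (fst arg) (cons (fst arg) (snd arg)))))),
    -- 11, 12: the core
    mapBody 11 (ite (nonemptyE (interE (selfE (snd arg)) (fst arg)))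
      (ite (nonemptyE (interE (inE (snd arg)) (fst arg)))
        (nonemptyE (interE (outE (snd arg)) (fst arg))) nil) nil),
    foldBody 12 (call 11 (cons (snd (snd arg)) (fst arg))),
    -- 13, 14: cardinality and measure
    ite arg (ite (fst arg) (cons nil (call 13 (snd arg))) (call 13 (snd arg))) nil,
    letIn (call 10 arg) (call 13 (call 12 (cons (fst (var 1)) (cons (fst (var 1))
      (diffE (snd (var 0)) (fst (var 0))))))),
    -- 15: the measures of the branches of a plan
    ite (snd (snd arg))
      (cons (call 14 (cons (fst arg) (cons
          (unionE (fst (snd (snd arg))) (fst (fst (snd arg)))) (snd (fst (snd arg))))))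
        (call 15 (cons (fst arg) (cons (cons (fst (fst (snd arg)))
          (diffE (snd (fst (snd arg))) (fst (snd (snd arg))))) (snd (snd (snd arg)))))))
      (cons (call 14 (cons (fst arg) (fst (snd arg)))) nil),
    -- 16, 17: concatenation of lists, comparison of lengths
    ite (fst arg) (cons (fst (fst arg)) (call 16 (cons (snd (fst arg)) (snd arg)))) (snd arg),
    ite (fst arg) (ite (snd arg) (call 17 (cons (snd (fst arg)) (snd (snd arg)))) nil)
      (cons nil nil),
    -- 18, 19, 20: the search for a plan
    ite (fst (snd arg)) (ite (snd (snd arg))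
        (ite (call 17 (cons (call 16 (cons (fst (fst (snd arg))) (fst (snd (snd arg))))) (fst arg)))
          (call 18 (cons (fst arg) (cons (snd (fst (snd arg))) (snd (snd (snd arg)))))) nil) nil)
      (notE (snd (snd arg))),
    anyBody 19 (call 18 (cons (fst (fst arg)) (cons (snd arg) (snd (fst arg))))),
    findBody 20 (call 19 (cons (cons (snd (snd (fst arg)))
      (call 15 (cons (fst (fst arg)) (cons (fst (snd (fst arg))) (snd arg)))))
      (constE templatesVal))),
    -- 21, 22, 23: all plans
    mapBody 21 arg,
    foldBody 22 (call 16 (cons (call 21 (cons (selfE (fst (snd arg))) (fst arg)))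
      (snd (snd arg)))),
    letIn (call 22 (cons (cons nil nil) (cons arg nil)))
      (letIn (call 22 (cons (var 0) (cons (var 1) nil)))
        (letIn (call 22 (cons (var 0) (cons (var 2) nil)))
          (call 16 (cons (var 2) (call 16 (cons (var 1) (var 0))))))),
    -- 24, 25, 26: the largest subset that defends itself
    anyBody 24 (ite (nonemptyE (interE (selfE (snd arg)) (inE (snd (fst arg)))))
      (notE (nonemptyE (interE (inE (snd arg)) (fst (fst arg))))) nil),
    mapBody 25 (ite (nonemptyE (interE (selfE (snd arg)) (snd (fst arg))))
      (notE (call 24 (cons (cons (snd (fst arg)) (snd arg)) (fst (fst arg))))) nil),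
    foldBody 26 (call 25 (cons (cons (fst arg) (snd (snd arg))) (fst arg))),
    -- 27, 28: the case of an empty core
    anyBody 27 (ite (nonemptyE (interE (selfE (snd arg)) (fst arg)))
      (nonemptyE (interE (nbrE (snd arg)) (fst arg))) nil),
    ite (call 27 (cons (snd (snd arg)) (fst arg))) nil
      (letIn (call 26 (cons (fst arg) (cons (fst arg) (snd (snd arg)))))
        (ite (nonemptyE (diffE (fst (snd (var 1))) (var 0))) nil (cons (var 0) nil))),
    -- 29, 30, 31, 32: removing the members of a list of bit vectors from another one
    ite (snd arg) (ite (fst (snd arg))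
        (cons (fst (fst arg)) (call 29 (cons (snd (fst arg)) (snd (snd arg)))))
        (cons (call 29 (cons (fst (fst arg)) (snd (snd arg)))) (snd (fst arg))))
      (cons nil nil),
    ite (snd arg) (ite (fst (snd arg))
        (call 30 (cons (snd (fst arg)) (snd (snd arg))))
        (call 30 (cons (fst (fst arg)) (snd (snd arg)))))
      (fst arg),
    foldBody 31 (call 29 (cons (snd (snd arg)) (call 26 (cons (fst (fst arg))
      (cons (fst (fst arg)) (diffE (fst (snd arg)) (snd (fst arg)))))))),
    ite (fst (snd arg)) (ite (call 30 (cons (fst arg) (fst (fst (snd arg)))))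
        (call 32 (cons (fst arg) (cons (snd (fst (snd arg))) (snd (snd arg)))))
        (cons (fst (fst (snd arg)))
          (call 32 (cons (fst arg) (cons (snd (fst (snd arg))) (snd (snd arg)))))))
      (snd (snd arg)),
    -- 33, 34: the enumeration
    letIn (call 14 arg) (ite (var 0)
      (letIn (call 10 (var 1))
        (letIn (call 20 (cons (cons (fst (var 2)) (cons (var 0) (var 1))) (call 23 (fst (var 2)))))
          (call 34 (cons (fst (var 3)) (cons (var 1) (var 0))))))
      (call 28 (cons (fst (var 1)) (call 10 (var 1))))),
    ite (snd (snd arg))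
      (letIn (call 33 (cons (fst arg) (cons
          (unionE (fst (snd (snd arg))) (fst (fst (snd arg)))) (snd (fst (snd arg))))))
        (letIn (call 34 (cons (fst (var 1)) (cons (cons (fst (fst (snd (var 1))))
            (diffE (snd (fst (snd (var 1)))) (fst (snd (snd (var 1))))))
            (snd (snd (snd (var 1)))))))
          (letIn (call 31 (cons (cons (fst (var 2)) (fst (snd (snd (var 2))))) (cons (var 1) nil)))
            (call 32 (cons (var 0) (cons (var 1) (var 2)))))))
      (call 33 (cons (fst arg) (fst (snd arg)))),
    -- 35, 36, 37, 38: zero vector, one vector, identity matrix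
    mapBody 35 nil,
    mapBody 36 (cons nil nil),
    mapBody 37 arg,
    ite arg (cons (cons (cons nil nil) (call 35 (cons nil (snd arg))))
      (call 37 (cons nil (call 38 (snd arg))))) nil,
    -- 39, 40, 41, 42: the records of the vertices
    mapBody 39 (nonemptyE (interE (fst arg) (snd arg))),
    mapBody 40 (call 39 (cons (snd arg) (fst arg))),
    zipBody 41 (cons (fst (fst arg)) (cons (fst (snd arg))
      (unionE (fst (fst arg)) (fst (snd arg))))),
    zipBody 42 (cons (fst (fst arg)) (fst (snd arg))) ]

end ConsProg

namespace Argumentation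

open ConsProg

section Encoding

open Classical

variable {V : Type*}

/-- The bit vector of a set, the vertices being listed in the order `vl`. -/
noncomputable def enc (vl : List V) (X : Finset V) : Val :=
  Val.ofList (vl.map fun v => Val.ofBool (decide (v ∈ X)))

theorem ofBool_congr {p : Bool} {q : Prop} [Decidable q] (h : p = true ↔ q) :
    Val.ofBool p = Val.ofBool (decide q) := by
  rw [Bool.eq_iff_iff.2 (h.trans decide_eq_true_iff.symm)]

/-- The cost of an operation on bit vectors. -/
def bitCost (n : ℕ) : ℕ := loopCost n 20

theorem ev_inter {vl : List V} {X Y : Finset V} {env : List Val} {a b : Expr} {s t : ℕ}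
    (h₁ : Ev prog env a (enc vl X) s) (h₂ : Ev prog env b (enc vl Y) t) :
    Ev prog env (interE a b) (enc vl (X ∩ Y)) (s + t + bitCost vl.length + 2) := by
  refine (Ev.call (h₁.cons h₂) (Fn.congr (Fn.zip (c := 20)
    (F := fun v => Val.ofBool (decide (v ∈ X) && decide (v ∈ Y))) rfl
    fun v _ x y => ?_) ?_)).mono ?_
  · exact (Ev.and .path .path).mono (by decide)
  · simp [enc]
  · unfold bitCost
    omega

theorem ev_diff {vl : List V} {X Y : Finset V} {env : List Val} {a b : Expr} {s t : ℕ}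
    (h₁ : Ev prog env a (enc vl X) s) (h₂ : Ev prog env b (enc vl Y) t) :
    Ev prog env (diffE a b) (enc vl (X \ Y)) (s + t + bitCost vl.length + 2) := by
  refine (Ev.call (h₁.cons h₂) (Fn.congr (Fn.zip (c := 20)
    (F := fun v => Val.ofBool (decide (v ∈ X) && !decide (v ∈ Y))) rfl
    fun v _ x y => ?_) ?_)).mono ?_
  · exact (Ev.and .path (Ev.not .path)).mono (by decide)
  · simp [enc]
  · unfold bitCost
    omega

theorem ev_union {vl : List V} {X Y : Finset V} {env : List Val} {a b : Expr} {s t : ℕ}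
    (h₁ : Ev prog env a (enc vl X) s) (h₂ : Ev prog env b (enc vl Y) t) :
    Ev prog env (unionE a b) (enc vl (X ∪ Y)) (s + t + bitCost vl.length + 2) := by
  refine (Ev.call (h₁.cons h₂) (Fn.congr (Fn.zip (c := 20)
    (F := fun v => Val.ofBool (decide (v ∈ X) || decide (v ∈ Y))) rfl
    fun v _ x y => ?_) ?_)).mono ?_
  · exact (Ev.or .path .path).mono (by decide)
  · simp [enc]
  · unfold bitCost
    omega

theorem ev_nonempty {vl : List V} (hvl : ∀ v, v ∈ vl) {X : Finset V} {env : List Val} {a : Expr}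
    {s : ℕ} (h : Ev prog env a (enc vl X) s) :
    Ev prog env (nonemptyE a) (Val.ofBool (decide (∃ x, x ∈ X))) (s + bitCost vl.length + 3) := by
  refine (Ev.call (Ev.nil.cons h) (Fn.congr (Fn.any (c := 20) (p := fun v => decide (v ∈ X)) rfl
    fun v _ => ?_) ?_)).mono ?_
  · exact Ev.mono .path (by decide)
  · exact ofBool_congr (by simp [hvl])
  · unfold bitCost
    omega

theorem ev_meets {vl : List V} (hvl : ∀ v, v ∈ vl) {X Y : Finset V} {env : List Val} {a b : Expr}
    {s t : ℕ} (h₁ : Ev prog env a (enc vl X) s) (h₂ : Ev prog env b (enc vl Y) t) :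
    Ev prog env (nonemptyE (interE a b)) (Val.ofBool (decide (∃ x ∈ X, x ∈ Y)))
      (s + t + 2 * bitCost vl.length + 5) :=
  ((ev_nonempty hvl (ev_inter h₁ h₂)).congr (by simp)).mono (by omega)

theorem ev_mem {vl : List V} (hvl : ∀ v, v ∈ vl) {v : V} {Y : Finset V} {env : List Val}
    {a b : Expr} {s t : ℕ} (h₁ : Ev prog env a (enc vl {v}) s) (h₂ : Ev prog env b (enc vl Y) t) :
    Ev prog env (nonemptyE (interE a b)) (Val.ofBool (decide (v ∈ Y)))
      (s + t + 2 * bitCost vl.length + 5) :=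
  (ev_meets hvl h₁ h₂).congr (by simp)

theorem ev_interDiff {vl : List V} (hvl : ∀ v, v ∈ vl) {X Y Z : Finset V} {env : List Val}
    {a b c : Expr} {s t r : ℕ} (h₁ : Ev prog env a (enc vl X) s) (h₂ : Ev prog env b (enc vl Y) t)
    (h₃ : Ev prog env c (enc vl Z) r) :
    Ev prog env (nonemptyE (diffE (interE a b) c))
      (Val.ofBool (decide (∃ x ∈ X, x ∈ Y ∧ x ∉ Z)))
      (s + t + r + 3 * bitCost vl.length + 7) :=
  ((ev_nonempty hvl (ev_diff (ev_inter h₁ h₂) h₃)).congr (by simp [and_assoc])).mono (by omega)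

theorem ofBool_any {vl : List V} (hvl : ∀ v, v ∈ vl) {p : V → Prop} [DecidablePred p] {q : Prop}
    [Decidable q] (h : (∃ v, p v) ↔ q) :
    Val.ofBool (vl.any fun v => decide (p v)) = Val.ofBool (decide q) :=
  ofBool_congr (by simp [hvl, h])

theorem ofList_map_eq_enc {vl : List V} {X : Finset V} {p : V → Prop} [DecidablePred p]
    (h : ∀ v, p v ↔ v ∈ X) :
    Val.ofList (vl.map fun v => Val.ofBool (decide (p v))) = enc vl X := by
  simp [enc, h]

attribute [irreducible] enc

theorem fn_card {vl : List V} (hvl : ∀ v, v ∈ vl) (hnd : vl.Nodup) (X : Finset V) :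
    Fn prog 13 (enc vl X) (unary X.card) (loopCost vl.length 0) := by
  have h : ∀ l : List V, Fn prog 13 (Val.ofList (l.map fun v => Val.ofBool (decide (v ∈ X))))
      (unary (l.filter (· ∈ X)).length) (loopCost l.length 0) := by
    intro l
    induction l with
    | nil => exact ⟨_, rfl, (Ev.iteNil .path .nil).mono (by simp [loopCost, Expr.pathCost, arg])⟩
    | cons v l ih =>
      rw [List.length_cons, loopCost_succ]
      refine ⟨_, rfl, Ev.mono (Ev.iteCons .path (Ev.ite (p := decide (v ∈ X)) (t := loopCost l.length 0 + 10)
        .path (fun hv => ?_) fun hv => ?_)) ?_⟩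
      · refine ((Ev.nil.cons (Ev.call .path ih)).congr ?_).mono ?_
        · simp only [decide_eq_true_eq] at hv
          simp [hv, unary, List.replicate_succ, Val.ofList]
        · simp only [Expr.pathCost, arg]
          omega
      · refine ((Ev.call .path ih).congr ?_).mono ?_
        · simp only [decide_eq_false_iff_not] at hv
          simp [hv]
        · simp only [Expr.pathCost, arg]
          omega
      · simp only [Expr.pathCost, arg]
        omega
  have hX : (vl.filter (· ∈ X)).length = X.card := by
    rw [← List.toFinset_card_of_nodup (hnd.filter _)]
    congr 1
    ext v
    simp [hvl]
  have := h vl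
  rw [hX, ofList_map_eq_enc (X := X) fun _ => Iff.rfl] at this
  exact this

variable [Fintype V] (G : Digraph V)

/-- The record of a vertex. -/
noncomputable def record (vl : List V) (v : V) : Val :=
  .cons (enc vl {v}) (.cons (enc vl (inNbrs G Finset.univ v))
    (.cons (enc vl (outNbrs G Finset.univ v))
      (enc vl (inNbrs G Finset.univ v ∪ outNbrs G Finset.univ v))))

/-- The list of the records of all vertices. -/
noncomputable def records (vl : List V) : Val := Val.ofList (vl.map (record G vl))

/-- The encoding of a partial solution. -/
noncomputable def encPair (vl : List V) (st : Finset V × Finset V) : Val :=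
  .cons (enc vl st.1) (enc vl st.2)

variable {G}

/-- The cost of testing whether a vertex is impossible. -/
def badCost (n : ℕ) : ℕ := loopCost n (5 * bitCost n + 100)

theorem fn_bad {vl : List V} (hvl : ∀ v, v ∈ vl) (st : Finset V × Finset V) (v : V) :
    Fn prog 5 (.cons (.cons (encPair vl st) (record G vl v)) (records G vl))
      (Val.ofBool (decide (∃ u, G.Adj u v ∧ ∀ t ∈ st.2, G.Adj t u → Nbr G v t)))
      (badCost vl.length) := by
  refine (Fn.any (c := 5 * bitCost vl.length + 100)
    (p := fun u => decide (G.Adj u v ∧ ∀ t ∈ st.2, G.Adj t u → Nbr G v t)) rfl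
    fun u _ => ?_).congr (ofBool_any hvl Iff.rfl)
  refine ((Ev.and (ev_mem hvl (v := u) (Y := inNbrs G Finset.univ v) .path .path)
    (Ev.not (ev_interDiff hvl (X := st.2) (Y := inNbrs G Finset.univ u)
      (Z := inNbrs G Finset.univ v ∪ outNbrs G Finset.univ v) .path .path .path))).congr
    (ofBool_congr ?_)).mono ?_
  · simp [mem_inNbrs, mem_outNbrs, Nbr]
    grind
  · simp only [Expr.pathCost, selfE, inE, nbrE, arg]
    omega

/-- The cost of computing the possible vertices. -/
def keepCost (n : ℕ) : ℕ := loopCost n (4 * bitCost n + badCost n + 100)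

theorem fn_keep {vl : List V} (hvl : ∀ v, v ∈ vl) (st : Finset V × Finset V) :
    Fn prog 6 (.cons (.cons (records G vl) (encPair vl st)) (records G vl))
      (enc vl (step G st).2) (keepCost vl.length) := by
  refine (Fn.map (c := 4 * bitCost vl.length + badCost vl.length + 100)
    (F := fun v => Val.ofBool (decide (v ∈ st.2 ∧ ¬ Bad G st v))) rfl
    fun v _ => ?_).congr (ofList_map_eq_enc (by simp [step]))
  refine ((Ev.and (ev_mem hvl (v := v) (Y := st.2) .path .path)
    (Ev.notAnd (ev_meets hvl (X := inNbrs G Finset.univ v ∪ outNbrs G Finset.univ v) (Y := st.1)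
      .path .path)
    (Ev.not (Ev.call .path (fn_bad hvl st v))))).congr (ofBool_congr ?_)).mono ?_
  · simp only [Bool.and_eq_true, Bool.not_eq_true', decide_eq_true_eq, decide_eq_false_iff_not,
      Bad, Nbr, not_or]
    simp only [Finset.mem_union, mem_inNbrs, mem_outNbrs, Finset.mem_univ, true_and]
    grind
  · simp only [Expr.pathCost, selfE, nbrE, arg]
    omega

/-- The cost of testing whether a vertex is forced. -/
def forcedCost (n : ℕ) : ℕ := loopCost n (7 * bitCost n + 100)

theorem fn_forced {vl : List V} (hvl : ∀ v, v ∈ vl) (st : Finset V × Finset V) (w : V) :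
    Fn prog 7 (.cons (.cons (encPair vl st) (record G vl w)) (records G vl))
      (Val.ofBool (decide (Forced G st w))) (forcedCost vl.length) := by
  refine (Fn.any (c := 7 * bitCost vl.length + 100)
    (p := fun u => decide (G.Adj w u ∧ (∃ v ∈ st.1, G.Adj u v) ∧ ∀ t ∈ st.2, G.Adj t u → t = w)) rfl
    fun u _ => ?_).congr (ofBool_any hvl Iff.rfl)
  refine ((Ev.and (ev_mem hvl (v := w) (Y := inNbrs G Finset.univ u) .path .path)
    (Ev.and (ev_meets hvl (X := outNbrs G Finset.univ u) (Y := st.1) .path .path)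
    (Ev.not (ev_interDiff hvl (X := st.2) (Y := inNbrs G Finset.univ u)
      (Z := {w}) .path .path .path)))).congr (ofBool_congr ?_)).mono ?_
  · simp [mem_inNbrs, mem_outNbrs, and_comm]
    grind
  · simp only [Expr.pathCost, selfE, inE, outE, arg]
    omega

/-- The cost of computing the chosen vertices. -/
def chosenCost (n : ℕ) : ℕ := loopCost n (2 * bitCost n + forcedCost n + 100)

theorem fn_chosen {vl : List V} (hvl : ∀ v, v ∈ vl) (st : Finset V × Finset V) :
    Fn prog 8 (.cons (.cons (records G vl) (encPair vl st)) (records G vl))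
      (enc vl (step G st).1) (chosenCost vl.length) := by
  refine (Fn.map (c := 2 * bitCost vl.length + forcedCost vl.length + 100)
    (F := fun v => Val.ofBool (decide (v ∈ st.1 ∨ Forced G st v))) rfl
    fun v _ => ?_).congr (ofList_map_eq_enc (by simp [step]))
  refine ((Ev.or (ev_mem hvl (v := v) (Y := st.1) .path .path)
    (Ev.call .path (fn_forced hvl st v))).congr (ofBool_congr ?_)).mono ?_
  · simp
  · simp only [Expr.pathCost, selfE, arg]
    omega

/-- Iteration as a fold over the list of all vertices. -/
theorem foldl_const {α β : Type*} (f : β → β) (l : List α) (s : β) :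
    l.foldl (fun s _ => f s) s = f^[l.length] s := by
  induction l generalizing s with
  | nil => rfl
  | cons a l ih => exact ih (f s)

/-- The cost of propagation. -/
def normCost (n : ℕ) : ℕ := 2 * loopCost n (chosenCost n + keepCost n + 100) + 100

theorem fn_norm {vl : List V} (hvl : ∀ v, v ∈ vl) (hcard : vl.length = Fintype.card V)
    (st : Finset V × Finset V) :
    Fn prog 10 (.cons (records G vl) (encPair vl st)) (encPair vl (norm G st))
      (normCost vl.length) := by
  have h : ∀ st, Fn prog 9 (.cons (records G vl) (.cons (records G vl) (encPair vl st)))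
      (encPair vl ((step G)^[Fintype.card V] st))
      (loopCost vl.length (chosenCost vl.length + keepCost vl.length + 100)) := by
    intro st
    refine (Fn.fold (k := encPair vl) (f := fun _ s => step G s) rfl (fun v _ s => ?_) st).congr ?_
    · refine (Ev.cons (Ev.call .path (fn_chosen hvl s))
        (Ev.call .path (fn_keep hvl s))).mono ?_
      simp only [Expr.pathCost, arg]
      omega
    · rw [foldl_const, hcard]
  refine ⟨_, rfl, (Ev.congr (Ev.call (Ev.cons .path (Ev.cons .path
    (Ev.call .path (h st)))) (h _)) ?_).mono ?_⟩
  · rw [norm, Function.iterate_add_apply]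
  · simp only [Expr.pathCost, normCost, arg]
    omega

/-- The cost of computing the core. -/
def coreCost (n : ℕ) : ℕ := loopCost n (loopCost n (6 * bitCost n + 100) + 100)

theorem fn_core {vl : List V} (hvl : ∀ v, v ∈ vl) (hcard : vl.length = Fintype.card V)
    (U : Finset V) :
    Fn prog 12 (.cons (records G vl) (.cons (records G vl) (enc vl U))) (enc vl (core G U))
      (coreCost vl.length) := by
  have h : ∀ C, Fn prog 11 (.cons (enc vl C) (records G vl)) (enc vl (coreStep G C))
      (loopCost vl.length (6 * bitCost vl.length + 100)) := by
    intro C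
    refine (Fn.map (F := fun v => Val.ofBool (decide
        (v ∈ C ∧ (∃ u ∈ C, G.Adj u v) ∧ ∃ u ∈ C, G.Adj v u))) rfl
      fun v _ => ?_).congr (ofList_map_eq_enc (by simp [coreStep]))
    refine ((Ev.and (ev_mem hvl (v := v) (Y := C) .path .path)
      (Ev.and (ev_meets hvl (X := inNbrs G Finset.univ v) (Y := C) .path .path)
      (ev_meets hvl (X := outNbrs G Finset.univ v) (Y := C) .path .path))).congr
      (ofBool_congr ?_)).mono ?_
    · simp [mem_inNbrs, mem_outNbrs, and_comm]
    · simp only [Expr.pathCost, selfE, inE, outE, arg]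
      omega
  refine (Fn.fold (k := enc vl) (f := fun _ s => coreStep G s) rfl (fun v _ s => ?_) U).congr ?_
  · refine (Ev.call .path (h s)).mono ?_
    simp only [Expr.pathCost, arg]
    omega
  · rw [foldl_const, hcard, core]

/-- The cost of computing the measure. -/
def muCost (n : ℕ) : ℕ := normCost n + coreCost n + bitCost n + loopCost n 0 + 100

theorem fn_mu {vl : List V} (hvl : ∀ v, v ∈ vl) (hnd : vl.Nodup)
    (hcard : vl.length = Fintype.card V) (st : Finset V × Finset V) :
    Fn prog 14 (.cons (records G vl) (encPair vl st)) (unary (mu G st)) (muCost vl.length) := by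
  refine ⟨_, rfl, Ev.mono (Ev.letIn (Ev.call .path (fn_norm hvl hcard st))
    (Ev.call (Ev.call (Ev.cons .path (Ev.cons .path (ev_diff (X := (norm G st).2)
      (Y := (norm G st).1) .path .path))) (fn_core hvl hcard _)) (fn_card hvl hnd _))) ?_⟩
  simp only [Expr.pathCost, arg, muCost]
  omega

end Encoding

end Argumentation

namespace ConsProg

/-- The number of steps for building a value. -/
def valSize : Val → ℕ
  | .nil => 1
  | .cons v w => valSize v + valSize w + 1

theorem Ev.const {P : Program} {env : List Val} (v : Val) :
    Ev P env (constE v) v (valSize v) := by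
  induction v with
  | nil => exact .nil
  | cons v w ih₁ ih₂ => exact ih₁.cons ih₂

theorem fn_append {α : Type*} (g : α → Val) (l l' : List α) :
    Fn prog 16 (.cons (.ofList (l.map g)) (.ofList (l'.map g))) (.ofList ((l ++ l').map g))
      (loopCost l.length 0) := by
  refine ⟨_, rfl, ?_⟩
  induction l with
  | nil => exact (Ev.iteNil .path .path).mono (by simp [loopCost, Expr.pathCost, arg])
  | cons a l ih =>
    rw [List.length_cons, loopCost_succ]
    refine Ev.mono (Ev.iteCons .path (Ev.cons .path (Ev.call .path ⟨_, rfl, ih⟩))) ?_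
    simp only [Expr.pathCost, arg]
    omega

theorem unary_succ (k : ℕ) : unary (k + 1) = .cons .nil (unary k) := rfl

theorem fn_unary_add (a b : ℕ) :
    Fn prog 16 (.cons (unary a) (unary b)) (unary (a + b)) (loopCost a 0) := by
  have := fn_append id (List.replicate a Val.nil) (List.replicate b Val.nil)
  simpa [unary] using this

theorem fn_unary_le (a b : ℕ) :
    Fn prog 17 (.cons (unary a) (unary b)) (Val.ofBool (decide (a ≤ b))) (loopCost a 0) := by
  refine ⟨_, rfl, ?_⟩
  induction a generalizing b with
  | zero =>
    refine ((Ev.iteNil .path .truth).congr (by simp)).mono (by simp [loopCost, Expr.pathCost, arg])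
  | succ a ih =>
    rw [loopCost_succ]
    cases b with
    | zero =>
      refine ((Ev.iteCons .path (Ev.iteNil .path .nil)).congr (by simp [Val.ofBool])).mono ?_
      simp only [Expr.pathCost, arg]
      omega
    | succ b =>
      refine ((Ev.iteCons .path (Ev.iteCons .path (Ev.call .path ⟨_, rfl, ih b⟩))).congr
        (by simp)).mono ?_
      simp only [Expr.pathCost, arg]
      omega

/-- The cost of comparing the measures of the branches with a template. -/
def fitsCost (k n : ℕ) : ℕ := loopCost k (loopCost 8 0 + loopCost (8 + n) 0 + 20) + 10

theorem fn_fits {n : ℕ} (m : ℕ) (as ms : List ℕ) (has : ∀ a ∈ as, a ≤ 8) (hms : ∀ b ∈ ms, b ≤ n) :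
    Fn prog 18 (.cons (unary m) (.cons (.ofList (as.map unary)) (.ofList (ms.map unary))))
      (Val.ofBool (Argumentation.fits m as ms)) (fitsCost as.length n) := by
  refine ⟨_, rfl, ?_⟩
  unfold fitsCost
  induction as generalizing ms with
  | nil =>
    cases ms with
    | nil =>
      exact (Ev.iteNil .path (Ev.not (p := false) .path)).mono
        (by simp [loopCost, Expr.pathCost, arg])
    | cons b ms =>
      exact (Ev.iteNil .path (Ev.iteCons .path .nil)).mono
        (by simp [loopCost, Expr.pathCost, arg])
  | cons a as ih =>
    rw [List.length_cons, loopCost_succ]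
    cases ms with
    | nil =>
      refine (Ev.iteCons .path (Ev.iteNil .path .nil)).mono ?_
      simp only [Expr.pathCost, arg]
      omega
    | cons b ms =>
      have ha := has a (by simp)
      have hb := hms b (by simp)
      have h₁ : loopCost a 0 ≤ loopCost 8 0 := loopCost_mono ha le_rfl
      have h₂ : loopCost (a + b) 0 ≤ loopCost (8 + n) 0 := loopCost_mono (by omega) le_rfl
      have ih := ih ms (fun a h => has a (by simp [h])) (fun b h => hms b (by simp [h]))
      refine Ev.mono (Ev.iteCons .path (Ev.iteCons .path (Ev.and
        (Ev.call (Ev.cons (Ev.call .path (fn_unary_add a b)) .path) (fn_unary_le (a + b) m))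
        (Ev.call .path ⟨_, rfl, ih⟩)))) ?_
      simp only [Expr.pathCost, arg]
      omega

/-! ### Tries -/

/-- Inserts a bit vector into a trie. -/
def trieInsert : Val → List Bool → Val
  | _, [] => .cons .nil .nil
  | t, true :: bs => .cons t.fst (trieInsert t.snd bs)
  | t, false :: bs => .cons (trieInsert t.fst bs) t.snd

/-- Looks a bit vector up in a trie. -/
def trieLookup : Val → List Bool → Val
  | t, [] => t
  | t, true :: bs => trieLookup t.snd bs
  | t, false :: bs => trieLookup t.fst bs

theorem trieLookup_nil (bs : List Bool) : trieLookup .nil bs = .nil := by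
  induction bs with
  | nil => rfl
  | cons b bs ih => cases b <;> exact ih

theorem trieLookup_insert (t : Val) (bs cs : List Bool) (h : bs.length = cs.length) :
    trieLookup (trieInsert t bs) cs = if bs = cs then .cons .nil .nil else trieLookup t cs := by
  induction bs generalizing t cs with
  | nil =>
    obtain rfl : cs = [] := by simpa using h.symm
    simp [trieInsert, trieLookup]
  | cons b bs ih =>
    cases cs with
    | nil => simp at h
    | cons c cs =>
      have := fun t => ih t cs (by simpa using h)
      cases b <;> cases c <;> simp [trieInsert, trieLookup, this, Val.fst, Val.snd]

theorem fn_trieInsert (t : Val) (bs : List Bool) :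
    Fn prog 29 (.cons t (.ofList (bs.map Val.ofBool))) (trieInsert t bs)
      (loopCost bs.length 0) := by
  refine ⟨_, rfl, ?_⟩
  induction bs generalizing t with
  | nil => exact (Ev.iteNil .path .truth).mono (by simp [loopCost, Expr.pathCost, arg])
  | cons b bs ih =>
    rw [List.length_cons, loopCost_succ]
    cases b with
    | true =>
      refine Ev.mono (Ev.iteCons .path (Ev.iteCons .path (Ev.cons .path
        (Ev.call .path ⟨_, rfl, ih t.snd⟩)))) ?_
      simp only [Expr.pathCost, arg]
      omega
    | false =>
      refine Ev.mono (Ev.iteCons .path (Ev.iteNil .path (Ev.cons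
        (Ev.call .path ⟨_, rfl, ih t.fst⟩) .path))) ?_
      simp only [Expr.pathCost, arg]
      omega

theorem fn_trieLookup (t : Val) (bs : List Bool) :
    Fn prog 30 (.cons t (.ofList (bs.map Val.ofBool))) (trieLookup t bs)
      (loopCost bs.length 0) := by
  refine ⟨_, rfl, ?_⟩
  induction bs generalizing t with
  | nil => exact (Ev.iteNil .path .path).mono (by simp [loopCost, Expr.pathCost, arg])
  | cons b bs ih =>
    rw [List.length_cons, loopCost_succ]
    cases b with
    | true =>
      refine Ev.mono (Ev.iteCons .path (Ev.iteCons .path (Ev.call .path ⟨_, rfl, ih t.snd⟩))) ?_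
      simp only [Expr.pathCost, arg]
      omega
    | false =>
      refine Ev.mono (Ev.iteCons .path (Ev.iteNil .path (Ev.call .path ⟨_, rfl, ih t.fst⟩))) ?_
      simp only [Expr.pathCost, arg]
      omega

end ConsProg

namespace Argumentation

open ConsProg

section Search

open Classical

variable {V : Type*}

/-- The encoding of a plan. -/
noncomputable def encPlan (vl : List V) (ws : List V) : Val :=
  Val.ofList (ws.map fun w => enc vl {w})

/-- All lists that arise by putting a vertex in front of a member of `L`. -/
def extend (vl : List V) (L : List (List V)) : List (List V) :=
  vl.foldl (fun acc v => L.map (v :: ·) ++ acc) []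

theorem mem_extend {vl : List V} {L : List (List V)} {ws : List V} :
    ws ∈ extend vl L ↔ ∃ v ∈ vl, ∃ l ∈ L, ws = v :: l := by
  have h : ∀ acc, ws ∈ vl.foldl (fun acc v => L.map (v :: ·) ++ acc) acc ↔
      ws ∈ acc ∨ ∃ v ∈ vl, ∃ l ∈ L, ws = v :: l := by
    induction vl with
    | nil => simp
    | cons v vl ih =>
      intro acc
      rw [List.foldl_cons, ih]
      simp only [List.mem_append, List.mem_map, List.mem_cons, exists_eq_or_imp, eq_comm (a := ws)]
      rw [← or_assoc, or_comm (a := ws ∈ acc)]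
  rw [extend, h]
  simp

theorem length_extend (vl : List V) (L : List (List V)) :
    (extend vl L).length = vl.length * L.length := by
  have h : ∀ acc, (vl.foldl (fun acc v => L.map (v :: ·) ++ acc) acc).length =
      vl.length * L.length + acc.length := by
    induction vl with
    | nil => simp
    | cons v vl ih =>
      intro acc
      rw [List.foldl_cons, ih, List.length_append, List.length_map, List.length_cons]
      ring
  rw [extend, h]
  simp

/-- All plans with one to three members. -/
def allPlans (vl : List V) : List (List V) :=
  extend vl [[]] ++ (extend vl (extend vl [[]]) ++ extend vl (extend vl (extend vl [[]])))

theorem length_allPlans (vl : List V) :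
    (allPlans vl).length = vl.length + (vl.length ^ 2 + vl.length ^ 3) := by
  simp only [allPlans, List.length_append, length_extend, List.length_singleton]
  ring

theorem mem_allPlans {vl : List V} (hvl : ∀ v, v ∈ vl) {ws : List V} (h₁ : 1 ≤ ws.length)
    (h₃ : ws.length ≤ 3) : ws ∈ allPlans vl := by
  simp only [allPlans, List.mem_append, mem_extend]
  match ws with
  | [] => simp at h₁
  | [a] => simp [hvl]
  | [a, b] => simp [hvl]
  | [a, b, c] => simp [hvl]
  | _ :: _ :: _ :: _ :: _ =>
    simp only [List.length_cons] at h₃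
    omega

/-- The cost of extending `k` lists. -/
def extendCost (n k : ℕ) : ℕ := loopCost n (loopCost k 10 + loopCost k 0 + 50)

theorem singleton_union_eq_insert (w : V) (S : Finset V) : {w} ∪ S = insert w S := rfl

theorem enc_eq (vl : List V) (X : Finset V) :
    enc vl X = Val.ofList ((vl.map fun v => decide (v ∈ X)).map Val.ofBool) := by
  rw [List.map_map]
  simp only [enc]
  rfl

theorem enc_injective {vl : List V} (hvl : ∀ v, v ∈ vl) {X Y : Finset V}
    (h : (vl.map fun v => decide (v ∈ X)) = vl.map fun v => decide (v ∈ Y)) : X = Y := by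
  ext v
  have := List.map_inj_left.1 h v (hvl v)
  simpa using this

/-- A trie that contains the members of `R`. -/
def IsTrie (vl : List V) (t : Val) (R : List (Finset V)) : Prop :=
  ∀ X : Finset V, trieLookup t (vl.map fun v => decide (v ∈ X)) = Val.ofBool (decide (X ∈ R))

theorem fn_filter {vl : List V} {t : Val} {R : List (Finset V)}
    (ht : IsTrie vl t R) (L₀ L₁ : List (Finset V)) :
    Fn prog 32 (.cons t (.cons (.ofList (L₀.map (enc vl))) (.ofList (L₁.map (enc vl)))))
      (.ofList ((L₀.filter (· ∉ R) ++ L₁).map (enc vl)))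
      (loopCost L₀.length (loopCost vl.length 0 + 50)) := by
  refine ⟨_, rfl, ?_⟩
  induction L₀ with
  | nil => exact (Ev.iteNil .path .path).mono (by simp [loopCost, Expr.pathCost, arg])
  | cons X L ih =>
    rw [List.length_cons, loopCost_succ]
    have h := fn_trieLookup t (vl.map fun v => decide (v ∈ X))
    rw [ht X, ← enc_eq, List.length_map] at h
    refine Ev.mono (Ev.iteCons .path (Ev.ite
      (t := loopCost L.length (loopCost vl.length 0 + 50) + 30)
      (Ev.call .path h) (fun hX => ?_) fun hX => ?_)) ?_
    · rw [decide_eq_true_eq] at hX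
      refine ((Ev.call .path ⟨_, rfl, ih⟩).congr ?_).mono ?_
      · simp [hX]
      · simp only [Expr.pathCost, arg]
        omega
    · rw [decide_eq_false_iff_not] at hX
      refine ((Ev.cons .path (Ev.call .path ⟨_, rfl, ih⟩)).congr (v := .cons (enc vl X) _) ?_).mono ?_
      · simp [hX, Val.ofList]
      · simp only [Expr.pathCost, arg]
        omega
    · simp only [Expr.pathCost, arg]
      omega

variable [Fintype V] {G : Digraph V}

theorem fn_extend (vl : List V) (L : List (List V)) :
    Fn prog 22 (.cons (.ofList (L.map (encPlan vl))) (.cons (records G vl) .nil))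
      (.ofList ((extend vl L).map (encPlan vl))) (extendCost vl.length L.length) := by
  refine Fn.fold (k := fun acc : List (List V) => Val.ofList (acc.map (encPlan vl)))
    (f := fun v acc => L.map (v :: ·) ++ acc) rfl (fun v _ acc => ?_) []
  have h : Fn prog 21 (.cons (enc vl {v}) (.ofList (L.map (encPlan vl))))
      (.ofList ((L.map (v :: ·)).map (encPlan vl))) (loopCost L.length 10) := by
    refine (Fn.map (F := fun l => encPlan vl (v :: l)) rfl fun l _ => ?_).congr ?_
    · exact Ev.mono .path (by decide)
    · rw [List.map_map]
      rfl
  have h' := fn_append (encPlan vl) (L.map (v :: ·)) acc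
  rw [List.length_map] at h'
  refine (Ev.call (Ev.cons (Ev.call .path h) .path) h').mono ?_
  simp only [Expr.pathCost, arg, selfE]
  omega

/-- The cost of listing all plans. -/
def plansCost (n : ℕ) : ℕ :=
  extendCost n 1 + extendCost n n + extendCost n (n * n) + loopCost n 0 + loopCost (n * n) 0 + 100

theorem fn_allPlans (vl : List V) :
    Fn prog 23 (records G vl) (.ofList ((allPlans vl).map (encPlan vl)))
      (plansCost vl.length) := by
  have h₁ := fn_extend (G := G) vl [[]]
  have h₂ := fn_extend (G := G) vl (extend vl [[]])
  have h₃ := fn_extend (G := G) vl (extend vl (extend vl [[]]))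
  have h₄ := fn_append (encPlan vl) (extend vl (extend vl [[]]))
    (extend vl (extend vl (extend vl [[]])))
  have h₅ := fn_append (encPlan vl) (extend vl [[]]) (extend vl (extend vl [[]]) ++
    extend vl (extend vl (extend vl [[]])))
  simp only [length_extend, List.length_singleton, mul_one] at h₁ h₂ h₃ h₄ h₅
  refine ⟨_, rfl, (Ev.letIn (Ev.call .path h₁) (Ev.letIn (Ev.call .path h₂)
    (Ev.letIn (Ev.call .path h₃) (Ev.call (Ev.cons .path (Ev.call .path h₄)) h₅)))).mono ?_⟩
  simp only [Expr.pathCost, arg, plansCost]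
  omega

/-- The cost of computing the measures of the branches of a plan with `k` members. -/
def musCost (n k : ℕ) : ℕ := loopCost (k + 1) (muCost n + 2 * bitCost n + 60)

theorem fn_mus {vl : List V} (hvl : ∀ v, v ∈ vl) (hnd : vl.Nodup)
    (hcard : vl.length = Fintype.card V) (ws : List V) (st : Finset V × Finset V) :
    Fn prog 15 (.cons (records G vl) (.cons (encPair vl st) (encPlan vl ws)))
      (.ofList ((mus G ws st).map unary)) (musCost vl.length ws.length) := by
  refine ⟨_, rfl, ?_⟩
  unfold musCost
  induction ws generalizing st with
  | nil =>
    refine (Ev.iteNil .path (Ev.cons (Ev.call .path (fn_mu hvl hnd hcard st)) .nil)).mono ?_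
    simp only [Expr.pathCost, arg, loopCost, List.length_nil]
    omega
  | cons w ws ih =>
    rw [List.length_cons, loopCost_succ]
    have ih := ih (st.1, st.2.erase w)
    rw [Finset.erase_eq] at ih
    have hmu := fn_mu (G := G) hvl hnd hcard (insert w st.1, st.2)
    rw [← singleton_union_eq_insert] at hmu
    refine Ev.mono (Ev.congr (Ev.iteCons .path (Ev.cons
      (Ev.call (Ev.cons .path (Ev.cons (ev_union (X := {w}) (Y := st.1) .path .path) .path)) hmu)
      (Ev.call (Ev.cons .path (Ev.cons (Ev.cons .path (ev_diff (X := st.2) (Y := {w}) .path .path))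
        .path)) ⟨_, rfl, ih⟩))) ?_) ?_
    · rw [← Finset.erase_eq, singleton_union_eq_insert]
      rfl
    · simp only [Expr.pathCost, arg]
      omega

theorem mus_le (ws : List V) (st : Finset V × Finset V) :
    ∀ b ∈ mus G ws st, b ≤ Fintype.card V := by
  induction ws generalizing st with
  | nil => simpa [mus] using mu_le st
  | cons w ws ih =>
    simp only [mus, List.mem_cons, forall_eq_or_imp]
    exact ⟨mu_le _, ih _⟩

/-- The cost of comparing the measures of the branches with all templates. -/
def fitsAnyCost (n : ℕ) : ℕ := loopCost 7 (fitsCost 4 n + 30)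

/-- The cost of the search for a plan. -/
def findCost (n : ℕ) : ℕ :=
  loopCost (n + (n ^ 2 + n ^ 3))
    (musCost n 3 + fitsAnyCost n + valSize templatesVal + 60)

theorem Feasible.one_le_length {m : ℕ} {st : Finset V × Finset V} {ws : List V}
    (h : Feasible G m st ws) : 1 ≤ ws.length := by
  obtain ⟨as, has, h⟩ := h
  have := fits_length h
  rw [length_mus] at this
  have h2 : ∀ as ∈ templates, 2 ≤ as.length := by decide
  have := h2 as has
  omega

theorem fn_find {vl : List V} (hvl : ∀ v, v ∈ vl) (hnd : vl.Nodup)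
    (hcard : vl.length = Fintype.card V) (m : ℕ) (st : Finset V × Finset V)
    (hex : ∃ ws, Feasible G m st ws) :
    ∃ ws, Feasible G m st ws ∧
      Fn prog 20 (.cons (.cons (records G vl) (.cons (encPair vl st) (unary m)))
        (.ofList ((allPlans vl).map (encPlan vl)))) (encPlan vl ws) (findCost vl.length) := by
  have hfits : ∀ ws : List V, Fn prog 19
      (.cons (.cons (unary m) (.ofList ((mus G ws st).map unary))) templatesVal)
      (Val.ofBool (decide (Feasible G m st ws))) (fitsAnyCost vl.length) := by
    intro ws
    refine (Fn.any (c := fitsCost 4 vl.length + 30) (p := fun as => fits m as (mus G ws st))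
      (l := templates) rfl fun as has => ?_).congr
      (ofBool_congr (by simp [Feasible]))
    have h8 : ∀ as ∈ templates, ∀ a ∈ as, a ≤ 8 := by decide
    have h4 : ∀ as ∈ templates, as.length ≤ 4 := by decide
    refine (Ev.call .path (fn_fits (n := vl.length) m as (mus G ws st) (h8 as has) ?_)).mono ?_
    · rw [hcard]
      exact mus_le ws st
    · have : fitsCost as.length vl.length ≤ fitsCost 4 vl.length :=
        Nat.add_le_add_right (loopCost_mono (h4 as has) le_rfl) 10
      simp only [Expr.pathCost, arg]
      omega
  have key : ∀ ws ∈ allPlans vl, ws.length ≤ 3 := by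
    intro ws hws
    simp only [allPlans, List.mem_append, mem_extend] at hws
    rcases hws with ⟨_, _, _, h, rfl⟩ | ⟨_, _, _, ⟨_, _, _, h, rfl⟩, rfl⟩ |
      ⟨_, _, _, ⟨_, _, _, ⟨_, _, _, h, rfl⟩, rfl⟩, rfl⟩ <;> simp_all
  obtain ⟨ws, -, hws, hf⟩ := Fn.find (P := prog) (self := 20) (x := .cons (records G vl)
      (.cons (encPair vl st) (unary m))) (g := encPlan vl)
    (p := fun ws => decide (Feasible G m st ws)) (l := allPlans vl)
    (c := musCost vl.length 3 + fitsAnyCost vl.length + valSize templatesVal + 60) rfl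
    (fun ws hws => by
      have hle : musCost vl.length ws.length ≤ musCost vl.length 3 :=
        loopCost_mono (by have := key ws hws; omega) le_rfl
      refine (Ev.call (Ev.cons (Ev.cons .path (Ev.call .path (fn_mus hvl hnd hcard ws st)))
        (.const _)) (hfits ws)).mono ?_
      simp only [Expr.pathCost, arg]
      omega)
    (by
      obtain ⟨ws, hws⟩ := hex
      exact ⟨ws, mem_allPlans hvl hws.one_le_length hws.length_le, by simpa using hws⟩)
  refine ⟨ws, by simpa using hws, hf.mono ?_⟩
  rw [length_allPlans]
  rfl

/-- The cost of computing the largest subset that defends itself. -/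
def defendedCost (n : ℕ) : ℕ :=
  loopCost n (loopCost n (2 * bitCost n + loopCost n (4 * bitCost n + 100) + 100) + 100)

theorem fn_defended {vl : List V} (hvl : ∀ v, v ∈ vl) (hcard : vl.length = Fintype.card V)
    (X : Finset V) :
    Fn prog 26 (.cons (records G vl) (.cons (records G vl) (enc vl X))) (enc vl (defended G X))
      (defendedCost vl.length) := by
  have h₁ : ∀ X v, Fn prog 24 (.cons (.cons (enc vl X) (record G vl v)) (records G vl))
      (Val.ofBool (decide (∃ u, G.Adj u v ∧ ¬ ∃ w ∈ X, G.Adj w u)))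
      (loopCost vl.length (4 * bitCost vl.length + 100)) := by
    intro X v
    refine (Fn.any (p := fun u => decide (G.Adj u v ∧ ¬ ∃ w ∈ X, G.Adj w u)) rfl
      fun u _ => ?_).congr (ofBool_any hvl Iff.rfl)
    refine ((Ev.and (ev_mem hvl (v := u) (Y := inNbrs G Finset.univ v) .path .path)
      (Ev.not (ev_meets hvl (X := inNbrs G Finset.univ u) (Y := X) .path .path))).congr
      (ofBool_congr ?_)).mono ?_
    · simp [mem_inNbrs]
      grind
    · simp only [Expr.pathCost, selfE, inE, arg]
      omega
  have h₂ : ∀ X, Fn prog 25 (.cons (.cons (records G vl) (enc vl X)) (records G vl))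
      (enc vl (accStep G X))
      (loopCost vl.length (2 * bitCost vl.length + loopCost vl.length
        (4 * bitCost vl.length + 100) + 100)) := by
    intro X
    refine (Fn.map (F := fun v => Val.ofBool (decide
        (v ∈ X ∧ ∀ u, G.Adj u v → ∃ w ∈ X, G.Adj w u))) rfl
      fun v _ => ?_).congr (ofList_map_eq_enc (by simp [accStep]))
    refine ((Ev.and (ev_mem hvl (v := v) (Y := X) .path .path)
      (Ev.not (Ev.call .path (h₁ X v)))).congr (ofBool_congr ?_)).mono ?_
    · simp
    · simp only [Expr.pathCost, selfE, arg]
      omega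
  refine (Fn.fold (k := enc vl) (f := fun _ s => accStep G s) rfl (fun v _ s => ?_) X).congr ?_
  · refine (Ev.call .path (h₂ s)).mono ?_
    simp only [Expr.pathCost, arg]
    omega
  · rw [foldl_const, hcard, defended]

/-- The cost of the case of an empty core. -/
def leafCost (n : ℕ) : ℕ := loopCost n (4 * bitCost n + 50) + defendedCost n + 2 * bitCost n + 100

theorem fn_leaf {vl : List V} (hvl : ∀ v, v ∈ vl) (hcard : vl.length = Fintype.card V)
    (st : Finset V × Finset V) :
    Fn prog 28 (.cons (records G vl) (encPair vl st))
      (.ofList ((if ConflictFree G (st.2 : Set V) ∧ st.1 ⊆ defended G st.2 then [defended G st.2]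
        else []).map (enc vl))) (leafCost vl.length) := by
  have h₁ : Fn prog 27 (.cons (enc vl st.2) (records G vl))
      (Val.ofBool (decide (¬ ConflictFree G (st.2 : Set V))))
      (loopCost vl.length (4 * bitCost vl.length + 50)) := by
    refine (Fn.any (p := fun v => decide (v ∈ st.2 ∧ ∃ u ∈ st.2, Nbr G v u)) rfl
      fun v _ => ?_).congr (ofBool_any hvl ?_)
    · refine ((Ev.and (ev_mem hvl (v := v) (Y := st.2) .path .path)
        (ev_meets hvl (X := inNbrs G Finset.univ v ∪ outNbrs G Finset.univ v) (Y := st.2)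
          .path .path)).congr (ofBool_congr ?_)).mono ?_
      · simp [mem_inNbrs, mem_outNbrs, Nbr]
        grind
      · simp only [Expr.pathCost, selfE, nbrE, arg]
        omega
    · simp only [ConflictFree, Nbr, Finset.mem_coe]
      push Not
      grind
  refine ⟨_, rfl, Ev.mono (Ev.ite (t := defendedCost vl.length + 2 * bitCost vl.length + 60)
    (Ev.call .path h₁) (fun h => ?_) fun h => ?_) ?_⟩
  · refine (Ev.nil.congr ?_).mono (by omega)
    rw [decide_eq_true_eq] at h
    simp [h, Val.ofList]
  · rw [decide_eq_false_iff_not, not_not] at h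
    refine Ev.mono (Ev.letIn (Ev.call .path (fn_defended hvl hcard st.2))
      (Ev.ite (t := 10) (ev_nonempty hvl (ev_diff (X := st.1) (Y := defended G st.2) .path .path))
        (fun h' => ?_) fun h' => ?_)) ?_
    · refine (Ev.nil.congr ?_).mono (by omega)
      have : ¬ st.1 ⊆ defended G st.2 := by
        simpa [Finset.not_subset] using h'
      simp [this, Val.ofList]
    · refine (Ev.congr (Ev.cons .path .nil) ?_).mono (by simp [Expr.pathCost])
      have : st.1 ⊆ defended G st.2 := by
        intro x hx
        by_contra hx'
        simp only [Finset.mem_sdiff, decide_eq_false_iff_not, not_exists] at h'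
        exact h' x ⟨hx, hx'⟩
      simp only [h, this, and_self, if_true]
      rfl
    · simp only [Expr.pathCost, arg]
      omega
  · simp only [Expr.pathCost, arg, leafCost]
    omega

/-- The cost of inserting a set into the trie. -/
def rhoCost (n : ℕ) : ℕ := defendedCost n + bitCost n + loopCost n 0 + 50

theorem fn_trie {vl : List V} (hvl : ∀ v, v ∈ vl) (hcard : vl.length = Fintype.card V) (w : V)
    (L : List (Finset V)) :
    ∃ t, IsTrie vl t (L.map fun T => defended G (T.erase w)) ∧
      Fn prog 31 (.cons (.cons (records G vl) (enc vl {w})) (.cons (.ofList (L.map (enc vl))) .nil))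
        t (loopCost L.length (rhoCost vl.length)) := by
  let f : Finset V → Val → Val := fun T t =>
    trieInsert t (vl.map fun v => decide (v ∈ defended G (T.erase w)))
  refine ⟨L.foldl (fun t T => f T t) .nil, ?_, Fn.fold (k := id) (f := f) rfl
    (fun T _ t => ?_) .nil⟩
  · have h : ∀ (L R : List (Finset V)) (t : Val), IsTrie vl t R →
        IsTrie vl (L.foldl (fun t T => f T t) t)
          ((L.map fun T => defended G (T.erase w)).reverse ++ R) := by
      intro L
      induction L with
      | nil => exact fun R t ht => ht
      | cons T L ih =>
        intro R t ht
        rw [List.foldl_cons, List.map_cons, List.reverse_cons, List.append_assoc]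
        refine ih _ _ fun X => ?_
        rw [trieLookup_insert _ _ _ (by simp), ht X]
        by_cases hX : X = defended G (T.erase w)
        · subst hX
          simp [Val.ofBool]
        · rw [if_neg fun h => hX (enc_injective hvl h).symm]
          refine ofBool_congr ?_
          simp [hX]
    have := h L [] .nil fun X => by simp [trieLookup_nil, Val.ofBool]
    intro X
    rw [this X]
    refine ofBool_congr ?_
    simp
  · have h₁ := fn_defended (G := G) hvl hcard (T.erase w)
    rw [enc_eq vl (defended G (T.erase w)), Finset.erase_eq] at h₁
    have h₂ := fn_trieInsert t (vl.map fun v => decide (v ∈ defended G (T \ {w})))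
    rw [List.length_map] at h₂
    refine ((Ev.call (Ev.cons .path (Ev.call (Ev.cons .path (Ev.cons .path
      (ev_diff (X := T) (Y := {w}) .path .path))) h₁)) h₂).congr ?_).mono ?_
    · simp only [f, Finset.erase_eq, id]
    · simp only [Expr.pathCost, arg, rhoCost]
      omega

end Search

end Argumentation

namespace Argumentation

open ConsProg

section Enumeration

open Classical

variable {V : Type*} [Fintype V] {G : Digraph V}

/-- `L` lists the maximal admissible sets between `S` and `Y`. -/
def Lists (G : Digraph V) (st : Finset V × Finset V) (L : List (Finset V)) : Prop :=
  L.Nodup ∧ ∀ T, T ∈ L ↔ MaxFam G st T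

theorem Lists.length_eq {st : Finset V × Finset V} {L : List (Finset V)} (h : Lists G st L) :
    L.length = count G st := by
  rw [count, ← List.toFinset_card_of_nodup h.1]
  congr 1
  ext T
  simp [h.2]

theorem Lists.branch {S Y : Finset V} {w : V} {L₀ L₁ : List (Finset V)}
    (h₁ : Lists G (insert w S, Y) L₁) (h₀ : Lists G (S, Y.erase w) L₀) :
    Lists G (S, Y)
      (L₀.filter (· ∉ L₁.map fun T => defended G (T.erase w)) ++ L₁) := by
  constructor
  · refine List.Nodup.append (h₀.1.filter _) h₁.1 fun T hT hT' => ?_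
    have hw₀ := ((h₀.2 T).1 (List.mem_filter.1 hT).1).prop.2.2
    have hw₁ := ((h₁.2 T).1 hT').prop.2.1
    exact Finset.notMem_erase w Y (hw₀ (hw₁ (Finset.mem_insert_self _ _)))
  · intro T
    rw [maxFam_branch w T, List.mem_append, List.mem_filter, h₀.2, h₁.2, or_comm]
    refine or_congr Iff.rfl (and_congr Iff.rfl ?_)
    simp only [decide_eq_true_eq, List.mem_map, h₁.2, not_exists, not_and, eq_comm (a := T), ne_eq]

/-- The cost per set of combining two branches. -/
def mergeCost (n : ℕ) : ℕ := rhoCost n + loopCost n 0 + 2 * bitCost n + 300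

/-- The cost of a node of the search tree. -/
def nodeCost (n : ℕ) : ℕ :=
  muCost n + normCost n + findCost n + plansCost n + leafCost n + 200 + 8 * mergeCost n

attribute [irreducible] mergeCost nodeCost

theorem fn_run {φ : ℝ} (hφ : 1.232 ≤ φ) (h8 : φ ^ 8 = φ ^ 7 + 1) (hG : IsOriented G)
    {vl : List V} (hvl : ∀ v, v ∈ vl) (hcard : vl.length = Fintype.card V) {m : ℕ} {b : ℝ}
    (ih : ∀ st : Finset V × Finset V, mu G st < m → ∃ L, Lists G st L ∧ ∃ c : ℕ,
      Fn prog 33 (.cons (records G vl) (encPair vl st)) (.ofList (L.map (enc vl))) c ∧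
      (c : ℝ) ≤ b * φ ^ mu G st)
    (ws : List V) (st : Finset V × Finset V) (h : ∀ b ∈ mus G ws st, b < m) :
    ∃ L, Lists G st L ∧ ∃ c : ℕ,
      Fn prog 34 (.cons (records G vl) (.cons (encPair vl st) (encPlan vl ws)))
        (.ofList (L.map (enc vl))) c ∧
      (c : ℝ) ≤ b * ((mus G ws st).map (φ ^ ·)).sum +
        (ws.length + 1) * (mergeCost vl.length * (1 + ((mus G ws st).map (φ ^ ·)).sum)) := by
  have hpow : ∀ k : ℕ, 0 ≤ φ ^ k := fun k => pow_nonneg (by linarith) k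
  induction ws generalizing st with
  | nil =>
    obtain ⟨L, hL, c, hc, hcb⟩ := ih st (by simpa [mus] using h)
    refine ⟨L, hL, c + 20, ⟨_, rfl, (Ev.iteNil .path (Ev.call .path hc)).mono ?_⟩, ?_⟩
    · simp only [Expr.pathCost, arg]
      omega
    · have h₁ : (300 : ℝ) ≤ mergeCost vl.length := by
        have : 300 ≤ mergeCost vl.length := by unfold mergeCost; omega
        exact_mod_cast this
      have h₂ : (mergeCost vl.length : ℝ) ≤ mergeCost vl.length * (1 + φ ^ mu G st) :=
        le_mul_of_one_le_right (by linarith) (by linarith [hpow (mu G st)])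
      simp only [mus, List.map_cons, List.map_nil, List.sum_cons, List.sum_nil, List.length_nil]
      push_cast
      linarith
  | cons w ws ihw =>
    simp only [mus, List.mem_cons, forall_eq_or_imp] at h
    obtain ⟨L₁, hL₁, c₁, hc₁, hcb₁⟩ := ih _ h.1
    obtain ⟨L₀, hL₀, c₀, hc₀, hcb₀⟩ := ihw (st.1, st.2.erase w) h.2
    obtain ⟨t, ht, hft⟩ := fn_trie (G := G) hvl hcard w L₁
    have hfilter := fn_filter ht L₀ L₁
    have len₁ : (L₁.length : ℝ) ≤ φ ^ mu G (insert w st.1, st.2) := by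
      rw [hL₁.length_eq]
      exact count_le hφ h8 hG _
    have len₀ : (L₀.length : ℝ) ≤ ((mus G ws (st.1, st.2.erase w)).map (φ ^ ·)).sum := by
      rw [hL₀.length_eq]
      exact count_le_sum (fun s _ => count_le hφ h8 hG s) ws _ h.2
    refine ⟨_, hL₁.branch hL₀, c₁ + c₀ + loopCost L₁.length (rhoCost vl.length) +
      loopCost L₀.length (loopCost vl.length 0 + 50) + 2 * bitCost vl.length + 200,
      ⟨_, rfl, ?_⟩, ?_⟩
    · rw [← singleton_union_eq_insert] at hc₁
      rw [Finset.erase_eq] at hc₀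
      refine Ev.mono (Ev.iteCons .path (Ev.letIn
        (Ev.call (Ev.cons .path (Ev.cons (ev_union (X := {w}) (Y := st.1) .path .path) .path)) hc₁)
        (Ev.letIn (Ev.call (Ev.cons .path (Ev.cons (Ev.cons .path
          (ev_diff (X := st.2) (Y := {w}) .path .path)) .path)) hc₀)
        (Ev.letIn (Ev.call .path hft) (Ev.call .path hfilter))))) ?_
      simp only [Expr.pathCost, arg]
      omega
    · simp only [mus, List.map_cons, List.sum_cons, List.length_cons]
      set s := ((mus G ws (st.1, st.2.erase w)).map (φ ^ ·)).sum with hs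
      set p := φ ^ mu G (insert w st.1, st.2) with hp
      have hp0 : 0 ≤ p := hpow _
      have hs0 : 0 ≤ s := le_trans (Nat.cast_nonneg _) len₀
      have hK0 : (0 : ℝ) ≤ mergeCost vl.length := Nat.cast_nonneg _
      have hmerge : (loopCost L₁.length (rhoCost vl.length) +
          loopCost L₀.length (loopCost vl.length 0 + 50) + 2 * bitCost vl.length + 200 : ℝ) ≤
          mergeCost vl.length * (1 + L₁.length + L₀.length) := by
        have : loopCost L₁.length (rhoCost vl.length) +
            loopCost L₀.length (loopCost vl.length 0 + 50) + 2 * bitCost vl.length + 200 ≤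
            mergeCost vl.length * (1 + L₁.length + L₀.length) := by
          have h₁ : loopCost L₁.length (rhoCost vl.length) ≤
              mergeCost vl.length * L₁.length + 10 := by
            rw [loopCost, mul_comm]
            gcongr
            unfold mergeCost
            omega
          have h₀ : loopCost L₀.length (loopCost vl.length 0 + 50) ≤
              mergeCost vl.length * L₀.length + 10 := by
            rw [loopCost, mul_comm]
            gcongr
            unfold mergeCost
            omega
          have h : 2 * bitCost vl.length + 220 ≤ mergeCost vl.length := by
            unfold mergeCost
            omega
          rw [mul_add, mul_add, mul_one]
          omega
        exact_mod_cast this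
      have hmerge' : (mergeCost vl.length * (1 + L₁.length + L₀.length) : ℝ) ≤
          mergeCost vl.length * (1 + (p + s)) := by
        refine mul_le_mul_of_nonneg_left ?_ hK0
        linarith
      have hlast : (ws.length + 1 : ℝ) * (mergeCost vl.length * (1 + s)) ≤
          (ws.length + 1) * (mergeCost vl.length * (1 + (p + s))) := by
        refine mul_le_mul_of_nonneg_left (mul_le_mul_of_nonneg_left ?_ hK0) (by positivity)
        linarith
      push_cast
      linarith

theorem fn_enum {φ : ℝ} (hφ : 1.232 ≤ φ) (h8 : φ ^ 8 = φ ^ 7 + 1) (hG : IsOriented G)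
    {vl : List V} (hvl : ∀ v, v ∈ vl) (hnd : vl.Nodup) (hcard : vl.length = Fintype.card V)
    (st : Finset V × Finset V) :
    ∃ L, Lists G st L ∧ ∃ c : ℕ,
      Fn prog 33 (.cons (records G vl) (encPair vl st)) (.ofList (L.map (enc vl))) c ∧
      (c : ℝ) ≤ nodeCost vl.length * (mu G st + 1) * φ ^ mu G st := by
  have hpow : ∀ k : ℕ, 1 ≤ φ ^ k := fun k => one_le_pow₀ (by linarith)
  have hnode : (0 : ℝ) ≤ nodeCost vl.length := Nat.cast_nonneg _
  induction hm : mu G st using Nat.strong_induction_on generalizing st with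
  | _ m ih =>
    have hmu := fn_mu (G := G) hvl hnd hcard st
    have hnorm := fn_norm (G := G) hvl hcard st
    rw [hm] at hmu
    rcases (core G ((norm G st).2 \ (norm G st).1)).eq_empty_or_nonempty with h | h
    · obtain rfl : m = 0 := by
        rw [← hm, mu, h, Finset.card_empty]
      refine ⟨_, ⟨?_, fun T => ?_⟩, _, ⟨_, rfl, Ev.letIn (Ev.call .path hmu)
        (Ev.iteNil .path (Ev.call (Ev.cons .path (Ev.call .path hnorm))
          (fn_leaf hvl hcard (norm G st))))⟩, ?_⟩
      · split_ifs <;> simp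
      · rw [← maxFam_norm, maxFam_of_core_eq_empty (step_norm st) h, ← and_assoc]
        split_ifs with h' <;> simp [h']
      · simp only [pow_zero, mul_one, CharP.cast_eq_zero, zero_add]
        have h' : (muCost vl.length + normCost vl.length + leafCost vl.length + 150 : ℝ) ≤
            nodeCost vl.length := by
          have : muCost vl.length + normCost vl.length + leafCost vl.length + 150 ≤
              nodeCost vl.length := by
            unfold nodeCost
            omega
          exact_mod_cast this
        simp only [Expr.pathCost, arg]
        push_cast
        linarith
    · obtain ⟨k, rfl⟩ : ∃ k, m = k + 1 := by
        have := Finset.card_pos.2 h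
        rw [mu] at hm
        exact ⟨m - 1, by omega⟩
      have hex := exists_feasible hG (step_norm st) h
      have hmu' : (core G ((norm G st).2 \ (norm G st).1)).card = k + 1 := hm
      rw [hmu'] at hex
      obtain ⟨ws, hws, hfind⟩ := fn_find hvl hnd hcard (k + 1) (norm G st) hex
      obtain ⟨L, hL, c, hc, hcb⟩ := fn_run hφ h8 hG hvl hcard (m := k + 1)
        (b := nodeCost vl.length * (k + 1)) (fun s hs => by
          obtain ⟨L, hL, c, hc, hcb⟩ := ih _ hs s rfl
          refine ⟨L, hL, c, hc, hcb.trans ?_⟩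
          refine mul_le_mul_of_nonneg_right (mul_le_mul_of_nonneg_left ?_ hnode)
            (le_trans zero_le_one (hpow _))
          have : mu G s + 1 ≤ k + 1 := hs
          exact_mod_cast this) ws (norm G st) hws.lt
      refine ⟨L, ⟨hL.1, fun T => by rw [hL.2, maxFam_norm]⟩, _, ⟨_, rfl,
        Ev.letIn (Ev.call .path hmu) (Ev.iteCons (Ev.path (hv := unary_succ k))
          (Ev.letIn (Ev.call .path hnorm)
          (Ev.letIn (Ev.call (Ev.cons .path (Ev.call .path (fn_allPlans vl))) hfind)
            (Ev.call .path hc))))⟩, ?_⟩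
      have hsum := feasible_sum_le hφ h8 hws
      have hs0 : 0 ≤ ((mus G ws (norm G st)).map (φ ^ ·)).sum := by
        refine List.sum_nonneg fun x hx => ?_
        obtain ⟨b, -, rfl⟩ := List.mem_map.1 hx
        exact le_trans zero_le_one (hpow b)
      have hp1 := hpow (k + 1)
      generalize ((mus G ws (norm G st)).map (φ ^ ·)).sum = s at hsum hcb hs0
      generalize φ ^ (k + 1) = p at hsum hp1 ⊢
      have hlen : (ws.length : ℝ) + 1 ≤ 4 := by
        have := hws.length_le
        have : ws.length + 1 ≤ 4 := by omega
        exact_mod_cast this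
      have hK0 : (0 : ℝ) ≤ mergeCost vl.length := Nat.cast_nonneg _
      have h₁ : (nodeCost vl.length : ℝ) * (k + 1) * s ≤ nodeCost vl.length * (k + 1) * p :=
        mul_le_mul_of_nonneg_left hsum (by positivity)
      have h₂ : ((ws.length : ℝ) + 1) * (mergeCost vl.length * (1 + s)) ≤
          4 * (mergeCost vl.length * (p + p)) := by
        refine mul_le_mul hlen (mul_le_mul_of_nonneg_left ?_ hK0) (by positivity) (by norm_num)
        linarith
      have h₃ : ((nodeCost vl.length : ℝ) - 8 * mergeCost vl.length) * 1 ≤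
          (nodeCost vl.length - 8 * mergeCost vl.length) * p := by
        refine mul_le_mul_of_nonneg_left hp1 ?_
        rw [sub_nonneg]
        have : 8 * mergeCost vl.length ≤ nodeCost vl.length := by
          unfold nodeCost
          omega
        exact_mod_cast this
      have h₄ : (muCost vl.length + normCost vl.length + plansCost vl.length +
          findCost vl.length + 150 : ℝ) ≤ nodeCost vl.length - 8 * mergeCost vl.length := by
        rw [le_sub_iff_add_le]
        have : muCost vl.length + normCost vl.length + plansCost vl.length +
            findCost vl.length + 150 + 8 * mergeCost vl.length ≤ nodeCost vl.length := by
          unfold nodeCost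
          omega
        exact_mod_cast this
      simp only [Expr.pathCost, arg]
      push_cast
      linarith

end Enumeration

end Argumentation

/-! ## The main function -/

namespace Argumentation

open ConsProg

section Input

open Classical

variable {V : Type*}

theorem enc_def (vl : List V) (X : Finset V) :
    enc vl X = Val.ofList (vl.map fun v => Val.ofBool (decide (v ∈ X))) :=
  (ofList_map_eq_enc fun _ => Iff.rfl).symm

/-- The cost of computing the identity matrix. -/
def idCost (n : ℕ) : ℕ := loopCost n (2 * loopCost n 10 + 30)

theorem fn_zeros {α : Type*} (g : α → Val) (l : List α) :
    Fn prog 35 (.cons .nil (.ofList (l.map g))) (.ofList (l.map fun _ => Val.nil))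
      (loopCost l.length 10) :=
  Fn.map rfl fun _ _ => Ev.nil.mono (by norm_num)

theorem fn_ones {α : Type*} (g : α → Val) (l : List α) :
    Fn prog 36 (.cons .nil (.ofList (l.map g))) (.ofList (l.map fun _ => Val.ofBool true))
      (loopCost l.length 10) :=
  Fn.map rfl fun _ _ => Ev.truth.mono (by norm_num)

theorem fn_id {l : List V} (hl : l.Nodup) (g : V → Val) :
    Fn prog 38 (.ofList (l.map g)) (.ofList (l.map fun v => enc l {v})) (idCost l.length) := by
  suffices h : ∀ n, l.length ≤ n → Fn prog 38 (.ofList (l.map g))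
      (.ofList (l.map fun v => enc l {v})) (loopCost l.length (2 * loopCost n 10 + 30)) from
    h _ le_rfl
  intro n hn
  refine ⟨_, rfl, ?_⟩
  induction l with
  | nil => exact (Ev.iteNil .path .nil).mono (by simp [loopCost, Expr.pathCost, arg])
  | cons a l ih =>
    rw [List.length_cons, loopCost_succ]
    rw [List.length_cons] at hn
    have hmono : loopCost l.length 10 ≤ loopCost n 10 := loopCost_mono (by omega) le_rfl
    have hpush : Fn prog 37 (.cons .nil (.ofList (l.map fun v => enc l {v})))
        (.ofList (l.map fun v => .cons .nil (enc l {v}))) (loopCost l.length 10) :=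
      Fn.map rfl fun v _ => Ev.mono .path (by decide)
    have ha : a ∉ l := (List.nodup_cons.1 hl).1
    refine Ev.mono (Ev.congr (Ev.iteCons .path (Ev.cons (Ev.cons .truth
      (Ev.call .path (fn_zeros g l))) (Ev.call (Ev.cons .nil (Ev.call .path
        ⟨_, rfl, ih (List.nodup_cons.1 hl).2 (by omega)⟩)) hpush))) ?_) ?_
    · have h₁ : ∀ v ∈ l, enc (a :: l) {v} = .cons .nil (enc l {v}) := by
        intro v hv
        have : a ≠ v := fun h => ha (h ▸ hv)
        simp [enc_def, Val.ofList, Val.ofBool, this]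
      have h₂ : enc (a :: l) {a} = .cons (Val.ofBool true) (.ofList (l.map fun _ => Val.nil)) := by
        have : l.map (fun v => Val.ofBool (decide (v ∈ ({a} : Finset V)))) =
            l.map fun _ => Val.nil := by
          refine List.map_congr_left fun v hv => ?_
          have : v ≠ a := fun h => ha (h ▸ hv)
          simp [this, Val.ofBool]
        rw [enc_def, List.map_cons, this]
        simp [Val.ofList]
      rw [List.map_cons, List.map_congr_left h₁, h₂]
      rfl
    · simp only [Expr.pathCost, arg]
      omega

variable [Fintype V] {G : Digraph V}

/-- The cost of computing the records of the vertices. -/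
def recordsCost (n : ℕ) : ℕ :=
  idCost n + loopCost n (loopCost n (2 * bitCost n + 40) + 40) + loopCost n (bitCost n + 60) +
    loopCost n 40 + 2 * loopCost n 10 + 200

theorem fn_main {vl : List V} (hvl : ∀ v, v ∈ vl) (hnd : vl.Nodup) {y : Val} {c : ℕ}
    (h : Fn prog 33 (.cons (records G vl) (encPair vl (∅, Finset.univ))) y c) :
    Fn prog 0 (.ofList (vl.map fun v => enc vl (outNbrs G Finset.univ v))) y
      (recordsCost vl.length + c) := by
  have h₃₉ : ∀ v, Fn prog 39 (.cons (enc vl {v})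
      (.ofList (vl.map fun v => enc vl (outNbrs G Finset.univ v))))
      (enc vl (inNbrs G Finset.univ v)) (loopCost vl.length (2 * bitCost vl.length + 40)) := by
    intro v
    refine (Fn.map (F := fun u => Val.ofBool (decide (G.Adj u v))) rfl fun u _ => ?_).congr
      (ofList_map_eq_enc (by simp [mem_inNbrs]))
    refine ((ev_mem hvl (v := v) (Y := outNbrs G Finset.univ u) .path .path).congr
      (ofBool_congr ?_)).mono ?_
    · simp [mem_outNbrs]
    · simp only [Expr.pathCost, arg]
      omega
  have h₄₀ : Fn prog 40 (.cons (.ofList (vl.map fun v => enc vl (outNbrs G Finset.univ v)))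
      (.ofList (vl.map fun v => enc vl {v}))) (.ofList (vl.map fun v =>
        enc vl (inNbrs G Finset.univ v)))
      (loopCost vl.length (loopCost vl.length (2 * bitCost vl.length + 40) + 40)) := by
    refine Fn.map rfl fun v _ => (Ev.call .path (h₃₉ v)).mono ?_
    simp only [Expr.pathCost, arg]
    omega
  have h₄₁ : Fn prog 41 (.cons (.ofList (vl.map fun v => enc vl (inNbrs G Finset.univ v)))
      (.ofList (vl.map fun v => enc vl (outNbrs G Finset.univ v)))) (.ofList (vl.map fun v =>
        .cons (enc vl (inNbrs G Finset.univ v)) (.cons (enc vl (outNbrs G Finset.univ v))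
          (enc vl (inNbrs G Finset.univ v ∪ outNbrs G Finset.univ v)))))
      (loopCost vl.length (bitCost vl.length + 60)) := by
    refine Fn.zip rfl fun v _ x y => (Ev.cons .path (Ev.cons .path
      (ev_union (X := inNbrs G Finset.univ v) (Y := outNbrs G Finset.univ v) .path .path))).mono ?_
    simp only [Expr.pathCost, arg]
    omega
  have h₄₂ : Fn prog 42 (.cons (.ofList (vl.map fun v => enc vl {v})) (.ofList (vl.map fun v =>
        .cons (enc vl (inNbrs G Finset.univ v)) (.cons (enc vl (outNbrs G Finset.univ v))
          (enc vl (inNbrs G Finset.univ v ∪ outNbrs G Finset.univ v)))))) (records G vl)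
      (loopCost vl.length 40) :=
    Fn.zip rfl fun v _ x y => (Ev.cons .path .path).mono (by decide)
  have hzeros := fn_zeros (fun v => enc vl (outNbrs G Finset.univ v)) vl
  have hones := fn_ones (fun v => enc vl (outNbrs G Finset.univ v)) vl
  have h₀ : Val.ofList (vl.map fun _ => Val.nil) = enc vl ∅ := by
    simp [enc_def, Val.ofBool]
  have h₁ : Val.ofList (vl.map fun _ => Val.ofBool true) = enc vl Finset.univ := by
    simp [enc_def]
  rw [h₀] at hzeros
  rw [h₁] at hones
  refine ⟨_, rfl, Ev.mono (Ev.letIn (Ev.call .path (fn_id hnd _))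
    (Ev.letIn (Ev.call (Ev.cons .path (Ev.call (Ev.cons (Ev.call .path h₄₀) .path) h₄₁)) h₄₂)
      (Ev.call (Ev.cons .path (Ev.cons (Ev.call .path hzeros) (Ev.call .path hones))) h))) ?_⟩
  simp only [Expr.pathCost, arg, recordsCost]
  omega

end Input

/-! ### Polynomial bounds -/

/-- Functions given by a polynomial with natural coefficients. -/
def IsPoly (f : ℕ → ℕ) : Prop := ∃ q : Polynomial ℕ, ∀ n, f n = q.eval n

theorem IsPoly.const (c : ℕ) : IsPoly fun _ => c := ⟨Polynomial.C c, by simp⟩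

theorem IsPoly.id : IsPoly fun n => n := ⟨Polynomial.X, by simp⟩

theorem IsPoly.add {f g : ℕ → ℕ} (hf : IsPoly f) (hg : IsPoly g) : IsPoly fun n => f n + g n := by
  obtain ⟨p, hp⟩ := hf
  obtain ⟨q, hq⟩ := hg
  exact ⟨p + q, by simp [hp, hq]⟩

theorem IsPoly.mul {f g : ℕ → ℕ} (hf : IsPoly f) (hg : IsPoly g) : IsPoly fun n => f n * g n := by
  obtain ⟨p, hp⟩ := hf
  obtain ⟨q, hq⟩ := hg
  exact ⟨p * q, by simp [hp, hq]⟩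

theorem IsPoly.pow {f : ℕ → ℕ} (hf : IsPoly f) (k : ℕ) : IsPoly fun n => f n ^ k := by
  obtain ⟨p, hp⟩ := hf
  exact ⟨p ^ k, by simp [hp]⟩

theorem IsPoly.loopCost {f g : ℕ → ℕ} (hf : IsPoly f) (hg : IsPoly g) :
    IsPoly fun n => loopCost (f n) (g n) :=
  (hf.mul (hg.add (.const 40))).add (.const 10)

theorem isPoly_bitCost : IsPoly bitCost := IsPoly.id.loopCost (.const 20)

theorem isPoly_badCost : IsPoly badCost :=
  IsPoly.id.loopCost (((IsPoly.const 5).mul isPoly_bitCost).add (.const 100))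

theorem isPoly_keepCost : IsPoly keepCost :=
  IsPoly.id.loopCost ((((IsPoly.const 4).mul isPoly_bitCost).add isPoly_badCost).add (.const 100))

theorem isPoly_forcedCost : IsPoly forcedCost :=
  IsPoly.id.loopCost (((IsPoly.const 7).mul isPoly_bitCost).add (.const 100))

theorem isPoly_chosenCost : IsPoly chosenCost :=
  IsPoly.id.loopCost
    ((((IsPoly.const 2).mul isPoly_bitCost).add isPoly_forcedCost).add (.const 100))

theorem isPoly_normCost : IsPoly normCost :=
  ((IsPoly.const 2).mul (IsPoly.id.loopCost
    ((isPoly_chosenCost.add isPoly_keepCost).add (.const 100)))).add (.const 100)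

theorem isPoly_coreCost : IsPoly coreCost :=
  IsPoly.id.loopCost ((IsPoly.id.loopCost
    (((IsPoly.const 6).mul isPoly_bitCost).add (.const 100))).add (.const 100))

theorem isPoly_muCost : IsPoly muCost :=
  (((isPoly_normCost.add isPoly_coreCost).add isPoly_bitCost).add
    (IsPoly.id.loopCost (.const 0))).add (.const 100)

theorem isPoly_musCost (k : ℕ) : IsPoly fun n => musCost n k :=
  (IsPoly.const (k + 1)).loopCost
    ((isPoly_muCost.add ((IsPoly.const 2).mul isPoly_bitCost)).add (.const 60))

theorem isPoly_fitsCost (k : ℕ) : IsPoly (fitsCost k) :=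
  ((IsPoly.const k).loopCost (((IsPoly.const (loopCost 8 0)).add
    (((IsPoly.const 8).add .id).loopCost (.const 0))).add (.const 20))).add (.const 10)

theorem isPoly_findCost : IsPoly findCost :=
  (IsPoly.id.add ((IsPoly.id.pow 2).add (IsPoly.id.pow 3))).loopCost
    ((((isPoly_musCost 3).add ((IsPoly.const 7).loopCost ((isPoly_fitsCost 4).add (.const 30)))).add
      (.const _)).add (.const 60))

theorem isPoly_extendCost {f : ℕ → ℕ} (hf : IsPoly f) : IsPoly fun n => extendCost n (f n) :=
  IsPoly.id.loopCost (((hf.loopCost (.const 10)).add (hf.loopCost (.const 0))).add (.const 50))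

theorem isPoly_plansCost : IsPoly plansCost :=
  (((((isPoly_extendCost (.const 1)).add (isPoly_extendCost .id)).add
    (isPoly_extendCost (IsPoly.id.mul .id))).add (IsPoly.id.loopCost (.const 0))).add
      ((IsPoly.id.mul .id).loopCost (.const 0))).add (.const 100)

theorem isPoly_defendedCost : IsPoly defendedCost :=
  IsPoly.id.loopCost ((IsPoly.id.loopCost ((((IsPoly.const 2).mul isPoly_bitCost).add
    (IsPoly.id.loopCost (((IsPoly.const 4).mul isPoly_bitCost).add (.const 100)))).add
      (.const 100))).add (.const 100))

theorem isPoly_leafCost : IsPoly leafCost :=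
  (((IsPoly.id.loopCost (((IsPoly.const 4).mul isPoly_bitCost).add (.const 50))).add
    isPoly_defendedCost).add ((IsPoly.const 2).mul isPoly_bitCost)).add (.const 100)

theorem isPoly_mergeCost : IsPoly mergeCost := by
  have : IsPoly fun n => defendedCost n + bitCost n + loopCost n 0 + 50 + loopCost n 0 +
      2 * bitCost n + 300 :=
    ((((((isPoly_defendedCost.add isPoly_bitCost).add (IsPoly.id.loopCost (.const 0))).add
      (.const 50)).add (IsPoly.id.loopCost (.const 0))).add
        ((IsPoly.const 2).mul isPoly_bitCost)).add (.const 300))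
  obtain ⟨q, hq⟩ := this
  exact ⟨q, fun n => by rw [mergeCost, rhoCost]; exact hq n⟩

theorem isPoly_nodeCost : IsPoly nodeCost := by
  have : IsPoly fun n => muCost n + normCost n + findCost n + plansCost n + leafCost n + 200 +
      8 * mergeCost n :=
    ((((((isPoly_muCost.add isPoly_normCost).add isPoly_findCost).add isPoly_plansCost).add
      isPoly_leafCost).add (.const 200)).add ((IsPoly.const 8).mul isPoly_mergeCost))
  obtain ⟨q, hq⟩ := this
  exact ⟨q, fun n => by rw [nodeCost]; exact hq n⟩

theorem isPoly_idCost : IsPoly idCost :=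
  IsPoly.id.loopCost (((IsPoly.const 2).mul (IsPoly.id.loopCost (.const 10))).add (.const 30))

theorem isPoly_recordsCost : IsPoly recordsCost :=
  ((((isPoly_idCost.add (IsPoly.id.loopCost ((IsPoly.id.loopCost
    (((IsPoly.const 2).mul isPoly_bitCost).add (.const 40))).add (.const 40)))).add
      (IsPoly.id.loopCost (isPoly_bitCost.add (.const 60)))).add
        (IsPoly.id.loopCost (.const 40))).add
          ((IsPoly.const 2).mul (IsPoly.id.loopCost (.const 10)))).add (.const 200)

/-! ### The theorem -/

open Classical in
theorem encodeSet_coe {V : Type*} {n : ℕ} (e : Fin n ≃ V) (X : Finset V) :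
    encodeSet e (X : Set V) = enc (List.ofFn e) X := by
  rw [enc_def, List.map_ofFn, encodeSet]
  exact congrArg _ (congrArg _ (funext fun i => ofBool_congr (by simp)))

theorem enumeratesPreferredInTime.{u} {φ : ℝ} (hφ : 1.232 ≤ φ) (h8 : φ ^ 8 = φ ^ 7 + 1) :
    EnumeratesPreferredInTime.{u} prog φ := by
  obtain ⟨q, hq⟩ := (isPoly_nodeCost.mul (IsPoly.id.add (.const 1))).add
    (isPoly_recordsCost.add (.const 2))
  refine ⟨q, fun V n e G hG => ?_⟩
  let _ : Fintype V := Fintype.ofEquiv _ e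
  set vl := List.ofFn e with hvl_def
  have hvl : ∀ v, v ∈ vl := fun v => (List.mem_ofFn' _ _).2 ⟨e.symm v, by simp⟩
  have hnd : vl.Nodup := List.nodup_ofFn.2 e.injective
  have hlen : vl.length = n := List.length_ofFn
  have hcard : vl.length = Fintype.card V := by
    rw [hlen, ← Fintype.card_congr e, Fintype.card_fin]
  obtain ⟨L, hL, c, hc, hcb⟩ := fn_enum hφ h8 hG hvl hnd hcard (∅, Finset.univ)
  have hmain := fn_main hvl hnd hc
  have hinput : encodeDigraph e G =
      Val.ofList (vl.map fun v => enc vl (outNbrs G Finset.univ v)) := by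
    rw [encodeDigraph, hvl_def, List.map_ofFn]
    congr 2
    funext i
    rw [Function.comp_apply, ← encodeSet_coe]
    congr 1
    ext v
    simp [mem_outNbrs]
  rw [← hinput] at hmain
  obtain ⟨t, ht, hev⟩ := Ev.call (env := [encodeDigraph e G]) (a := .var 0) .path hmain
  refine ⟨_, t, hev, ⟨L.map fun T : Finset V => (T : Set V), ?_, fun S => ?_, ?_⟩, ?_⟩
  · exact hL.1.map Finset.coe_injective
  · rw [List.mem_map]
    constructor
    · rintro ⟨T, hT, rfl⟩
      exact (preferred_iff_maxFam T).2 ((hL.2 T).1 hT)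
    · intro hS
      have hcoe : ((Set.toFinite S).toFinset : Set V) = S := Set.Finite.coe_toFinset _
      refine ⟨(Set.toFinite S).toFinset, (hL.2 _).2 ((preferred_iff_maxFam _).1 ?_), hcoe⟩
      rw [hcoe]
      exact hS
  · rw [List.map_map]
    congr 2
    funext T
    exact (encodeSet_coe e T).symm
  · have hmu : mu G (∅, Finset.univ) ≤ n := by
      rw [← hlen, hcard]
      exact mu_le _
    have h₁ : (1 : ℝ) ≤ φ ^ n := one_le_pow₀ (by linarith)
    have h₂ : (c : ℝ) ≤ nodeCost n * (n + 1) * φ ^ n := by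
      rw [hlen] at hcb
      refine hcb.trans ?_
      have : (mu G (∅, Finset.univ) : ℝ) ≤ n := by exact_mod_cast hmu
      have : φ ^ mu G (∅, Finset.univ) ≤ φ ^ n := pow_le_pow_right₀ (by linarith) hmu
      gcongr
    have h₃ : (t : ℝ) ≤ c + (recordsCost n + 2) := by
      have : t ≤ c + (recordsCost n + 2) := by
        refine ht.trans ?_
        rw [hlen]
        simp only [Expr.pathCost]
        omega
      exact_mod_cast this
    have h₄ : (recordsCost n + 2 : ℝ) ≤ (recordsCost n + 2) * φ ^ n :=
      le_mul_of_one_le_right (by positivity) h₁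
    rw [← hq]
    push_cast
    linarith

end Argumentation

theorem mainTheorem1 :
    ∃ φ : ℝ,
      -- `φ` is the unique positive root, with its numerical value
      (0 < φ ∧ 1 - φ ^ (-1 : ℤ) - φ ^ (-8 : ℤ) = 0) ∧
      (∀ x : ℝ, 0 < x → 1 - x ^ (-1 : ℤ) - x ^ (-8 : ℤ) = 0 → x = φ) ∧
      |φ - 1.23205| < 0.000005 ∧ φ < 1.2321 ∧
      -- one algorithm lists the preferred extensions of all oriented graphs
      (∃ P : ConsProg.Program, Argumentation.EnumeratesPreferredInTime P φ) ∧
      -- the number of preferred extensions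
      (∀ (V : Type*) [Fintype V] (G : Digraph V), Argumentation.IsOriented G →
        ({S : Set V | Argumentation.Preferred G S}.ncard : ℝ) ≤ φ ^ Fintype.card V) := by
  obtain ⟨φ, h, huniq, hl, hr, h8⟩ := Argumentation.exists_root
  have hφ : 1.232 ≤ φ := by linarith
  refine ⟨φ, h, huniq, abs_lt.2 ⟨by linarith, by linarith⟩, by linarith,
    ⟨ConsProg.prog, Argumentation.enumeratesPreferredInTime hφ h8⟩, fun V _ G hG => ?_⟩
  exact Argumentation.ncard_preferred_le hφ h8 hG
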